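/- Let $0<q<1$, $[N]=\frac{q^{-N}-q^{N}}{q^{-1}-q}$, and let $\mathcal H$ be the Hilbert space with orthonormal basis $v^j_{x,y,\uparrow}$ ($0\le x\le 2j$, $0\le y\le 2j+1$) and $v^j_{x,y,\downarrow}$ ($0\le x\le 2j$, $0\le y\le 2j-1$), $j\in\{0,\frac12,1,\dots\}$. Let $\pi(a)=a_++a_-$ and $\pi(b)=b_++b_-$ be the generators of the spinor representation of $SU_q(2)$: with $p_\uparrow=q^{(x+y-2j-1)/2}$ and $p_\downarrow=q^{(x+y-2j)/2}$, $$a_+v^j_{x,y,\uparrow}=p_\uparrow[x+1]^{\frac12}\Big(\tfrac{q^{-j-1/2}[y+1]^{1/2}}{[2j+2]}v^{j+\frac12}_{x+1,y+1,\uparrow}+\tfrac{q^{1/2}[2j-y+1]^{1/2}}{[2j+1][2j+2]}v^{j+\frac12}_{x+1,y,\downarrow}\Big),\quad a_+v^j_{x,y,\downarrow}=p_\downarrow[x+1]^{\frac12}\tfrac{q^{-j}[y+1]^{1/2}}{[2j+1]}v^{j+\frac12}_{x+1,y+1,\downarrow},$$ $$a_-v^j_{x,y,\uparrow}=p_\uparrow[2j-x]^{\frac12}\tfrac{q^{j+1}[2j-y+1]^{1/2}}{[2j+1]}v^{j-\frac12}_{x,y,\uparrow},\quad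 a_-v^j_{x,y,\downarrow}=p_\downarrow[2j-x]^{\frac12}\Big(-\tfrac{q^{1/2}[y+1]^{1/2}}{[2j][2j+1]}v^{j-\frac12}_{x,y+1,\uparrow}+\tfrac{q^{j+1/2}[2j-y-1]^{1/2}}{[2j]}v^{j-\frac12}_{x,y,\downarrow}\Big),$$ $$b_+v^j_{x,y,\uparrow}=p_\uparrow[x+1]^{\frac12}\Big(\tfrac{[2j-y+2]^{1/2}}{[2j+2]}v^{j+\frac12}_{x+1,y,\uparrow}-\tfrac{q^{-j-1}[y]^{1/2}}{[2j+1][2j+2]}v^{j+\frac12}_{x+1,y-1,\downarrow}\Big),\quad b_+v^j_{x,y,\downarrow}=p_\downarrow[x+1]^{\frac12}\tfrac{q^{-1/2}[2j-y]^{1/2}}{[2j+1]}v^{j+\frac12}_{x+1,y,\downarrow},$$ $$b_-v^j_{x,y,\uparrow}=-p_\uparrow[2j-x]^{\frac12}\tfrac{q^{-1/2}[y]^{1/2}}{[2j+1]}v^{j-\frac12}_{x,y-1,\uparrow},\quad b_-v^j_{x,y,\downarrow}=-p_\downarrow[2j-x]^{\frac12}\Big(\tfrac{q^{j}[2j-y]^{1/2}}{[2j][2j+1]}v^{j-\frac12}_{x,y,\uparrow}+\tfrac{[y]^{1/2}}{[2j]}v^{j-\frac12}_{x,y-1,\downarrow}\Big)$$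 (vectors with labels out of range are zero). Let $\mathcal A$ be the unital $*$-algebra generated by $\pi(a),\pi(b)$, and let $D$ be the Dirac operator $Dv^j_{x,y,\uparrow}=(2j+\frac32)v^j_{x,y,\uparrow}$, $Dv^j_{x,y,\downarrow}=-(2j+\frac12)v^j_{x,y,\downarrow}$. Put $F=D/|D|$, $P=\frac12(1+F)$, $\delta(T)=[|D|,T]$, $\nabla(T)=[D^2,T]$. The function $z\mapsto\mathrm{Tr}(T|D|^{-z})$, defined for $\mathrm{Re}\,z$ large, is continued meromorphically to $\mathbb C$; $\int\!\!\!\!\!\!-\,T$ denotes its residue at $z=0$ and $\mathrm{Tr}(T|D|^{-z})|_{z=0}$ its value at $z=0$. For $a_i\in\mathcal A$ let $\chi_1(a_0,a_1)=\mathrm{Tr}(a_0[F,a_1])$; let the local cocycle be $\phi_{odd}=(\phi_1,\phi_3)$ with $$\phi_1(a_0,a_1)=\int\!\!\!\!\!\!-\,a_0[D,a_1]|D|^{-1}-\tfrac14\int\!\!\!\!\!\!-\,a_0\nabla([D,a_1])|D|^{-3}+\tfrac18\int\!\!\!\!\!\!-\,a_0\nabla^2([D,a_1])|D|^{-5},\quad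 \phi_3(a_0,\dots,a_3)=\tfrac1{12}\int\!\!\!\!\!\!-\,a_0[D,a_1][D,a_2][D,a_3]|D|^{-3};$$ let $\phi_{ev}=(\phi_0,\phi_2)$ and $\phi'_{ev}=(\phi'_0,\phi'_2)$ with $\phi_0(a)=\mathrm{Tr}(Fa|D|^{-z})|_{z=0}$, $\phi_0'(a)=\mathrm{Tr}(a|D|^{-z})|_{z=0}$, $\phi_2(a_0,a_1,a_2)=\frac1{24}\int\!\!\!\!\!\!-\,a_0\delta(a_1)\delta^2(a_2)F|D|^{-3}$, $\phi_2'=-\phi_2$; and let $$\psi_1(a_0,a_1)=2\int\!\!\!\!\!\!-\,a_0\delta(a_1)P|D|^{-1}-\int\!\!\!\!\!\!-\,a_0\delta^2(a_1)P|D|^{-2}+\tfrac23\int\!\!\!\!\!\!-\,a_0\delta^3(a_1)P|D|^{-3},\qquad \beta(a)=2\,\mathrm{Tr}(Pa|D|^{-z})|_{z=0}.$$ For an $n$-cochain $\varphi$ (a function of $a_0,\dots,a_n$) let $b$ be the Hochschild coboundary $$(b\varphi)(a_0,\dots,a_{n+1})=\sum_{j=0}^n(-1)^j\varphi(\dots,a_ja_{j+1},\dots)+(-1)^{n+1}\varphi(a_{n+1}a_0,a_1,\dots,a_n),$$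 and $B=NB_0$ with $(B_0\varphi)(a_0,\dots,a_{n-1})=\varphi(1,a_0,\dots,a_{n-1})-(-1)^n\varphi(a_0,\dots,a_{n-1},1)$ and $(N\psi)(a_0,\dots,a_{n-1})=\sum_{j=0}^{n-1}(-1)^{(n-1)j}\psi(a_j,\dots,a_{n-1},a_0,\dots,a_{j-1})$. Then for all arguments in $\mathcal A$ everything above is well defined: $a_0[F,a_1]$ is trace class, and for each operator $T$ occurring above $T|D|^{-z}$ is trace class for $\mathrm{Re}\,z$ large and its trace has a meromorphic continuation to $\mathbb C$, with at most a simple pole at $z=0$ where a residue is taken and regular at $z=0$ where a value is taken. Moreover $$\phi_{odd}=\psi_1-(b+B)\phi'_{ev},\qquad \phi_{odd}=\chi_1+(b+B)\phi_{ev},\qquad \chi_1=\psi_1-b\beta,$$ and $\psi_1$ is a $(b,B)$-cocycle: $b\psi_1=0$ and $B\psi_1=0$. -/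

import Mathlib

open Filter Topology
open scoped ComplexConjugate

noncomputable section

namespace QSU2

/-! ### Hochschild / cyclic cochains -/

/-- `n`-cochains on `R`: functions of `n + 1` arguments `a₀, …, aₙ`. -/
abbrev Cochain (R : Type) (n : ℕ) : Type := (Fin (n + 1) → R) → ℂ

section Cochains

variable {R : Type} [Semiring R]

/-- The Hochschild coboundary
`(bφ)(a₀,…,aₙ₊₁) = ∑_{j ≤ n} (-1)^j φ(…, a_j a_{j+1}, …) + (-1)^{n+1} φ(aₙ₊₁ a₀, a₁, …, aₙ)`. -/
def hochB {n : ℕ} (φ : Cochain R n) : Cochain R (n + 1) := fun a =>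
  (∑ j : Fin (n + 1), (-1 : ℂ) ^ (j : ℕ) * φ (Fin.contractNth j.castSucc (· * ·) a))
    + (-1 : ℂ) ^ (n + 1) *
      φ (Fin.cons (a (Fin.last (n + 1)) * a 0) (fun i : Fin n => a i.castSucc.succ))

/-- `(B₀φ)(a₀,…,aₙ) = φ(1,a₀,…,aₙ) - (-1)^{n+1} φ(a₀,…,aₙ,1)`. -/
def connesB0 {n : ℕ} (φ : Cochain R (n + 1)) : Cochain R n := fun a =>
  φ (Fin.cons 1 a) - (-1 : ℂ) ^ (n + 1) * φ (Fin.snoc a 1)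

/-- Cyclic antisymmetrisation `(Nψ)(a₀,…,aₙ) = ∑_{j ≤ n} (-1)^{n j} ψ(a_j,…,aₙ,a₀,…,a_{j-1})`
(addition in `Fin (n + 1)` is modulo `n + 1`). -/
def cyclicN {n : ℕ} (ψ : Cochain R n) : Cochain R n := fun a =>
  ∑ j : Fin (n + 1), (-1 : ℂ) ^ (n * (j : ℕ)) * ψ (fun i => a (i + j))

/-- Connes' operator `B = N B₀`. -/
def connesB {n : ℕ} (φ : Cochain R (n + 1)) : Cochain R n := cyclicN (connesB0 φ)

/-- The total coboundary `b + B` on families of cochains `(φ₀, φ₁, φ₂, …)`. -/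
def totalBoundary (φ : ∀ n, Cochain R n) : ∀ n, Cochain R n
  | 0 => connesB (φ 1)
  | n + 1 => hochB (φ n) + connesB (φ (n + 2))

end Cochains

/-! ### Spinors -/

/-- The labels `(j, x, y, s)` of the orthonormal basis, written with `n = 2j`:
`0 ≤ x ≤ 2j`; for `s = ↑` (`Sum.inl`) `0 ≤ y ≤ 2j + 1`, and for `s = ↓` (`Sum.inr`)
`0 ≤ y ≤ 2j - 1`. -/
abbrev Idx : Type := Σ n : ℕ, Fin (n + 1) × (Fin (n + 2) ⊕ Fin n)

/-- The Hilbert space of spinors `ℋ = ℓ²(Idx)`. -/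
abbrev Hilb : Type := lp (fun _ : Idx => ℂ) 2

/-- The linear span of the orthonormal basis: a dense subspace of `ℋ`, contained in the
smooth domain `ℋ^∞`, a core for `|D|`, and invariant under all operators used below. -/
abbrev Core : Type := Idx →₀ ℂ

/-- Operators on the core. -/
abbrev Op : Type := Module.End ℂ Core

/-- The basis vector `v_{x,y,↑}^{n/2}` (zero if the label is out of range). -/
def vUp (n x y : ℕ) : Core :=
  if h : x < n + 1 ∧ y < n + 2 then
    Finsupp.single ⟨n, ⟨x, h.1⟩, Sum.inl ⟨y, h.2⟩⟩ 1 else 0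

/-- The basis vector `v_{x,y,↓}^{n/2}` (zero if the label is out of range). -/
def vDn (n x y : ℕ) : Core :=
  if h : x < n + 1 ∧ y < n then
    Finsupp.single ⟨n, ⟨x, h.1⟩, Sum.inr ⟨y, h.2⟩⟩ 1 else 0

/-- The operator with prescribed values on the basis vectors `v_{x,y,↑}^{n/2}`
and `v_{x,y,↓}^{n/2}`. -/
def opOfBasis (up dn : ℕ → ℕ → ℕ → Core) : Op :=
  Finsupp.linearCombination ℂ fun i : Idx =>
    match i with
    | ⟨n, x, Sum.inl y⟩ => up n x y
    | ⟨n, x, Sum.inr y⟩ => dn n x y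

/-- The diagonal operator with eigenvalues `f i`. -/
def diag (f : Idx → ℂ) : Op :=
  Finsupp.linearCombination ℂ fun i => Finsupp.single i (f i)

/-- The matrix entry `⟨v_i, T v_k⟩`. -/
def entry (T : Op) (i k : Idx) : ℂ := T (Finsupp.single k 1) i

/-! ### The Dirac operator -/

/-- Eigenvalues of `D`: `2j + 3/2` on `↑`, `-(2j + 1/2)` on `↓`. -/
def eig : Idx → ℝ
  | ⟨n, _, Sum.inl _⟩ => n + 3 / 2
  | ⟨n, _, Sum.inr _⟩ => -(n + 1 / 2)

/-- The Dirac operator. -/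
def D : Op := diag fun i => (eig i : ℂ)

/-- The complex powers `|D|^z`. -/
def absDPow (z : ℂ) : Op := diag fun i => ((|eig i| : ℝ) : ℂ) ^ z

/-- `|D|`. -/
def absD : Op := diag fun i => ((|eig i| : ℝ) : ℂ)

/-- `F = D / |D|`. -/
def F : Op := diag fun i => ((eig i / |eig i| : ℝ) : ℂ)

/-- The projection `P = (1 + F) / 2`. -/
def P : Op := (1 / 2 : ℂ) • (1 + F)

/-- The commutator. -/
def comm (S T : Op) : Op := S * T - T * S

/-- `δ(T) = [|D|, T]`. -/
def δ (T : Op) : Op := comm absD T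

/-- `∇(T) = [D², T]`. -/
def nabla (T : Op) : Op := comm (D * D) T

/-! ### The algebra -/

/-- The `q`-number `[N] = (q^{-N} - q^N) / (q^{-1} - q)`. -/
def qnum (q : ℝ) (N : ℤ) : ℝ := (q ^ (-N) - q ^ N) / (q⁻¹ - q)

/-- `[N]^{1/2}`. -/
def sq (q : ℝ) (N : ℤ) : ℝ := Real.sqrt (qnum q N)

/-- The prefactor `q^{(x+y-2j-1)/2}` for `s = ↑`. -/
def preUp (q : ℝ) (n x y : ℕ) : ℝ := q ^ (((x : ℝ) + y - n - 1) / 2)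

/-- The prefactor `q^{(x+y-2j)/2}` for `s = ↓`. -/
def preDn (q : ℝ) (n x y : ℕ) : ℝ := q ^ (((x : ℝ) + y - n) / 2)

/-- `a₊`. -/
def aPlus (q : ℝ) : Op := opOfBasis
  (fun n x y => ((preUp q n x y * sq q (x + 1) : ℝ) : ℂ) •
    (((q ^ (-(n + 1 : ℝ) / 2) * sq q (y + 1) / qnum q (n + 2) : ℝ) : ℂ) • vUp (n + 1) (x + 1) (y + 1)
      + ((q ^ (1 / 2 : ℝ) * sq q (n - y + 1) / (qnum q (n + 1) * qnum q (n + 2)) : ℝ) : ℂ) •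
        vDn (n + 1) (x + 1) y))
  (fun n x y => ((preDn q n x y * sq q (x + 1) : ℝ) : ℂ) •
    (((q ^ (-(n : ℝ) / 2) * sq q (y + 1) / qnum q (n + 1) : ℝ) : ℂ) • vDn (n + 1) (x + 1) (y + 1)))

/-- `a₋`. In this and the next operators a truncated subtraction `n - 1` or `y - 1` of natural
numbers (at `n = 0` or `y = 0`) only occurs next to a vanishing coefficient. -/
def aMinus (q : ℝ) : Op := opOfBasis
  (fun n x y => ((preUp q n x y * sq q (n - x) : ℝ) : ℂ) •
    (((q ^ ((n : ℝ) / 2 + 1) * sq q (n - y + 1) / qnum q (n + 1) : ℝ) : ℂ) • vUp (n - 1) x y))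
  (fun n x y => ((preDn q n x y * sq q (n - x) : ℝ) : ℂ) •
    (-((q ^ (1 / 2 : ℝ) * sq q (y + 1) / (qnum q n * qnum q (n + 1)) : ℝ) : ℂ) • vUp (n - 1) x (y + 1)
      + ((q ^ (((n : ℝ) + 1) / 2) * sq q (n - y - 1) / qnum q n : ℝ) : ℂ) • vDn (n - 1) x y))

/-- `b₊`. -/
def bPlus (q : ℝ) : Op := opOfBasis
  (fun n x y => ((preUp q n x y * sq q (x + 1) : ℝ) : ℂ) •
    (((sq q (n - y + 2) / qnum q (n + 2) : ℝ) : ℂ) • vUp (n + 1) (x + 1) y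
      - ((q ^ (-(n : ℝ) / 2 - 1) * sq q y / (qnum q (n + 1) * qnum q (n + 2)) : ℝ) : ℂ) •
        vDn (n + 1) (x + 1) (y - 1)))
  (fun n x y => ((preDn q n x y * sq q (x + 1) : ℝ) : ℂ) •
    (((q ^ (-1 / 2 : ℝ) * sq q (n - y) / qnum q (n + 1) : ℝ) : ℂ) • vDn (n + 1) (x + 1) y))

/-- `b₋`. -/
def bMinus (q : ℝ) : Op := opOfBasis
  (fun n x y => -((preUp q n x y * sq q (n - x) : ℝ) : ℂ) •
    (((q ^ (-1 / 2 : ℝ) * sq q y / qnum q (n + 1) : ℝ) : ℂ) • vUp (n - 1) x (y - 1)))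
  (fun n x y => -((preDn q n x y * sq q (n - x) : ℝ) : ℂ) •
    (((q ^ ((n : ℝ) / 2) * sq q (n - y) / (qnum q n * qnum q (n + 1)) : ℝ) : ℂ) • vUp (n - 1) x y
      + ((sq q y / qnum q n : ℝ) : ℂ) • vDn (n - 1) x (y - 1)))

/-- The spinor representation on the generator `a`. -/
def piA (q : ℝ) : Op := aPlus q + aMinus q

/-- The spinor representation on the generator `b`. -/
def piB (q : ℝ) : Op := bPlus q + bMinus q

/-- The inner product of `ℋ` restricted to the core (linear in the second variable). -/
def ip (v w : Core) : ℂ := v.sum fun i c => conj c * w i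

/-- The adjoint of an operator which changes the level `n = 2j` by at most one, given by the
conjugate transposed matrix; see `ip_adj_piA`, `ip_adj_piB`. -/
def adj (T : Op) : Op :=
  Finsupp.linearCombination ℂ fun i =>
    ∑ k ∈ (Finset.range (i.1 + 2)).sigma fun _ => Finset.univ,
      Finsupp.single k (conj (entry T i k))

theorem entry_vUp (n x y : ℕ) (i : Idx) (h : i.1 ≠ n) : vUp n x y i = 0 := by
  unfold vUp
  split_ifs
  · exact Finsupp.single_eq_of_ne (fun e => h (by rw [e]))
  · rfl

theorem entry_vDn (n x y : ℕ) (i : Idx) (h : i.1 ≠ n) : vDn n x y i = 0 := by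
  unfold vDn
  split_ifs
  · exact Finsupp.single_eq_of_ne (fun e => h (by rw [e]))
  · rfl

theorem entry_piA (q : ℝ) (i k : Idx) (h : i.1 + 1 < k.1) : entry (piA q) i k = 0 := by
  obtain ⟨n, x, y | y⟩ := k <;>
  · have h1 : i.1 ≠ n + 1 := by dsimp only at h; omega
    have h2 : i.1 ≠ n - 1 := by dsimp only at h; omega
    simp [entry, piA, aPlus, aMinus, opOfBasis, entry_vUp _ _ _ _ h1, entry_vUp _ _ _ _ h2,
      entry_vDn _ _ _ _ h1, entry_vDn _ _ _ _ h2]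

theorem entry_piB (q : ℝ) (i k : Idx) (h : i.1 + 1 < k.1) : entry (piB q) i k = 0 := by
  obtain ⟨n, x, y | y⟩ := k <;>
  · have h1 : i.1 ≠ n + 1 := by dsimp only at h; omega
    have h2 : i.1 ≠ n - 1 := by dsimp only at h; omega
    simp [entry, piB, bPlus, bMinus, opOfBasis, entry_vUp _ _ _ _ h1, entry_vUp _ _ _ _ h2,
      entry_vDn _ _ _ _ h1, entry_vDn _ _ _ _ h2]

theorem entry_adj {T : Op} (hT : ∀ i k : Idx, i.1 + 1 < k.1 → entry T i k = 0) (i k : Idx) :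
    entry (adj T) k i = conj (entry T i k) := by
  have : entry (adj T) k i = ∑ l ∈ (Finset.range (i.1 + 2)).sigma fun _ => Finset.univ,
      (Finsupp.single l (conj (entry T i l)) : Core) k := by
    simp [entry, adj, Finsupp.finsetSum_apply]
  rw [this, Finset.sum_eq_single k]
  · simp
  · intro l _ hl
    exact Finsupp.single_eq_of_ne hl.symm
  · intro hk
    have : i.1 + 1 < k.1 := by
      simp only [Finset.mem_sigma, Finset.mem_range, Finset.mem_univ, and_true] at hk
      omega
    simp [hT i k this]

theorem ip_single_left (i : Idx) (c : ℂ) (w : Core) :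
    ip (Finsupp.single i c) w = conj c * w i := by
  simp [ip, Finsupp.sum_single_index]

theorem ip_add_left (v v' w : Core) : ip (v + v') w = ip v w + ip v' w := by
  unfold ip
  exact Finsupp.sum_add_index' (by simp) (by intros; simp [add_mul])

theorem ip_add_right (v w w' : Core) : ip v (w + w') = ip v w + ip v w' := by
  simp [ip, Finsupp.sum, mul_add, Finset.sum_add_distrib]

theorem ip_smul_right (v w : Core) (c : ℂ) : ip v (c • w) = c * ip v w := by
  simp only [ip, Finsupp.sum, Finsupp.smul_apply, smul_eq_mul, Finset.mul_sum]
  exact Finset.sum_congr rfl fun _ _ => by ring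

theorem ip_single_right (v : Core) (k : Idx) : ip v (Finsupp.single k 1) = conj (v k) := by
  classical
  simp only [ip, Finsupp.sum, Finsupp.single_apply]
  by_cases hk : k ∈ v.support
  · rw [Finset.sum_eq_single k] <;> simp +contextual [eq_comm, hk]
  · rw [Finset.sum_eq_zero]
    · rw [Finsupp.notMem_support_iff.1 hk, map_zero]
    · intro l hl
      have : k ≠ l := fun e => hk (e ▸ hl)
      simp [this]

theorem ip_adj {T : Op} (hT : ∀ i k : Idx, i.1 + 1 < k.1 → entry T i k = 0) (v w : Core) :
    ip (adj T v) w = ip v (T w) := by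
  induction w using Finsupp.induction_linear with
  | zero => simp [ip]
  | add w w' h h' => rw [map_add, ip_add_right, ip_add_right, h, h']
  | single k c =>
    have e : (Finsupp.single k c : Core) = c • Finsupp.single k 1 := by simp
    rw [e, map_smul, ip_smul_right, ip_smul_right]
    congr 1
    induction v using Finsupp.induction_linear with
    | zero => simp [ip]
    | add v v' h h' => rw [map_add, ip_add_left, ip_add_left, h, h']
    | single i d =>
      have e' : (Finsupp.single i d : Core) = d • Finsupp.single i 1 := by simp
      rw [ip_single_left, ip_single_right, e', map_smul]
      have := entry_adj hT i k
      unfold entry at this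
      simp [this]

theorem ip_adj_piA (q : ℝ) (v w : Core) : ip (adj (piA q) v) w = ip v (piA q w) :=
  ip_adj (entry_piA q) v w

theorem ip_adj_piB (q : ℝ) (v w : Core) : ip (adj (piB q) v) w = ip v (piB q w) :=
  ip_adj (entry_piB q) v w

/-- The `*`-algebra `𝒜` of the quantum group `SU_q(2)`, in its (faithful) spinor representation:
the unital algebra generated by `π(a)`, `π(b)` and their adjoints. -/
def Alg (q : ℝ) : Subalgebra ℂ Op :=
  Algebra.adjoin ℂ {piA q, piB q, adj (piA q), adj (piB q)}

/-! ### Zeta functions and residues -/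

/-- `T` extends to a trace class operator on `ℋ`: there are `ξₙ, ηₙ ∈ ℋ` with
`∑ ‖ξₙ‖ ‖ηₙ‖ < ∞` and `T v = ∑ ξₙ ⟨ηₙ, v⟩`. -/
def IsTraceClass (T : Op) : Prop :=
  ∃ ξ η : ℕ → Hilb, Summable (fun n => ‖ξ n‖ * ‖η n‖) ∧
    ∀ i k, entry T i k = ∑' n, (ξ n) i * conj ((η n) k)

/-- The trace, computed in the orthonormal basis. -/
def opTrace (T : Op) : ℂ := ∑' i, entry T i i

/-- `f` is the meromorphic continuation to `ℂ` of the zeta function `z ↦ Tr(T |D|^{-z})`, where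
`T |D|^{-z}` is trace class for `Re z` large. -/
structure IsZeta (T : Op) (f : ℂ → ℂ) : Prop where
  meromorphic : Meromorphic f
  eq_trace : ∃ σ : ℝ, ∀ z : ℂ, σ < z.re →
    IsTraceClass (T * absDPow (-z)) ∧ f z = opTrace (T * absDPow (-z))

/-- The zeta function of `T` has a meromorphic continuation with at most a simple pole at `0`,
with residue `r` there. -/
def IsNCInt (T : Op) (r : ℂ) : Prop :=
  ∃ f, IsZeta T f ∧ Tendsto (fun z => z * f z) (𝓝[≠] 0) (𝓝 r)

/-- The zeta function of `T` has a meromorphic continuation, regular at `0` with value `r`. -/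
def IsZetaZero (T : Op) (r : ℂ) : Prop :=
  ∃ f, IsZeta T f ∧ Tendsto f (𝓝[≠] 0) (𝓝 r)

theorem IsZeta.eventuallyEq {T : Op} {f g : ℂ → ℂ} (hf : IsZeta T f) (hg : IsZeta T g) (z : ℂ) :
    f =ᶠ[𝓝[≠] z] g := by
  obtain ⟨σ, hσ⟩ := hf.eq_trace
  obtain ⟨τ, hτ⟩ := hg.eq_trace
  have hm : Meromorphic (f - g) := fun z => (hf.meromorphic z).sub (hg.meromorphic z)
  by_contra hne
  have h1 : meromorphicOrderAt (f - g) z ≠ ⊤ := by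
    intro h
    rw [meromorphicOrderAt_eq_top_iff] at h
    exact hne (h.mono fun w hw => sub_eq_zero.1 hw)
  have h2 := hm.exists_meromorphicOrderAt_ne_top_iff_forall.1 ⟨z, h1⟩
    (((max σ τ + 1 : ℝ) : ℂ))
  apply h2
  rw [meromorphicOrderAt_eq_top_iff]
  apply Filter.Eventually.filter_mono nhdsWithin_le_nhds
  have hopen : IsOpen {w : ℂ | max σ τ < w.re} := isOpen_lt continuous_const Complex.continuous_re
  filter_upwards [hopen.mem_nhds (show max σ τ < (((max σ τ + 1 : ℝ) : ℂ)).re by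
      rw [Complex.ofReal_re]; linarith)]
    with w hw
  have hw' : max σ τ < w.re := hw
  simp [(hσ w (lt_of_le_of_lt (le_max_left _ _) hw')).2,
    (hτ w (lt_of_le_of_lt (le_max_right _ _) hw')).2]

theorem IsNCInt.unique {T : Op} {r s : ℂ} (hr : IsNCInt T r) (hs : IsNCInt T s) : r = s := by
  obtain ⟨f, hf, hfr⟩ := hr
  obtain ⟨g, hg, hgs⟩ := hs
  refine tendsto_nhds_unique hfr (hgs.congr' ?_)
  filter_upwards [hf.eventuallyEq hg 0] with z hz
  rw [hz]

theorem IsZetaZero.unique {T : Op} {r s : ℂ} (hr : IsZetaZero T r) (hs : IsZetaZero T s) :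
    r = s := by
  obtain ⟨f, hf, hfr⟩ := hr
  obtain ⟨g, hg, hgs⟩ := hs
  exact tendsto_nhds_unique hfr (hgs.congr' (hf.eventuallyEq hg 0).symm)

open Classical in
/-- The residue functional `⨍ T = Res_{z=0} Tr(T |D|^{-z})` (`0` if it does not exist). -/
def ncInt (T : Op) : ℂ := if h : ∃ r, IsNCInt T r then h.choose else 0

open Classical in
/-- The value `Tr(T |D|^{-z})|_{z=0}` (`0` if it does not exist). -/
def zetaZero (T : Op) : ℂ := if h : ∃ r, IsZetaZero T r then h.choose else 0

theorem IsNCInt.ncInt_eq {T : Op} {r : ℂ} (h : IsNCInt T r) : ncInt T = r := by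
  have h' : ∃ r, IsNCInt T r := ⟨r, h⟩
  rw [ncInt, dif_pos h']
  exact h'.choose_spec.unique h

theorem IsZetaZero.zetaZero_eq {T : Op} {r : ℂ} (h : IsZetaZero T r) : zetaZero T = r := by
  have h' : ∃ r, IsZetaZero T r := ⟨r, h⟩
  rw [zetaZero, dif_pos h']
  exact h'.choose_spec.unique h

/-! ### The cochains on `𝒜` -/

/-- `χ₁(a₀,a₁) = Tr(a₀ [F, a₁])`. -/
def χ₁ (q : ℝ) : Cochain (Alg q) 1 := fun a => opTrace (a 0 * comm F (a 1))

/-- The first component of the Connes-Moscovici local cocycle. -/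
def φ₁ (q : ℝ) : Cochain (Alg q) 1 := fun a =>
  ncInt (a 0 * comm D (a 1) * absDPow (-1))
    - 1 / 4 * ncInt (a 0 * nabla (comm D (a 1)) * absDPow (-3))
    + 1 / 8 * ncInt (a 0 * nabla (nabla (comm D (a 1))) * absDPow (-5))

/-- The second component of the Connes-Moscovici local cocycle. -/
def φ₃ (q : ℝ) : Cochain (Alg q) 3 := fun a =>
  1 / 12 * ncInt (a 0 * comm D (a 1) * comm D (a 2) * comm D (a 3) * absDPow (-3))

/-- `φ₀(a) = Tr(F a |D|^{-z})|_{z=0}`. -/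
def φ₀ (q : ℝ) : Cochain (Alg q) 0 := fun a => zetaZero (F * a 0)

/-- `φ₂(a₀,a₁,a₂) = (1/24) ⨍ a₀ δ(a₁) δ²(a₂) F |D|^{-3}`. -/
def φ₂ (q : ℝ) : Cochain (Alg q) 2 := fun a =>
  1 / 24 * ncInt (a 0 * δ (a 1) * δ (δ (a 2)) * F * absDPow (-3))

/-- `φ'₀(a) = Tr(a |D|^{-z})|_{z=0}`. -/
def φ₀' (q : ℝ) : Cochain (Alg q) 0 := fun a => zetaZero (a 0)

/-- `φ'₂(a₀,a₁,a₂) = -(1/24) ⨍ a₀ δ(a₁) δ²(a₂) F |D|^{-3}`. -/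
def φ₂' (q : ℝ) : Cochain (Alg q) 2 := fun a =>
  -(1 / 24) * ncInt (a 0 * δ (a 1) * δ (δ (a 2)) * F * absDPow (-3))

/-- `ψ₁(a₀,a₁) = 2⨍a₀δ(a₁)P|D|⁻¹ - ⨍a₀δ²(a₁)P|D|⁻² + (2/3)⨍a₀δ³(a₁)P|D|⁻³`. -/
def ψ₁ (q : ℝ) : Cochain (Alg q) 1 := fun a =>
  2 * ncInt (a 0 * δ (a 1) * P * absDPow (-1))
    - ncInt (a 0 * δ (δ (a 1)) * P * absDPow (-2))
    + 2 / 3 * ncInt (a 0 * δ (δ (δ (a 1))) * P * absDPow (-3))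

/-- `β(a) = 2 Tr(P a |D|^{-z})|_{z=0}`. -/
def β (q : ℝ) : Cochain (Alg q) 0 := fun a => 2 * zetaZero (P * a 0)

/-- The local cocycle `φ_odd = (φ₁, φ₃)`. -/
def φOdd (q : ℝ) : ∀ n, Cochain (Alg q) n
  | 1 => φ₁ q
  | 3 => φ₃ q
  | _ => 0

/-- `φ_ev = (φ₀, φ₂)`. -/
def φEv (q : ℝ) : ∀ n, Cochain (Alg q) n
  | 0 => φ₀ q
  | 2 => φ₂ q
  | _ => 0

/-- `φ'_ev = (φ'₀, φ'₂)`. -/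
def φEv' (q : ℝ) : ∀ n, Cochain (Alg q) n
  | 0 => φ₀' q
  | 2 => φ₂' q
  | _ => 0

/-- A `1`-cochain as an element of the total complex. -/
def inDegreeOne {R : Type} (ψ : Cochain R 1) : ∀ n, Cochain R n
  | 1 => ψ
  | _ => 0

end QSU2

end

/-!
# The local index cocycles of the spinor Dirac operator on `SU_q(2)`

The eigenvalues of `|D|` are `m + 1/2`; call `m` the level of a basis vector. The level of
`v^j_{x,y,↑}` is `2j + 1` and that of `v^j_{x,y,↓}` is `2j`, and a level contains `m (m + 1)`
labels of either spin. Two classes of operators carry the argument. A *weighted shift*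
`IsWeightedShift` preserves the spin and moves `(m, x, y)` by a constant vector, with weight
`u(x) v(y)` up to an error which decays exponentially in `m`, where `u` and `v` converge
exponentially fast. A *smoothing* operator `IsSmoothing` is banded for the level and has columns
which decay exponentially in it. Together they span the algebra `Tame`. It contains the
generators and their adjoints (`Alg_le_Tame`): up to exponentially small errors `[N]` is
`q^{-N} / (q⁻¹ - q)`, which turns the parts of the generators which preserve the spin into
weighted shifts, while the parts which change
the spin have one denominator more and are smoothing. As weighted shifts preserve the spin,
`[F, T]` is smoothing for every tame `T` (`comm_F_smoothing`); in particular it is trace class,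
and `[D, T]` agrees with `δ(T) F` up to a smoothing operator. As weighted shifts are homogeneous
for the level, `δ` multiplies them by their degree and preserves `Tame`.

Summing `u(x) v(y)` over a level, one finds that the trace of a tame operator over the level `m`
is `p₀ + p₁ (m + 1/2) + p₂ (m + 1/2)²` up to an exponentially small error
(`exists_hasQuadExpansion`). So `Tr(T |D|^{-z})` is
`p₀ ζ(z, 1/2) + p₁ ζ(z - 1, 1/2) + p₂ ζ(z - 2, 1/2)` plus an entire function, with the Hurwitz
zeta function (`HasExpansion.isZeta`). This gives all the continuations and the simple poles:
`⨍ T |D|^{-1} = p₀`, `⨍ T |D|^{-2} = p₁`, `⨍ T |D|^{-3} = p₂`, the residues of `T |D|^{-k}` with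
`k ≥ 4` vanish, and `Tr(T |D|^{-z})` is regular at `0`, with the value `p₁ ζ(-1, 1/2) = p₁ / 24`
plus the sum of the errors.

All the identities come from one commutator formula, `commutatorFormula`: for tame `A` and `B`

  `Tr([A, B] |D|^{-z})|_{z=0}
    = - ⨍ B δ(A) |D|^{-1} + 1/2 ⨍ B δ²(A) |D|^{-2} - 1/3 ⨍ B δ³(A) |D|^{-3}`,

and `T ↦ ⨍ T |D|^{-3}` is a trace. For `A` of degree `n ≥ 0` and `B` of degree `-n` the level
traces of `AB` are those of `BA` delayed by `n` levels. The delay changes the quadratic expansion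
by the substitution `m ↦ m - n`, and the regularised sum by a cubic polynomial in `n` without
constant term (`regularised_sum_delay`); the powers of `n` are absorbed by `δ^k(A) = n^k A`.

If `E` commutes with tame operators up to smoothing ones, the formula for `[b, E a]` expresses the
Hochschild coboundary of `a ↦ Tr(E a |D|^{-z})|_{z=0}` by residues and by `Tr(a [E, b])`
(`zetaLin_comm`). For `E = P` this is `χ₁ = ψ₁ - b β`. For `E = F` it is the formula for
`χ₁ + b φ₀`, whose residues agree with those of `φ₁`, expanded by `∇(X) = 2 δ(X) |D| + δ²(X)`, up
to the coefficient of `⨍ a₀ δ³(a₁) F |D|^{-3}`, which is `1/3` instead of `1/4`. The functional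
`T ↦ ⨍ T F |D|^{-3}` is a trace which vanishes on the image of `δ` (`topRes_mul_comm`,
`topRes_δ`), so integration by parts shows that `B φ₂` makes up for the difference (`connesB_φ₂`),
and the Leibniz rule shows that `φ₃ = b φ₂` (`φ₃_eq_hochB`). The identity with `φ'_ev` follows
from the other two because `β = φ₀ + φ₀'`. Finally `b χ₁ = 0`, as `[F, ·]` is a derivation with
smoothing values, so that `b ψ₁ = b χ₁ + b² β = 0`; and `B ψ₁ = 0`, since `δ(1) = 0` and
`ψ₁(1, a) = Tr([F, a]) = 0`.
-/

open Filter Topology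
open scoped ComplexConjugate

noncomputable section

namespace QSU2

/-- The ring structure on `Op`, built over the semiring structure and the subtraction which instance
search finds on `Op`, so that statements about rings and about semirings agree syntactically. -/
@[reducible] def opRing : Ring Op :=
  { (inferInstance : Semiring Op) with
    intCast := Int.castDef
    neg := Neg.neg
    sub := Sub.sub
    zsmul := fun n x => n • x
    sub_eq_add_neg := fun a b => sub_eq_add_neg a b
    neg_add_cancel := fun a => neg_add_cancel a
    zsmul_zero' := fun a => zero_smul ℤ a
    zsmul_succ' := fun n a => by exact SubNegMonoid.zsmul_succ' n a
    zsmul_neg' := fun n a => by exact SubNegMonoid.zsmul_neg' n a }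

attribute [local instance] opRing

/-! ### Coordinates on the label set -/

/-- The spin of a label: `true` for `↑`, `false` for `↓`. -/
def isUp (i : Idx) : Bool := i.2.2.isLeft

/-- The first coordinate `x` of a label. -/
def cx (i : Idx) : ℕ := i.2.1

/-- The second coordinate `y` of a label. -/
def cy (i : Idx) : ℕ := Sum.elim (fun y => y.val) (fun y => y.val) i.2.2

/-- The level of a label: the integer `m` for which `|D|` has the eigenvalue `m + 1/2`. It equals
`2j + 1` for spin `↑` and `2j` for spin `↓`. -/
def lvl (i : Idx) : ℕ := i.1 + (isUp i).toNat

theorem abs_eig (i : Idx) : |eig i| = lvl i + 1 / 2 := by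
  obtain ⟨n, x, y | y⟩ := i
  · rw [eig, abs_of_pos (by positivity)]
    simp [lvl, isUp]
    norm_num
    ring
  · rw [eig, abs_neg, abs_of_pos (by positivity)]
    simp [lvl, isUp]

theorem idx_ext {i k : Idx} (h1 : isUp i = isUp k) (h2 : lvl i = lvl k) (h3 : cx i = cx k)
    (h4 : cy i = cy k) : i = k := by
  obtain ⟨n, x, y | y⟩ := i <;> obtain ⟨n', x', y' | y'⟩ := k <;>
    simp [isUp, lvl, cx, cy] at h1 h2 h3 h4
  all_goals
    subst h2
    rw [Fin.val_inj] at h3 h4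
    subst h3 h4
    rfl

/-- The labels of spin `s` at level `m` form the rectangle `x < m`, `y ≤ m` for `↑` and
`x ≤ m`, `y < m` for `↓`. -/
theorem exists_idx {s : Bool} {m x y : ℕ} (hx : x < m + (!s).toNat) (hy : y < m + s.toNat) :
    ∃ i : Idx, isUp i = s ∧ lvl i = m ∧ cx i = x ∧ cy i = y := by
  cases s
  · exact ⟨⟨m, ⟨x, by simpa using hx⟩, Sum.inr ⟨y, by simpa using hy⟩⟩, by
      simp [isUp, lvl, cx, cy]⟩
  · simp at hx hy
    obtain ⟨n, rfl⟩ : ∃ n, m = n + 1 := ⟨m - 1, by omega⟩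
    exact ⟨⟨n, ⟨x, hx⟩, Sum.inl ⟨y, by omega⟩⟩, by simp [isUp, lvl, cx, cy]⟩

theorem cx_lt (i : Idx) : cx i < lvl i + (!isUp i).toNat := by
  obtain ⟨n, x, y | y⟩ := i <;> simp [isUp, lvl, cx] <;> omega

theorem cy_lt (i : Idx) : cy i < lvl i + (isUp i).toNat := by
  obtain ⟨n, x, y | y⟩ := i
  · simp [isUp, lvl, cy]
    omega
  · simp [isUp, lvl, cy]

/-- The finite set of labels at level `m`. -/
def levelSet (m : ℕ) : Finset Idx :=
  ((Finset.range (m + 1)).sigma fun _ => Finset.univ).filter fun i => lvl i = m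

theorem mem_levelSet {m : ℕ} {i : Idx} : i ∈ levelSet m ↔ lvl i = m := by
  simp only [levelSet, Finset.mem_filter, Finset.mem_sigma, Finset.mem_range, Finset.mem_univ,
    and_true, and_iff_right_iff_imp]
  intro h
  unfold lvl at h
  omega

/-- A sum over the labels of spin `s` and level `m` is a sum over a rectangle of pairs `(x, y)`. -/
theorem sum_levelSet_spin {M : Type*} [AddCommMonoid M] (s : Bool) (m : ℕ) (f : ℕ → ℕ → M) :
    ∑ i ∈ levelSet m with isUp i = s, f (cx i) (cy i) =
      ∑ x ∈ Finset.range (m + (!s).toNat), ∑ y ∈ Finset.range (m + s.toNat), f x y := by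
  rw [← Finset.sum_product']
  refine Finset.sum_nbij (fun i => (cx i, cy i)) ?_ ?_ ?_ (fun _ _ => rfl)
  · intro i hi
    simp only [Finset.mem_filter, mem_levelSet] at hi
    have h1 := cx_lt i
    have h2 := cy_lt i
    rw [hi.1, hi.2] at h1 h2
    simp [h1, h2]
  · intro i hi k hk h
    simp only [Finset.coe_filter, mem_levelSet, Set.mem_ofPred_eq] at hi hk
    simp only [Prod.mk.injEq] at h
    exact idx_ext (hi.2.trans hk.2.symm) (hi.1.trans hk.1.symm) h.1 h.2
  · rintro ⟨x, y⟩ h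
    simp only [Finset.coe_product, Finset.coe_range, Set.mem_prod, Set.mem_Iio] at h
    obtain ⟨i, h1, h2, h3, h4⟩ := exists_idx h.1 h.2
    exact ⟨i, by simp [mem_levelSet, h1, h2], by simp [h3, h4]⟩

theorem card_levelSet_le (m : ℕ) : (levelSet m).card ≤ 2 * (m + 1) ^ 2 := by
  have h : ∀ s : Bool, ((levelSet m).filter fun i => isUp i = s).card ≤ (m + 1) ^ 2 := by
    intro s
    have := sum_levelSet_spin s m (fun _ _ => 1)
    simp only [Finset.sum_const, smul_eq_mul, mul_one, Finset.card_range] at this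
    rw [this]
    cases s <;> simp <;> nlinarith
  have := Finset.card_filter_add_card_filter_not (s := levelSet m) (fun i => isUp i = true)
  have e : ((levelSet m).filter fun i => ¬ isUp i = true) =
      (levelSet m).filter fun i => isUp i = false := by
    ext i; simp
  rw [e] at this
  have h1 := h true
  have h2 := h false
  omega

/-! ### Matrix entries -/

theorem entry_add (S T : Op) (i k : Idx) : entry (S + T) i k = entry S i k + entry T i k := rfl

theorem entry_sub (S T : Op) (i k : Idx) : entry (S - T) i k = entry S i k - entry T i k := rfl

theorem entry_smul (c : ℂ) (T : Op) (i k : Idx) : entry (c • T) i k = c * entry T i k := rfl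

theorem entry_zero (i k : Idx) : entry 0 i k = 0 := rfl

theorem op_ext {S T : Op} (h : ∀ i k, entry S i k = entry T i k) : S = T := by
  refine Finsupp.lhom_ext' fun k => LinearMap.ext_ring ?_
  ext i
  exact h i k

/-- Matrix multiplication; `s` is any finite set which contains the support of the `k`-th column of
`B`. -/
theorem entry_mul (A B : Op) (i k : Idx) {s : Finset Idx} (hs : ∀ l, entry B l k ≠ 0 → l ∈ s) :
    entry (A * B) i k = ∑ l ∈ s, entry A i l * entry B l k := by
  have e : B (Finsupp.single k 1) = ∑ l ∈ s, entry B l k • Finsupp.single l (1 : ℂ) := by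
    have h := (Finsupp.sum_single (B (Finsupp.single k 1))).symm
    rw [Finsupp.sum_of_support_subset (s := s)] at h
    · rw [h]
      refine Finset.sum_congr rfl fun l _ => ?_
      rw [Finsupp.smul_single, smul_eq_mul, mul_one]
      rfl
    · intro l hl
      exact hs l (Finsupp.mem_support_iff.1 hl)
    · simp
  change A (B (Finsupp.single k 1)) i = _
  rw [e, map_sum, Finsupp.finsetSum_apply]
  refine Finset.sum_congr rfl fun l _ => ?_
  rw [map_smul, Finsupp.smul_apply, smul_eq_mul, mul_comm]
  rfl

theorem entry_diag (f : Idx → ℂ) (i k : Idx) : entry (diag f) i k = if i = k then f k else 0 := by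
  simp [entry, diag, Finsupp.single_apply, eq_comm]

theorem entry_mul_diag (T : Op) (f : Idx → ℂ) (i k : Idx) :
    entry (T * diag f) i k = entry T i k * f k := by
  rw [entry_mul T (diag f) i k (s := {k})]
  · simp [entry_diag]
  · intro l hl
    rw [entry_diag] at hl
    by_contra h
    exact hl (if_neg (by simpa using h))

theorem entry_diag_mul (T : Op) (f : Idx → ℂ) (i k : Idx) :
    entry (diag f * T) i k = f i * entry T i k := by
  rw [entry_mul (diag f) T i k (s := insert i (T (Finsupp.single k 1)).support)]
  · rw [Finset.sum_eq_single i]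
    · simp [entry_diag]
    · intro l _ hl
      simp [entry_diag, hl.symm]
    · simp
  · intro l hl
    exact Finset.mem_insert_of_mem (Finsupp.mem_support_iff.2 hl)

theorem diag_mul_diag (f g : Idx → ℂ) : diag f * diag g = diag fun i => f i * g i := by
  refine op_ext fun i k => ?_
  rw [entry_mul_diag, entry_diag, entry_diag]
  split_ifs <;> simp

theorem diag_one : diag (fun _ => 1) = 1 := by
  refine op_ext fun i k => ?_
  rw [entry_diag, entry]
  simp [Finsupp.single_apply, eq_comm]

/-- The `ℓ¹`-norm of the `k`-th column of the matrix of `T`. -/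
def colNorm (T : Op) (k : Idx) : ℝ := ∑ l ∈ (T (Finsupp.single k 1)).support, ‖entry T l k‖

theorem colNorm_eq_sum (T : Op) (k : Idx) {s : Finset Idx} (hs : ∀ l, entry T l k ≠ 0 → l ∈ s) :
    colNorm T k = ∑ l ∈ s, ‖entry T l k‖ := by
  refine Finset.sum_subset (fun l hl => hs l (Finsupp.mem_support_iff.1 hl)) fun l _ hl => ?_
  rw [norm_eq_zero]
  exact Finsupp.notMem_support_iff.1 hl

theorem colNorm_nonneg (T : Op) (k : Idx) : 0 ≤ colNorm T k :=
  Finset.sum_nonneg fun _ _ => norm_nonneg _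

theorem norm_entry_le (T : Op) (i k : Idx) : ‖entry T i k‖ ≤ colNorm T k := by
  by_cases h : entry T i k = 0
  · rw [h, norm_zero]
    exact colNorm_nonneg T k
  · exact Finset.single_le_sum (f := fun l => ‖entry T l k‖) (fun _ _ => norm_nonneg _)
      (Finsupp.mem_support_iff.2 h)

theorem colNorm_add_le (S T : Op) (k : Idx) : colNorm (S + T) k ≤ colNorm S k + colNorm T k := by
  classical
  let s := (S (Finsupp.single k 1)).support ∪ (T (Finsupp.single k 1)).support
  have hS : ∀ l, entry S l k ≠ 0 → l ∈ s := fun l hl =>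
    Finset.mem_union_left _ (Finsupp.mem_support_iff.2 hl)
  have hT : ∀ l, entry T l k ≠ 0 → l ∈ s := fun l hl =>
    Finset.mem_union_right _ (Finsupp.mem_support_iff.2 hl)
  rw [colNorm_eq_sum S k hS, colNorm_eq_sum T k hT, colNorm_eq_sum (S + T) k (s := s),
    ← Finset.sum_add_distrib]
  · exact Finset.sum_le_sum fun l _ => norm_add_le _ _
  · intro l hl
    by_contra h
    have h1 : entry S l k = 0 := by by_contra h'; exact h (hS l h')
    have h2 : entry T l k = 0 := by by_contra h'; exact h (hT l h')
    exact hl (by rw [entry_add, h1, h2, add_zero])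

theorem colNorm_smul (c : ℂ) (T : Op) (k : Idx) : colNorm (c • T) k = ‖c‖ * colNorm T k := by
  rw [colNorm_eq_sum (c • T) k (s := (T (Finsupp.single k 1)).support), colNorm, Finset.mul_sum]
  · exact Finset.sum_congr rfl fun l _ => by rw [entry_smul, norm_mul]
  · intro l hl
    refine Finsupp.mem_support_iff.2 fun h => hl ?_
    rw [entry_smul, entry, h, mul_zero]

theorem colNorm_mul_le (A B : Op) (k : Idx) {C : ℝ}
    (h : ∀ l, entry B l k ≠ 0 → colNorm A l ≤ C) :
    colNorm (A * B) k ≤ C * colNorm B k := by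
  classical
  let s := (B (Finsupp.single k 1)).support
  have hs : ∀ l, entry B l k ≠ 0 → l ∈ s := fun l hl => Finsupp.mem_support_iff.2 hl
  calc colNorm (A * B) k ≤ ∑ i ∈ ((A * B) (Finsupp.single k 1)).support,
        ∑ l ∈ s, ‖entry A i l‖ * ‖entry B l k‖ := by
        refine Finset.sum_le_sum fun i _ => ?_
        rw [entry_mul A B i k hs]
        refine (norm_sum_le _ _).trans (Finset.sum_le_sum fun l _ => ?_)
        rw [norm_mul]
    _ = ∑ l ∈ s, (∑ i ∈ ((A * B) (Finsupp.single k 1)).support, ‖entry A i l‖) *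
          ‖entry B l k‖ := by
        rw [Finset.sum_comm]
        simp_rw [Finset.sum_mul]
    _ ≤ ∑ l ∈ s, C * ‖entry B l k‖ := by
        refine Finset.sum_le_sum fun l hl => ?_
        refine mul_le_mul_of_nonneg_right ?_ (norm_nonneg _)
        refine le_trans ?_ (h l (Finsupp.mem_support_iff.1 hl))
        rw [colNorm_eq_sum A l (s := ((A * B) (Finsupp.single k 1)).support ∪
          (A (Finsupp.single l 1)).support)
          (fun i hi => Finset.mem_union_right _ (Finsupp.mem_support_iff.2 hi))]
        exact Finset.sum_le_sum_of_subset_of_nonneg Finset.subset_union_left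
          fun _ _ _ => norm_nonneg _
    _ = C * colNorm B k := by rw [← Finset.mul_sum]; rfl

theorem colNorm_mul_diag (T : Op) (f : Idx → ℂ) (k : Idx) :
    colNorm (T * diag f) k = colNorm T k * ‖f k‖ := by
  rw [colNorm_eq_sum (T * diag f) k (s := (T (Finsupp.single k 1)).support), colNorm,
    Finset.sum_mul]
  · exact Finset.sum_congr rfl fun l _ => by rw [entry_mul_diag, norm_mul]
  · intro l hl
    refine Finsupp.mem_support_iff.2 fun h => hl ?_
    rw [entry_mul_diag, entry, h, zero_mul]

/-- The trace of `T` over the level `m`. -/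
def levelTrace (T : Op) (m : ℕ) : ℂ := ∑ i ∈ levelSet m, entry T i i

theorem levelTrace_add (S T : Op) (m : ℕ) :
    levelTrace (S + T) m = levelTrace S m + levelTrace T m := Finset.sum_add_distrib

theorem levelTrace_smul (c : ℂ) (T : Op) (m : ℕ) :
    levelTrace (c • T) m = c * levelTrace T m := (Finset.mul_sum _ _ _).symm

theorem levelTrace_mul_diag (T : Op) (g : ℕ → ℂ) (m : ℕ) :
    levelTrace (T * diag fun i => g (lvl i)) m = levelTrace T m * g m := by
  rw [levelTrace, levelTrace, Finset.sum_mul]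
  refine Finset.sum_congr rfl fun i hi => ?_
  rw [entry_mul_diag, mem_levelSet.1 hi]

/-- A level consists of `O(m²)` labels, and each diagonal entry is bounded by its column. -/
theorem norm_levelTrace_le (T : Op) (m : ℕ) {C : ℝ} (hC0 : 0 ≤ C)
    (hC : ∀ k, lvl k = m → colNorm T k ≤ C) :
    ‖levelTrace T m‖ ≤ 2 * (m + 1 : ℝ) ^ 2 * C :=
  calc ‖levelTrace T m‖ ≤ ∑ i ∈ levelSet m, C :=
        (norm_sum_le _ _).trans (Finset.sum_le_sum fun i hi =>
          (norm_entry_le T i i).trans (hC i (mem_levelSet.1 hi)))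
    _ = (levelSet m).card * C := by rw [Finset.sum_const, nsmul_eq_mul]
    _ ≤ _ := mul_le_mul_of_nonneg_right (by exact_mod_cast card_levelSet_le m) hC0

theorem absDPow_eq (z : ℂ) : absDPow z = diag fun i => ((lvl i : ℂ) + 1 / 2) ^ z := by
  unfold absDPow
  congr 1
  ext i
  rw [abs_eig]
  push_cast
  rfl

theorem absD_eq : absD = diag fun i => (lvl i : ℂ) + 1 / 2 := by
  unfold absD
  congr 1
  ext i
  rw [abs_eig]
  push_cast
  rfl

theorem F_eq : F = diag fun i => if isUp i then 1 else -1 := by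
  unfold F
  congr 1
  ext i
  obtain ⟨n, x, y | y⟩ := i
  · have : (0 : ℝ) < n + 3 / 2 := by positivity
    simp [eig, isUp, abs_of_pos this, div_self this.ne']
  · have : (0 : ℝ) < n + 1 / 2 := by positivity
    simp only [eig, isUp, abs_neg, abs_of_pos this, neg_div, div_self this.ne']
    simp

theorem D_eq : D = F * absD := by
  rw [F_eq, absD_eq, diag_mul_diag]
  unfold D
  congr 1
  ext i
  obtain ⟨n, x, y | y⟩ := i
  · simp [eig, isUp, lvl]; ring
  · simp [eig, isUp, lvl]

/-! ### Exponentially small functions -/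

/-- `g a ≤ C r^{ℓ a}` for some constants `C ≥ 0` and `0 < r < 1`. -/
def ExpSmall {α : Type*} (ℓ : α → ℕ) (g : α → ℝ) : Prop :=
  ∃ C r : ℝ, 0 ≤ C ∧ 0 < r ∧ r < 1 ∧ ∀ a, g a ≤ C * r ^ ℓ a

namespace ExpSmall

variable {α β : Type*} {ℓ : α → ℕ} {f g : α → ℝ}

theorem mono (hg : ExpSmall ℓ g) (h : ∀ a, f a ≤ g a) : ExpSmall ℓ f := by
  obtain ⟨C, r, hC, h0, h1, H⟩ := hg
  exact ⟨C, r, hC, h0, h1, fun a => (h a).trans (H a)⟩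

theorem of_nonpos (h : ∀ a, f a ≤ 0) : ExpSmall ℓ f :=
  ⟨0, 1 / 2, le_rfl, by norm_num, by norm_num, fun a => by simpa using h a⟩

theorem of_le_pow {q : ℝ} (h0 : 0 < q) (h1 : q < 1) (C : ℝ) (h : ∀ a, f a ≤ C * q ^ ℓ a) :
    ExpSmall ℓ f :=
  ⟨|C|, q, abs_nonneg C, h0, h1, fun a => (h a).trans
    (mul_le_mul_of_nonneg_right (le_abs_self C) (pow_nonneg h0.le _))⟩

theorem add (hf : ExpSmall ℓ f) (hg : ExpSmall ℓ g) : ExpSmall ℓ fun a => f a + g a := by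
  obtain ⟨C, r, hC, h0, h1, H⟩ := hf
  obtain ⟨C', r', hC', h0', h1', H'⟩ := hg
  refine ⟨C + C', max r r', by positivity, lt_max_of_lt_left h0, max_lt h1 h1', fun a => ?_⟩
  have e1 : C * r ^ ℓ a ≤ C * max r r' ^ ℓ a := by gcongr; exact le_max_left _ _
  have e2 : C' * r' ^ ℓ a ≤ C' * max r r' ^ ℓ a := by gcongr; exact le_max_right _ _
  linarith [H a, H' a]

theorem const_mul (hf : ExpSmall ℓ f) {c : ℝ} (hc : 0 ≤ c) : ExpSmall ℓ fun a => c * f a := by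
  obtain ⟨C, r, hC, h0, h1, H⟩ := hf
  exact ⟨c * C, r, by positivity, h0, h1, fun a => by
    rw [mul_assoc]; exact mul_le_mul_of_nonneg_left (H a) hc⟩

/-- Multiplication by a polynomially growing factor preserves exponential smallness. -/
theorem pow_mul (hf : ExpSmall ℓ f) (d : ℕ) : ExpSmall ℓ fun a => (ℓ a + 1 : ℝ) ^ d * f a := by
  obtain ⟨C, r, hC, h0, h1, H⟩ := hf
  set s := √r with hs
  have hs0 : 0 < s := Real.sqrt_pos.2 h0
  have hs1 : s < 1 := by rw [hs, Real.sqrt_lt' one_pos]; simpa using h1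
  have hss : s * s = r := Real.mul_self_sqrt h0.le
  have ht := (tendsto_pow_const_mul_const_pow_of_abs_lt_one d
    (by rwa [abs_of_pos hs0] : |s| < 1)).comp (tendsto_add_atTop_nat 1)
  obtain ⟨M, hM⟩ := ht.bddAbove_range
  have hM' : ∀ n : ℕ, (n + 1 : ℝ) ^ d * s ^ n ≤ M / s := by
    intro n
    have := hM ⟨n, rfl⟩
    simp only [Function.comp_apply, Nat.cast_add, Nat.cast_one] at this
    rw [le_div_iff₀ hs0, mul_assoc, ← pow_succ]
    exact this
  have hM0 : 0 ≤ M / s := le_trans (by positivity) (hM' 0)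
  refine ⟨C * (M / s), s, by positivity, hs0, hs1, fun a => ?_⟩
  calc (ℓ a + 1 : ℝ) ^ d * f a ≤ (ℓ a + 1 : ℝ) ^ d * (C * r ^ ℓ a) :=
        mul_le_mul_of_nonneg_left (H a) (by positivity)
    _ = C * ((ℓ a + 1 : ℝ) ^ d * s ^ ℓ a) * s ^ ℓ a := by rw [← hss, mul_pow]; ring
    _ ≤ C * (M / s) * s ^ ℓ a := by gcongr; exact hM' _

theorem comp (hf : ExpSmall ℓ f) {ℓ' : β → ℕ} (φ : β → α) (K : ℕ)
    (h : ∀ b, ℓ' b ≤ ℓ (φ b) + K) : ExpSmall ℓ' fun b => f (φ b) := by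
  obtain ⟨C, r, hC, h0, h1, H⟩ := hf
  refine ⟨C * (r ^ K)⁻¹, r, by positivity, h0, h1, fun b => (H _).trans ?_⟩
  rw [mul_assoc]
  gcongr
  rw [inv_mul_eq_div, le_div_iff₀ (by positivity), ← pow_add]
  exact pow_le_pow_of_le_one h0.le h1.le (h b)

theorem summable {f : ℕ → ℝ} (hf : ExpSmall id f) (h : ∀ n, 0 ≤ f n) : Summable f := by
  obtain ⟨C, r, hC, h0, h1, H⟩ := hf
  exact Summable.of_nonneg_of_le h H ((summable_geometric_of_lt_one h0.le h1).mul_left C)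

theorem tail {f : ℕ → ℂ} (hf : ExpSmall id fun n => ‖f n‖) :
    ExpSmall id fun n => ‖∑' k, f (k + n)‖ := by
  have hs := hf.summable fun n => norm_nonneg _
  obtain ⟨C, r, hC, h0, h1, H⟩ := hf
  refine ⟨C * (1 - r)⁻¹, r, mul_nonneg hC (by simpa using h1.le), h0, h1, fun n => ?_⟩
  have hg := ((hasSum_geometric_of_lt_one h0.le h1).mul_left (C * r ^ n))
  rw [show C * (1 - r)⁻¹ * r ^ id n = C * r ^ n * (1 - r)⁻¹ by simp; ring]
  refine tsum_of_norm_bounded hg fun k => ?_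
  refine (H _).trans (le_of_eq ?_)
  simp only [id, pow_add]
  ring

end ExpSmall

/-! ### Trace class operators and traces -/

theorem tsum_eq_tsum_levelSet {f : Idx → ℂ} (hf : Summable f) :
    ∑' i, f i = ∑' m, ∑ i ∈ levelSet m, f i := by
  rw [← (Equiv.sigmaFiberEquiv lvl).tsum_eq f]
  refine ((Equiv.sigmaFiberEquiv lvl).summable_iff.2 hf).tsum_sigma.trans ?_
  refine tsum_congr fun m => ?_
  have h := tsum_subtype {i | lvl i = m} f
  refine Eq.trans h ?_
  rw [tsum_eq_sum (s := levelSet m)]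
  · exact Finset.sum_congr rfl fun i hi => Set.indicator_of_mem (s := {i | lvl i = m})
      (mem_levelSet.1 hi) f
  · intro i hi
    exact Set.indicator_of_notMem (s := {i | lvl i = m}) (fun h => hi (mem_levelSet.2 h)) f

theorem summable_of_levelSet {f : Idx → ℝ} {g : ℕ → ℝ} (h0 : ∀ i, 0 ≤ f i)
    (hfg : ∀ i, f i ≤ g (lvl i)) (hg : Summable fun m : ℕ => 2 * (m + 1 : ℝ) ^ 2 * g m)
    (hg0 : ∀ m, 0 ≤ g m) : Summable f := by
  rw [← (Equiv.sigmaFiberEquiv lvl).summable_iff]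
  refine (summable_sigma_of_nonneg (fun _ => h0 _)).2 ?_
  have hfin : ∀ m, Finite {i // lvl i = m} := fun m =>
    Set.Finite.to_subtype ((levelSet m).finite_toSet.subset fun i hi => mem_levelSet.2 hi)
  refine ⟨fun m => ?_, ?_⟩
  · have := hfin m
    exact summable_of_hasFiniteSupport (Set.toFinite _)
  · refine Summable.of_nonneg_of_le (fun m => tsum_nonneg fun _ => h0 _) (fun m => ?_) hg
    have h := tsum_subtype {i | lvl i = m} f
    refine (le_of_eq h).trans ?_
    rw [tsum_eq_sum (s := levelSet m)]
    · calc _ ≤ ∑ i ∈ levelSet m, g m := by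
            refine Finset.sum_le_sum fun i hi => ?_
            rw [Set.indicator_of_mem (s := {i | lvl i = m}) (mem_levelSet.1 hi) f]
            exact (hfg i).trans_eq (by rw [mem_levelSet.1 hi])
        _ = (levelSet m).card * g m := by rw [Finset.sum_const, nsmul_eq_mul]
        _ ≤ _ := mul_le_mul_of_nonneg_right (by exact_mod_cast card_levelSet_le m) (hg0 m)
    · intro i hi
      exact Set.indicator_of_notMem (s := {i | lvl i = m}) (fun h => hi (mem_levelSet.2 h)) f

/-- An operator whose columns are summable in norm is trace class: it is the sum of the rank one
operators `T v_k ⟨v_k, ·⟩`. -/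
theorem isTraceClass_of_summable {T : Op} (h : Summable (colNorm T)) : IsTraceClass T := by
  have : Infinite Idx := Infinite.of_injective
    (fun n : ℕ => (⟨n, ⟨0, by omega⟩, Sum.inl ⟨0, by omega⟩⟩ : Idx)) fun a b h => by
      simpa using congrArg (fun i : Idx => i.1) h
  obtain ⟨φ⟩ := nonempty_equiv_of_countable (α := ℕ) (β := Idx)
  let ξ : Idx → Hilb := fun k => ∑ l ∈ (T (Finsupp.single k 1)).support,
    lp.single 2 l (entry T l k)
  let η : Idx → Hilb := fun k => lp.single 2 k 1
  have hξ : ∀ i k, (ξ k : ∀ _, ℂ) i = entry T i k := by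
    intro i k
    simp only [ξ]
    rw [lp.coeFn_sum, Finset.sum_apply]
    simp only [lp.coeFn_single]
    rw [Finset.sum_eq_single i]
    · simp
    · intro l _ hl
      exact Pi.single_eq_of_ne hl.symm _
    · intro hi
      rw [Pi.single_eq_same]
      exact Finsupp.notMem_support_iff.1 hi
  have hnorm : ∀ k, ‖ξ k‖ * ‖η k‖ ≤ colNorm T k := by
    intro k
    have h1 : ‖η k‖ = 1 := by simp [η, lp.norm_single]
    rw [h1, mul_one]
    refine (norm_sum_le _ _).trans (Finset.sum_le_sum fun l _ => ?_)
    rw [lp.norm_single (by norm_num)]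
  refine ⟨ξ ∘ φ, η ∘ φ, ?_, fun i k => ?_⟩
  · exact (φ.summable_iff (f := fun k => ‖ξ k‖ * ‖η k‖)).2
      (Summable.of_nonneg_of_le (fun _ => by positivity) hnorm h)
  · refine Eq.trans ?_ (φ.tsum_eq fun n => (ξ n) i * conj ((η n) k)).symm
    rw [tsum_eq_single k]
    · simp [hξ, η]
    · intro n hn
      simp [η, Pi.single_eq_of_ne hn.symm]

theorem summable_entry_of_colNorm {T : Op} (h : Summable (colNorm T)) :
    Summable fun i => entry T i i :=
  Summable.of_norm_bounded h fun i => norm_entry_le T i i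

theorem opTrace_eq_tsum_levelTrace {T : Op} (h : Summable (colNorm T)) :
    opTrace T = ∑' m, levelTrace T m :=
  tsum_eq_tsum_levelSet (summable_entry_of_colNorm h)

/-! ### Zeta functions -/

theorem natCast_add_half_eq_ofReal (m : ℕ) : (m + 1 / 2 : ℂ) = ((m + 1 / 2 : ℝ) : ℂ) := by
  push_cast; rfl

theorem half_ne_zero (m : ℕ) : (m + 1 / 2 : ℂ) ≠ 0 := by
  rw [natCast_add_half_eq_ofReal, Complex.ofReal_ne_zero]
  positivity

theorem norm_half_cpow (m : ℕ) (z : ℂ) : ‖(m + 1 / 2 : ℂ) ^ z‖ = (m + 1 / 2 : ℝ) ^ z.re := by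
  rw [natCast_add_half_eq_ofReal, Complex.norm_cpow_eq_rpow_re_of_pos (by positivity)]

theorem colNorm_mul_absDPow (T : Op) (z : ℂ) (k : Idx) :
    colNorm (T * absDPow z) k = colNorm T k * (lvl k + 1 / 2 : ℝ) ^ z.re := by
  rw [absDPow_eq, colNorm_mul_diag, norm_half_cpow]

theorem levelTrace_mul_absDPow (T : Op) (z : ℂ) (m : ℕ) :
    levelTrace (T * absDPow z) m = levelTrace T m * (m + 1 / 2 : ℂ) ^ z := by
  rw [absDPow_eq]
  exact levelTrace_mul_diag T (fun m => (m + 1 / 2 : ℂ) ^ z) m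

theorem summable_colNorm_mul_absDPow {T : Op} {C : ℝ} {d : ℕ}
    (h : ∀ k, colNorm T k ≤ C * (lvl k + 1) ^ d) {z : ℂ} (hz : (d : ℝ) + 3 < z.re) :
    Summable (colNorm (T * absDPow (-z))) := by
  have hz0 : 0 < z.re := lt_of_le_of_lt (by positivity) hz
  refine summable_of_levelSet (g := fun m => |C| * (m + 1 : ℝ) ^ d * ((m + 1 : ℝ) / 2) ^ (-z.re))
    (colNorm_nonneg _) (fun i => ?_) ?_ (fun m => by positivity)
  · rw [colNorm_mul_absDPow]
    refine mul_le_mul ((h i).trans ?_) ?_ (by positivity) (by positivity)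
    · exact mul_le_mul_of_nonneg_right (le_abs_self C) (by positivity)
    · rw [Complex.neg_re]
      refine Real.rpow_le_rpow_of_nonpos (by positivity) ?_ (by linarith)
      have : (0 : ℝ) ≤ lvl i := Nat.cast_nonneg _
      linarith
  · have hs : Summable fun m : ℕ => ((m + 1 : ℕ) : ℝ) ^ ((d : ℝ) + 2 - z.re) :=
      (summable_nat_add_iff 1 (f := fun m : ℕ => (m : ℝ) ^ ((d : ℝ) + 2 - z.re))).2
        (Real.summable_nat_rpow.2 (by linarith))
    refine (hs.mul_left (2 * |C| * (1 / 2) ^ (-z.re))).congr fun m => ?_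
    have hm : (0 : ℝ) < m + 1 := by positivity
    rw [div_eq_mul_one_div (m + 1 : ℝ), Real.mul_rpow hm.le (by norm_num)]
    push_cast
    rw [show (d : ℝ) + 2 - z.re = ((d + 2 : ℕ) : ℝ) + -z.re by push_cast; ring,
      Real.rpow_add hm, Real.rpow_natCast, pow_add]
    ring

/-- The Laurent polynomial `∑ p_j t^j`. -/
def laurentEval (p : ℤ →₀ ℂ) (t : ℂ) : ℂ := p.sum fun j c => c * t ^ j

/-- The columns of `T` have polynomially bounded `ℓ¹`-norm, and up to an exponentially small
error the trace of `T` over the level `m` is the Laurent polynomial `∑ p_j (m + 1/2)^j`. -/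
structure HasExpansion (T : Op) (p : ℤ →₀ ℂ) : Prop where
  bdd : ∃ (C : ℝ) (d : ℕ), ∀ k, colNorm T k ≤ C * (lvl k + 1) ^ d
  asymp : ExpSmall id fun m : ℕ => ‖levelTrace T m - laurentEval p (m + 1 / 2)‖

/-- The Dirichlet series with exponentially small coefficients `e m` and frequencies `m + 1/2`. -/
def remainderZeta (e : ℕ → ℂ) (z : ℂ) : ℂ := ∑' m : ℕ, e m * (m + 1 / 2 : ℂ) ^ (-z)

theorem half_rpow_le (m : ℕ) {x R : ℝ} (hx : |x| ≤ R) :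
    (m + 1 / 2 : ℝ) ^ x ≤ (2 * (m + 1) : ℝ) ^ R := by
  have hm : (0 : ℝ) < m + 1 / 2 := by positivity
  have hm' : (0 : ℝ) ≤ m := Nat.cast_nonneg m
  rcases le_total 0 x with h | h
  · calc (m + 1 / 2 : ℝ) ^ x ≤ (2 * (m + 1) : ℝ) ^ x :=
          Real.rpow_le_rpow hm.le (by linarith) h
      _ ≤ _ := Real.rpow_le_rpow_of_exponent_le (by linarith) (by rwa [abs_of_nonneg h] at hx)
  · calc (m + 1 / 2 : ℝ) ^ x ≤ (1 / 2 : ℝ) ^ x :=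
          Real.rpow_le_rpow_of_nonpos (by norm_num) (by linarith) h
      _ = (2 : ℝ) ^ (-x) := by
          rw [one_div, Real.inv_rpow (by norm_num), Real.rpow_neg (by norm_num)]
      _ ≤ (2 * (m + 1) : ℝ) ^ (-x) :=
          Real.rpow_le_rpow (by norm_num) (by linarith) (by linarith)
      _ ≤ _ := Real.rpow_le_rpow_of_exponent_le (by linarith) (by rwa [abs_of_nonpos h] at hx)

theorem summable_remainder {e : ℕ → ℂ} (he : ExpSmall id fun m => ‖e m‖) (R : ℕ) :
    Summable fun m : ℕ => ‖e m‖ * (2 * (m + 1) : ℝ) ^ (R : ℝ) := by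
  have h := ((he.pow_mul R).const_mul (c := 2 ^ R) (by positivity)).summable
    (fun n => by positivity)
  refine h.congr fun m => ?_
  rw [Real.rpow_natCast, mul_pow]
  simp only [id]
  ring

theorem norm_remainder_le (e : ℕ → ℂ) {R : ℕ} {z : ℂ} (hz : ‖z‖ ≤ R) (m : ℕ) :
    ‖e m * (m + 1 / 2 : ℂ) ^ (-z)‖ ≤ ‖e m‖ * (2 * (m + 1) : ℝ) ^ (R : ℝ) := by
  rw [norm_mul, norm_half_cpow]
  gcongr
  refine half_rpow_le m ?_
  rw [Complex.neg_re, abs_neg]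
  exact (Complex.abs_re_le_norm z).trans hz

theorem hasSum_remainderZeta {e : ℕ → ℂ} (he : ExpSmall id fun m => ‖e m‖) (z : ℂ) :
    HasSum (fun m : ℕ => e m * (m + 1 / 2 : ℂ) ^ (-z)) (remainderZeta e z) := by
  obtain ⟨R, hR⟩ := exists_nat_ge ‖z‖
  exact (Summable.of_norm_bounded (summable_remainder he R)
    (norm_remainder_le e hR)).hasSum

theorem differentiable_remainderZeta {e : ℕ → ℂ} (he : ExpSmall id fun m => ‖e m‖) :
    Differentiable ℂ (remainderZeta e) := by
  intro z
  obtain ⟨R, hR⟩ := exists_nat_gt ‖z‖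
  have hU : IsOpen (Metric.ball (0 : ℂ) R) := Metric.isOpen_ball
  have h := Complex.differentiableOn_tsum_of_summable_norm
    (F := fun (m : ℕ) (z : ℂ) => e m * (m + 1 / 2 : ℂ) ^ (-z)) (summable_remainder he R)
    (fun m => ?_) hU fun m w hw =>
      norm_remainder_le e (by simpa using (mem_ball_zero_iff.1 hw).le) m
  · exact h.differentiableAt (hU.mem_nhds (by simpa using hR))
  · intro w _
    refine DifferentiableAt.differentiableWithinAt ?_
    exact (differentiableAt_const _).mul
      (differentiableAt_id.neg.const_cpow (Or.inl (half_ne_zero m)))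

/-- The Hurwitz zeta function `∑ (m + 1/2)^{-z}`. -/
def halfZeta : ℂ → ℂ := HurwitzZeta.hurwitzZeta ((1 / 2 : ℝ) : UnitAddCircle)

theorem hasSum_halfZeta {s : ℂ} (hs : 1 < s.re) :
    HasSum (fun m : ℕ => (m + 1 / 2 : ℂ) ^ (-s)) (halfZeta s) := by
  have h := HurwitzZeta.hasSum_hurwitzZeta_of_one_lt_re (a := 1 / 2) (by norm_num) hs
  refine h.congr_fun fun m => ?_
  rw [Complex.cpow_neg, ← one_div]
  norm_num

theorem differentiableAt_halfZeta {s : ℂ} (hs : s ≠ 1) : DifferentiableAt ℂ halfZeta s :=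
  HurwitzZeta.differentiableAt_hurwitzZeta _ hs

theorem halfZeta_zero : halfZeta 0 = 0 := by
  -- `1/2 = -1/2` on the circle, so that the odd part of the Hurwitz zeta function vanishes
  have hneg : -((1 / 2 : ℝ) : UnitAddCircle) = ((1 / 2 : ℝ) : UnitAddCircle) := by
    rw [← AddCircle.coe_neg, ← sub_eq_zero, ← AddCircle.coe_sub]
    rw [AddCircle.coe_eq_zero_iff]
    exact ⟨-1, by norm_num⟩
  have hne : ((1 / 2 : ℝ) : UnitAddCircle) ≠ 0 := by
    rw [Ne, AddCircle.coe_eq_zero_iff]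
    rintro ⟨n, hn⟩
    rw [zsmul_one] at hn
    have h2 : ((2 * n : ℤ) : ℝ) = ((1 : ℤ) : ℝ) := by push_cast; linarith
    have := Int.cast_injective h2
    omega
  have hodd : HurwitzZeta.hurwitzZetaOdd ((1 / 2 : ℝ) : UnitAddCircle) 0 = 0 := by
    rw [HurwitzZeta.hurwitzZetaOdd_eq, hneg, sub_self, zero_div]
  rw [halfZeta, HurwitzZeta.hurwitzZeta, hodd, HurwitzZeta.hurwitzZetaEven_apply_zero, if_neg hne,
    add_zero]

theorem halfZeta_neg_one : halfZeta (-1) = 1 / 24 := by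
  have h := HurwitzZeta.hurwitzZeta_neg_nat (k := 1) one_ne_zero (x := 1 / 2) (by norm_num)
  rw [Nat.cast_one] at h
  rw [halfZeta, h]
  simp [Polynomial.bernoulli, Finset.sum_range_succ, bernoulli_one, bernoulli_two,
    Polynomial.eval_monomial]
  norm_num

theorem halfZeta_neg_two : halfZeta (-2) = 0 := by
  have h := HurwitzZeta.hurwitzZeta_neg_nat (k := 2) two_ne_zero (x := 1 / 2) (by norm_num)
  rw [Nat.cast_ofNat] at h
  rw [halfZeta, h]
  simp [Polynomial.bernoulli, Finset.sum_range_succ, bernoulli_one, bernoulli_two,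
    Polynomial.eval_monomial, bernoulli_eq_zero_of_odd (n := 3) (by decide) (by norm_num)]
  norm_num

/-- The meromorphic continuation of `∑_m c_m (m + 1/2)^{-z}`, where `c_m` is the sum of
`∑ p_j (m + 1/2)^j` and an exponentially small remainder `e m`. -/
def expansionZeta (p : ℤ →₀ ℂ) (e : ℕ → ℂ) (z : ℂ) : ℂ :=
  (p.sum fun j c => c * halfZeta (z - j)) + remainderZeta e z

theorem meromorphic_halfZeta : Meromorphic halfZeta := by
  intro z
  rcases eq_or_ne z 1 with rfl | hz
  · have h1 : ∀ s : ℂ, DifferentiableAt ℂ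
        (fun s => halfZeta s - 1 / (s - 1) / Complex.Gammaℝ s) s := by
      intro s
      rcases eq_or_ne s 1 with rfl | hs
      · exact HurwitzZeta.differentiableAt_hurwitzZeta_sub_one_div _
      · refine (differentiableAt_halfZeta hs).sub ?_
        simp_rw [div_eq_mul_inv, one_mul]
        have h0 : DifferentiableAt ℂ (fun s : ℂ => (s - 1)⁻¹) s :=
          (differentiableAt_id.sub_const 1).inv (sub_ne_zero.2 hs)
        exact h0.mul (Complex.differentiable_Gammaℝ_inv s)
    have h2 : MeromorphicAt (fun s : ℂ => 1 / (s - 1) / Complex.Gammaℝ s) 1 := by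
      simp_rw [div_eq_mul_inv, one_mul]
      exact ((MeromorphicAt.id 1).sub (MeromorphicAt.const 1 1)).inv.mul
        (Complex.differentiable_Gammaℝ_inv.analyticAt 1).meromorphicAt
    have h3 := ((Differentiable.analyticAt h1 1).meromorphicAt).add h2
    refine h3.congr (Eventually.of_forall fun s => ?_)
    simp
  · refine AnalyticAt.meromorphicAt ?_
    exact DifferentiableOn.analyticAt (s := {1}ᶜ)
      (fun s hs => (differentiableAt_halfZeta hs).differentiableWithinAt)
      (isOpen_compl_singleton.mem_nhds hz)

theorem meromorphic_expansionZeta (p : ℤ →₀ ℂ) {e : ℕ → ℂ} (he : ExpSmall id fun m => ‖e m‖) :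
    Meromorphic (expansionZeta p e) := by
  intro z
  refine MeromorphicAt.add ?_
    ((differentiable_remainderZeta he).analyticAt z).meromorphicAt
  refine MeromorphicAt.fun_sum fun j _ => (MeromorphicAt.const _ z).mul ?_
  exact Meromorphic.meromorphic_fun_comp_sub_const_iff_meromorphic.2 meromorphic_halfZeta z

/-- The term `p_j (m + 1/2)^j` of the expansion contributes `p_j ζ(z - j, 1/2)` to the zeta
function, and the remainder contributes an entire function. -/
theorem HasExpansion.isZeta {T : Op} {p : ℤ →₀ ℂ} (h : HasExpansion T p) :
    IsZeta T (expansionZeta p fun m => levelTrace T m - laurentEval p (m + 1 / 2)) := by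
  obtain ⟨C, d, hC⟩ := h.bdd
  refine ⟨meromorphic_expansionZeta p h.asymp, ?_⟩
  obtain ⟨M, hM⟩ := p.support.exists_le
  refine ⟨max (d + 3) (M + 1), fun z hz => ?_⟩
  have hz1 : (d : ℝ) + 3 < z.re := (le_max_left _ _).trans_lt hz
  have hz2 : (M : ℝ) + 1 < z.re := (le_max_right _ _).trans_lt hz
  have hs := summable_colNorm_mul_absDPow hC hz1
  refine ⟨isTraceClass_of_summable hs, ?_⟩
  rw [opTrace_eq_tsum_levelTrace hs]
  have h1 : HasSum (fun m : ℕ => ∑ j ∈ p.support, p j * (m + 1 / 2 : ℂ) ^ (-(z - j)))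
      (p.sum fun j c => c * halfZeta (z - j)) := by
    refine hasSum_sum fun j hj => (hasSum_halfZeta ?_).mul_left _
    have : (j : ℝ) ≤ M := by exact_mod_cast hM j hj
    simp only [Complex.sub_re, Complex.intCast_re]
    linarith
  have h2 := h1.add (hasSum_remainderZeta h.asymp z)
  rw [expansionZeta, ← h2.tsum_eq]
  refine tsum_congr fun m => ?_
  have e : ∀ j : ℤ, (m + 1 / 2 : ℂ) ^ (-(z - j)) = (m + 1 / 2 : ℂ) ^ (-z) * (m + 1 / 2) ^ j := by
    intro j
    rw [neg_sub, sub_eq_neg_add, Complex.cpow_add _ _ (half_ne_zero m), Complex.cpow_intCast]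
  rw [levelTrace_mul_absDPow]
  simp_rw [e, laurentEval, Finsupp.sum]
  rw [sub_mul, Finset.sum_mul]
  simp_rw [show ∀ j : ℤ, p j * ((m + 1 / 2 : ℂ) ^ (-z) * (m + 1 / 2) ^ j) =
    p j * (m + 1 / 2) ^ j * (m + 1 / 2 : ℂ) ^ (-z) from fun j => by ring]
  ring

/-- The only pole of the Hurwitz zeta function is at `1`, with residue `1`. -/
theorem tendsto_mul_halfZeta (j : ℤ) :
    Tendsto (fun z : ℂ => z * halfZeta (z - j)) (𝓝[≠] 0) (𝓝 (if j = -1 then 1 else 0)) := by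
  split_ifs with hj
  · have h := HurwitzZeta.hurwitzZeta_residue_one ((1 / 2 : ℝ) : UnitAddCircle)
    have ht : Tendsto (fun z : ℂ => z + 1) (𝓝[≠] 0) (𝓝[≠] 1) := by
      refine tendsto_nhdsWithin_iff.2 ⟨?_, ?_⟩
      · refine Tendsto.mono_left ?_ nhdsWithin_le_nhds
        have : Continuous fun z : ℂ => z + 1 := by fun_prop
        simpa using this.tendsto 0
      · filter_upwards [self_mem_nhdsWithin] with z hz
        simpa using hz
    refine (h.comp ht).congr fun z => ?_
    simp [hj, halfZeta]
  · have hne : (0 : ℂ) - j ≠ 1 := by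
      intro h
      apply hj
      have : ((-j : ℤ) : ℂ) = ((1 : ℤ) : ℂ) := by push_cast; simpa using h
      have := Int.cast_injective this
      omega
    have hd : ContinuousAt (fun z : ℂ => halfZeta (z - j)) 0 :=
      ContinuousAt.comp (f := fun z : ℂ => z - j) (g := halfZeta)
        (differentiableAt_halfZeta hne).continuousAt (by fun_prop)
    have h := (continuousAt_id (x := (0 : ℂ))).mul hd
    have h' : Tendsto (fun z : ℂ => z * halfZeta (z - j)) (𝓝 0) (𝓝 (0 * halfZeta (0 - j))) := h
    rw [zero_mul] at h'
    exact h'.mono_left nhdsWithin_le_nhds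

/-- The residue at `0` of the zeta function of `T` is the coefficient of `(m + 1/2)^{-1}` in the
expansion of its level traces. -/
theorem HasExpansion.isNCInt {T : Op} {p : ℤ →₀ ℂ} (h : HasExpansion T p) :
    IsNCInt T (p (-1)) := by
  refine ⟨_, h.isZeta, ?_⟩
  have h1 : Tendsto (fun z : ℂ => ∑ j ∈ p.support, p j * (z * halfZeta (z - j))) (𝓝[≠] 0)
      (𝓝 (∑ j ∈ p.support, p j * if j = -1 then 1 else 0)) :=
    tendsto_finsetSum _ fun j _ => (tendsto_mul_halfZeta j).const_mul _
  have h2 : Tendsto (fun z : ℂ => z * remainderZeta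
      (fun m => levelTrace T m - laurentEval p (m + 1 / 2)) z) (𝓝[≠] 0) (𝓝 0) := by
    have h := continuous_id.mul (differentiable_remainderZeta h.asymp).continuous
    have h' := h.tendsto 0
    simp only [id, zero_mul, Pi.mul_apply] at h'
    exact h'.mono_left nhdsWithin_le_nhds
  have e : (∑ j ∈ p.support, p j * if j = -1 then 1 else 0) = p (-1) := by
    simp only [mul_ite, mul_one, mul_zero, Finset.sum_ite_eq', Finsupp.mem_support_iff]
    split_ifs with h0
    · rfl
    · exact (not_not.1 h0).symm
  have h3 := h1.add h2
  rw [e, add_zero] at h3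
  refine h3.congr fun z => ?_
  rw [expansionZeta, mul_add, Finsupp.sum, Finset.mul_sum]
  congr 1
  exact Finset.sum_congr rfl fun j _ => by ring

/-- If the exponent `-1` does not occur in the expansion, then the zeta function is regular at
`0`, with value `∑ p_j ζ(-j, 1/2)` plus the sum of the remainders. -/
theorem HasExpansion.isZetaZero {T : Op} {p : ℤ →₀ ℂ} (h : HasExpansion T p)
    (hp : ∀ j ∈ p.support, j ≠ -1) :
    IsZetaZero T ((p.sum fun j c => c * halfZeta (-j)) +
      ∑' m : ℕ, (levelTrace T m - laurentEval p (m + 1 / 2))) := by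
  refine ⟨_, h.isZeta, ?_⟩
  refine Tendsto.add ?_ ?_
  · refine tendsto_finsetSum _ fun j hj => Tendsto.const_mul _ ?_
    have hne : (0 : ℂ) - j ≠ 1 := by
      intro h
      apply hp j hj
      have : ((-j : ℤ) : ℂ) = ((1 : ℤ) : ℂ) := by push_cast; simpa using h
      have := Int.cast_injective this
      omega
    have hd : ContinuousAt (fun z : ℂ => halfZeta (z - j)) 0 :=
      ContinuousAt.comp (f := fun z : ℂ => z - j) (g := halfZeta)
        (differentiableAt_halfZeta hne).continuousAt (by fun_prop)
    have h' : Tendsto (fun z : ℂ => halfZeta (z - j)) (𝓝 0) (𝓝 (halfZeta (0 - j))) := hd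
    rw [zero_sub] at h'
    exact h'.mono_left nhdsWithin_le_nhds
  · have h' := (differentiable_remainderZeta h.asymp).continuous.tendsto 0
    have e : remainderZeta (fun m => levelTrace T m - laurentEval p (m + 1 / 2)) 0 =
        ∑' m : ℕ, (levelTrace T m - laurentEval p (m + 1 / 2)) :=
      tsum_congr fun m => by simp
    rw [e] at h'
    exact h'.mono_left nhdsWithin_le_nhds

/-! ### Smoothing operators -/

/-- The entries of `T` vanish outside a band around the level diagonal. -/
def LevelBanded (T : Op) : Prop :=
  ∃ K : ℕ, ∀ i k, entry T i k ≠ 0 → lvl i ≤ lvl k + K ∧ lvl k ≤ lvl i + K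

/-- Smoothing operators: level-banded, with exponentially small columns. -/
structure IsSmoothing (T : Op) : Prop where
  banded : LevelBanded T
  small : ExpSmall lvl (colNorm T)

/-- Level-banded operators with bounded columns. -/
structure IsBanded (T : Op) : Prop where
  banded : LevelBanded T
  bdd : ∃ C : ℝ, ∀ k, colNorm T k ≤ C

theorem entry_mul_ne_zero {A B : Op} {i k : Idx} (h : entry (A * B) i k ≠ 0) :
    ∃ l, entry A i l ≠ 0 ∧ entry B l k ≠ 0 := by
  rw [entry_mul A B i k (s := (B (Finsupp.single k 1)).support)
    fun l hl => Finsupp.mem_support_iff.2 hl] at h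
  obtain ⟨l, _, hl⟩ := Finset.exists_ne_zero_of_sum_ne_zero h
  exact ⟨l, left_ne_zero_of_mul hl, right_ne_zero_of_mul hl⟩

theorem LevelBanded.add {S T : Op} (hS : LevelBanded S) (hT : LevelBanded T) :
    LevelBanded (S + T) := by
  obtain ⟨K, hK⟩ := hS
  obtain ⟨K', hK'⟩ := hT
  refine ⟨K + K', fun i k h => ?_⟩
  by_cases h1 : entry S i k = 0
  · rw [entry_add, h1, zero_add] at h
    have := hK' i k h
    omega
  · have := hK i k h1
    omega

theorem LevelBanded.smul {T : Op} (hT : LevelBanded T) (c : ℂ) : LevelBanded (c • T) := by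
  obtain ⟨K, hK⟩ := hT
  exact ⟨K, fun i k h => hK i k (right_ne_zero_of_mul h)⟩

theorem LevelBanded.mul {S T : Op} (hS : LevelBanded S) (hT : LevelBanded T) :
    LevelBanded (S * T) := by
  obtain ⟨K, hK⟩ := hS
  obtain ⟨K', hK'⟩ := hT
  refine ⟨K + K', fun i k h => ?_⟩
  obtain ⟨l, h1, h2⟩ := entry_mul_ne_zero h
  have := hK i l h1
  have := hK' l k h2
  omega

theorem LevelBanded.mul_diag {T : Op} (hT : LevelBanded T) (f : Idx → ℂ) :
    LevelBanded (T * diag f) := by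
  obtain ⟨K, hK⟩ := hT
  exact ⟨K, fun i k h => hK i k (by rw [entry_mul_diag] at h; exact left_ne_zero_of_mul h)⟩

theorem IsBanded.add {S T : Op} (hS : IsBanded S) (hT : IsBanded T) : IsBanded (S + T) := by
  obtain ⟨C, hC⟩ := hS.bdd
  obtain ⟨C', hC'⟩ := hT.bdd
  exact ⟨hS.banded.add hT.banded, C + C', fun k =>
    (colNorm_add_le S T k).trans (add_le_add (hC k) (hC' k))⟩

theorem IsBanded.smul {T : Op} (hT : IsBanded T) (c : ℂ) : IsBanded (c • T) := by
  obtain ⟨C, hC⟩ := hT.bdd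
  exact ⟨hT.banded.smul c, ‖c‖ * C, fun k => by
    rw [colNorm_smul]; exact mul_le_mul_of_nonneg_left (hC k) (norm_nonneg c)⟩

theorem colNorm_zero (k : Idx) : colNorm 0 k = 0 := by
  have := colNorm_smul 0 0 k
  simpa using this

theorem IsSmoothing.zero : IsSmoothing 0 :=
  ⟨⟨0, fun _ _ h => absurd rfl h⟩, ExpSmall.of_nonpos fun k => (colNorm_zero k).le⟩

theorem IsSmoothing.add {S T : Op} (hS : IsSmoothing S) (hT : IsSmoothing T) :
    IsSmoothing (S + T) :=
  ⟨hS.banded.add hT.banded, (hS.small.add hT.small).mono (colNorm_add_le S T)⟩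

theorem IsSmoothing.smul {T : Op} (hT : IsSmoothing T) (c : ℂ) : IsSmoothing (c • T) :=
  ⟨hT.banded.smul c, (hT.small.const_mul (norm_nonneg c)).mono fun k => (colNorm_smul c T k).le⟩

theorem IsSmoothing.sub {S T : Op} (hS : IsSmoothing S) (hT : IsSmoothing T) :
    IsSmoothing (S - T) := by
  have h := hS.add (hT.smul (-1))
  rwa [neg_smul, one_smul, ← sub_eq_add_neg] at h

theorem IsSmoothing.isBanded {T : Op} (hT : IsSmoothing T) : IsBanded T := by
  obtain ⟨C, r, hC, h0, h1, H⟩ := hT.small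
  exact ⟨hT.banded, C, fun k => (H k).trans
    (mul_le_of_le_one_right hC (pow_le_one₀ h0.le h1.le))⟩

/-- Smoothing operators form an ideal in the banded operators. -/
theorem IsBanded.mul_smoothing {S T : Op} (hT : IsBanded T) (hS : IsSmoothing S) :
    IsSmoothing (T * S) := by
  obtain ⟨C, hC⟩ := hT.bdd
  refine ⟨hT.banded.mul hS.banded, (hS.small.const_mul (c := |C|) (abs_nonneg C)).mono fun k => ?_⟩
  exact colNorm_mul_le T S k fun l _ => (hC l).trans (le_abs_self C)

theorem IsSmoothing.mul_banded {S T : Op} (hS : IsSmoothing S) (hT : IsBanded T) :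
    IsSmoothing (S * T) := by
  obtain ⟨M, hM⟩ := hT.bdd
  obtain ⟨K, hK⟩ := hT.banded
  refine ⟨hS.banded.mul hT.banded, ?_⟩
  obtain ⟨C, r, hC, h0, h1, H⟩ := hS.small
  refine ExpSmall.of_le_pow h0 h1 (C * (r ^ K)⁻¹ * M) fun k => ?_
  have h2 : colNorm (S * T) k ≤ C * ((r ^ K)⁻¹ * r ^ lvl k) * colNorm T k := by
    refine colNorm_mul_le S T k fun l hl => (H l).trans ?_
    gcongr
    rw [inv_mul_eq_div, le_div_iff₀ (by positivity), ← pow_add]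
    exact pow_le_pow_of_le_one h0.le h1.le (hK l k hl).2
  calc colNorm (S * T) k ≤ C * ((r ^ K)⁻¹ * r ^ lvl k) * M :=
        h2.trans (mul_le_mul_of_nonneg_left (hM k) (by positivity))
    _ = _ := by ring

theorem IsSmoothing.mul_diag {S : Op} (hS : IsSmoothing S) (f : Idx → ℂ) {d : ℕ}
    (hf : ∀ k, ‖f k‖ ≤ (lvl k + 1 : ℝ) ^ d) : IsSmoothing (S * diag f) := by
  refine ⟨hS.banded.mul_diag f, (hS.small.pow_mul d).mono fun k => ?_⟩
  rw [colNorm_mul_diag, mul_comm]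
  exact mul_le_mul_of_nonneg_right (hf k) (colNorm_nonneg S k)

theorem IsSmoothing.mul_absD {S : Op} (hS : IsSmoothing S) : IsSmoothing (S * absD) := by
  rw [absD_eq]
  refine hS.mul_diag _ (d := 1) fun k => ?_
  rw [natCast_add_half_eq_ofReal, Complex.norm_real, Real.norm_of_nonneg (by positivity), pow_one]
  linarith

theorem IsSmoothing.summable {S : Op} (hS : IsSmoothing S) : Summable (colNorm S) := by
  obtain ⟨C, r, hC, h0, h1, H⟩ := hS.small
  refine summable_of_levelSet (g := fun m => C * r ^ m) (colNorm_nonneg S) H ?_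
    fun m => by positivity
  have h : ExpSmall id fun m : ℕ => C * r ^ m := ⟨C, r, hC, h0, h1, fun _ => le_rfl⟩
  have h2 := ((h.pow_mul 2).const_mul (c := 2) (by norm_num)).summable fun m => by positivity
  refine h2.congr fun m => ?_
  simp only [id]
  ring

theorem IsSmoothing.levelTrace_small {S : Op} (hS : IsSmoothing S) :
    ExpSmall id fun m => ‖levelTrace S m‖ := by
  obtain ⟨C, r, hC, h0, h1, H⟩ := hS.small
  have h : ExpSmall id fun m : ℕ => C * r ^ m := ⟨C, r, hC, h0, h1, fun _ => le_rfl⟩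
  refine ((h.pow_mul 2).const_mul (c := 2) (by norm_num)).mono fun m => ?_
  rw [← mul_assoc]
  exact norm_levelTrace_le S m (by positivity) fun k hk => hk ▸ H k

/-- The two iterated sums in `Tr(ST) = Tr(TS)` may be interchanged, because `S` is smoothing. -/
theorem opTrace_mul_comm {S T : Op} (hS : IsSmoothing S) (hT : IsBanded T) :
    opTrace (S * T) = opTrace (T * S) := by
  obtain ⟨M, hM⟩ := hT.bdd
  have e : ∀ (A B : Op) (i : Idx), entry (A * B) i i = ∑' l, entry A i l * entry B l i := by
    intro A B i
    rw [entry_mul A B i i (s := (B (Finsupp.single i 1)).support)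
      fun l hl => Finsupp.mem_support_iff.2 hl, tsum_eq_sum]
    intro l hl
    rw [show entry B l i = 0 from Finsupp.notMem_support_iff.1 hl, mul_zero]
  have hcol : ∀ i, HasSum (fun l => ‖entry S l i‖) (colNorm S i) := fun i =>
    hasSum_sum_of_ne_finset_zero fun l hl => by
      rw [show entry S l i = 0 from Finsupp.notMem_support_iff.1 hl, norm_zero]
  have hsum : Summable (Function.uncurry fun i l => entry T i l * entry S l i) := by
    have hn : Summable fun p : Idx × Idx => |M| * ‖entry S p.2 p.1‖ := by
      refine (summable_prod_of_nonneg fun _ => by positivity).2 ⟨fun i => ?_, ?_⟩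
      · exact (hcol i).summable.mul_left _
      · refine (hS.summable.mul_left |M|).congr fun i => ?_
        rw [tsum_mul_left, (hcol i).tsum_eq]
    refine Summable.of_norm_bounded hn fun p => ?_
    rw [Function.uncurry, norm_mul]
    exact mul_le_mul_of_nonneg_right
      ((norm_entry_le T _ _).trans ((hM _).trans (le_abs_self M))) (norm_nonneg _)
  unfold opTrace
  simp_rw [e]
  refine Eq.trans ?_ hsum.tsum_comm
  exact tsum_congr fun i => tsum_congr fun l => mul_comm _ _

/-! ### Weighted shifts -/

/-- Sequences which converge exponentially fast. -/
def ExpConst (u : ℕ → ℂ) : Prop := ∃ c : ℂ, ExpSmall id fun x => ‖u x - c‖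

namespace ExpConst

theorem const (c : ℂ) : ExpConst fun _ => c := ⟨c, ExpSmall.of_nonpos fun _ => by simp⟩

theorem bounded {u : ℕ → ℂ} (hu : ExpConst u) : ∃ C : ℝ, 0 ≤ C ∧ ∀ x, ‖u x‖ ≤ C := by
  obtain ⟨c, C, r, hC, h0, h1, H⟩ := hu
  refine ⟨C + ‖c‖, by positivity, fun x => ?_⟩
  have h2 : C * r ^ id x ≤ C := mul_le_of_le_one_right hC (pow_le_one₀ h0.le h1.le)
  calc ‖u x‖ = ‖(u x - c) + c‖ := by rw [sub_add_cancel]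
    _ ≤ ‖u x - c‖ + ‖c‖ := norm_add_le _ _
    _ ≤ C + ‖c‖ := by linarith [H x]

theorem mul {u v : ℕ → ℂ} (hu : ExpConst u) (hv : ExpConst v) : ExpConst fun x => u x * v x := by
  obtain ⟨M, hM0, hM⟩ := hv.bounded
  obtain ⟨c, hc⟩ := hu
  obtain ⟨d, hd⟩ := hv
  refine ⟨c * d, ((hc.const_mul hM0).add (hd.const_mul (norm_nonneg c))).mono fun x => ?_⟩
  rw [show u x * v x - c * d = v x * (u x - c) + c * (v x - d) by ring]
  refine (norm_add_le _ _).trans ?_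
  rw [norm_mul, norm_mul]
  gcongr
  exact hM x

theorem comp {u : ℕ → ℂ} (hu : ExpConst u) (φ : ℕ → ℕ) (K : ℕ) (h : ∀ x, x ≤ φ x + K) :
    ExpConst fun x => u (φ x) := by
  obtain ⟨c, hc⟩ := hu
  exact ⟨c, hc.comp φ K h⟩

theorem star {u : ℕ → ℂ} (hu : ExpConst u) : ExpConst fun x => conj (u x) := by
  obtain ⟨c, hc⟩ := hu
  refine ⟨conj c, hc.mono fun x => ?_⟩
  rw [← map_sub, RCLike.norm_conj]

/-- The partial sums of an exponentially convergent sequence are affine up to an exponentially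
small error. -/
theorem sum_range {u : ℕ → ℂ} (hu : ExpConst u) (d : ℕ) : ∃ a b : ℂ,
    ExpSmall id fun m : ℕ => ‖∑ x ∈ Finset.range (m + d), u x - (a * (m + 1 / 2) + b)‖ := by
  obtain ⟨c, hc⟩ := hu
  have hs : Summable fun x => u x - c :=
    Summable.of_norm (hc.summable fun _ => norm_nonneg _)
  refine ⟨c, c * (d - 1 / 2) + ∑' x, (u x - c), ?_⟩
  refine (hc.tail.comp (ℓ' := id) (fun m : ℕ => m + d) 0 fun m => by simp).mono fun m => ?_
  have h := hs.sum_add_tsum_nat_add (m + d)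
  rw [Finset.sum_sub_distrib, Finset.sum_const, Finset.card_range, nsmul_eq_mul] at h
  rw [← norm_neg]
  refine (congrArg norm ?_).le
  push_cast at h ⊢
  linear_combination -h

end ExpConst

/-- The sum of the entries of the `k`-th column of `T`. -/
def colSum (T : Op) (k : Idx) : ℂ :=
  Finsupp.linearCombination ℂ (fun _ => (1 : ℂ)) (T (Finsupp.single k 1))

/-- The label `i` has spin `s` and is obtained from the label `k`, also of spin `s`, by the shift
`κ` of the coordinates `(lvl, x, y)`. -/
def IsShift (s : Bool) (κ : ℤ × ℤ × ℤ) (i k : Idx) : Prop :=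
  isUp k = s ∧ isUp i = s ∧ (lvl i : ℤ) = lvl k + κ.1 ∧ (cx i : ℤ) = cx k + κ.2.1 ∧
    (cy i : ℤ) = cy k + κ.2.2

theorem IsShift.unique {s : Bool} {κ : ℤ × ℤ × ℤ} {i i' k : Idx} (h : IsShift s κ i k)
    (h' : IsShift s κ i' k) : i = i' := by
  obtain ⟨_, h2, h3, h4, h5⟩ := h
  obtain ⟨_, h2', h3', h4', h5'⟩ := h'
  exact idx_ext (h2.trans h2'.symm) (by omega) (by omega) (by omega)

theorem IsShift.trans {s : Bool} {κ κ' : ℤ × ℤ × ℤ} {i l k : Idx} (h : IsShift s κ i l)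
    (h' : IsShift s κ' l k) : IsShift s (κ + κ') i k := by
  obtain ⟨_, h2, h3, h4, h5⟩ := h
  obtain ⟨h1', _, h3', h4', h5'⟩ := h'
  refine ⟨h1', h2, ?_, ?_, ?_⟩ <;> simp only [Prod.fst_add, Prod.snd_add] <;> omega

/-- `T` is a weighted shift: it is supported on labels of spin `s`, shifts the coordinates
`(lvl, x, y)` by `κ`, and its weights are `u x * v y` up to a term which is exponentially small in
the level, with exponentially convergent `u` and `v`. If the shifted label is out of range, the
weight is zero, so that `u x * v y` itself is exponentially small. -/
structure IsWeightedShift (s : Bool) (κ : ℤ × ℤ × ℤ) (T : Op) : Prop where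
  shift : ∀ i k, entry T i k ≠ 0 → IsShift s κ i k
  weight : ∃ u v : ℕ → ℂ, ExpConst u ∧ ExpConst v ∧
    ExpSmall lvl fun k => ‖colSum T k - if isUp k = s then u (cx k) * v (cy k) else 0‖

namespace IsWeightedShift

variable {s : Bool} {κ κ' : ℤ × ℤ × ℤ} {A B T : Op}

theorem apply_single (h : ∀ i k, entry T i k ≠ 0 → IsShift s κ i k) {i k : Idx}
    (hi : IsShift s κ i k) :
    T (Finsupp.single k 1) = entry T i k • Finsupp.single i 1 := by
  ext l
  rw [Finsupp.smul_apply, Finsupp.single_apply, smul_eq_mul]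
  split_ifs with hl
  · rw [mul_one, ← hl]
    rfl
  · rw [mul_zero]
    by_contra h0
    exact hl (hi.unique (h l k h0))

theorem apply_single_eq_zero (h : ∀ i k, entry T i k ≠ 0 → IsShift s κ i k) {k : Idx}
    (hk : ∀ i, ¬ IsShift s κ i k) : T (Finsupp.single k 1) = 0 := by
  ext l
  by_contra h0
  exact hk l (h l k h0)

theorem colSum_eq (h : ∀ i k, entry T i k ≠ 0 → IsShift s κ i k) {i k : Idx}
    (hi : IsShift s κ i k) : colSum T k = entry T i k := by
  rw [colSum, apply_single h hi, map_smul, Finsupp.linearCombination_single]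
  simp

theorem colSum_eq_zero (h : ∀ i k, entry T i k ≠ 0 → IsShift s κ i k) {k : Idx}
    (hk : ∀ i, ¬ IsShift s κ i k) : colSum T k = 0 := by
  rw [colSum, apply_single_eq_zero h hk, map_zero]

theorem colNorm_eq (h : ∀ i k, entry T i k ≠ 0 → IsShift s κ i k) (k : Idx) :
    colNorm T k = ‖colSum T k‖ := by
  by_cases hk : ∃ i, IsShift s κ i k
  · obtain ⟨i, hi⟩ := hk
    rw [colSum_eq h hi, colNorm_eq_sum T k (s := {i}), Finset.sum_singleton]
    intro l hl
    rw [Finset.mem_singleton]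
    exact (h l k hl).unique hi
  · rw [colSum_eq_zero h (not_exists.1 hk), norm_zero, colNorm_eq_sum T k (s := ∅),
      Finset.sum_empty]
    intro l hl
    exact absurd ⟨l, h l k hl⟩ hk

theorem levelBanded (h : ∀ i k, entry T i k ≠ 0 → IsShift s κ i k) : LevelBanded T := by
  refine ⟨κ.1.natAbs, fun i k hik => ?_⟩
  have := (h i k hik).2.2.1
  omega

theorem colSum_bounded (h : IsWeightedShift s κ T) : ∃ C : ℝ, 0 ≤ C ∧ ∀ k, ‖colSum T k‖ ≤ C := by
  obtain ⟨u, v, hu, hv, C, r, hC, h0, h1, H⟩ := h.weight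
  obtain ⟨M, hM0, hM⟩ := hu.bounded
  obtain ⟨M', hM0', hM'⟩ := hv.bounded
  refine ⟨C + M * M', by positivity, fun k => ?_⟩
  have h2 : C * r ^ lvl k ≤ C := mul_le_of_le_one_right hC (pow_le_one₀ h0.le h1.le)
  have h3 : ‖if isUp k = s then u (cx k) * v (cy k) else 0‖ ≤ M * M' := by
    split_ifs
    · rw [norm_mul]
      exact mul_le_mul (hM _) (hM' _) (norm_nonneg _) hM0
    · rw [norm_zero]
      positivity
  have h4 := norm_add_le (colSum T k - if isUp k = s then u (cx k) * v (cy k) else 0)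
    (if isUp k = s then u (cx k) * v (cy k) else 0)
  rw [sub_add_cancel] at h4
  linarith [H k]

theorem isBanded (h : IsWeightedShift s κ T) : IsBanded T := by
  obtain ⟨C, _, hC⟩ := h.colSum_bounded
  exact ⟨levelBanded h.shift, C, fun k => (colNorm_eq h.shift k).le.trans (hC k)⟩

/-- The weights of a product of weighted shifts are products of shifted weights. -/
theorem mul (hA : IsWeightedShift s κ A) (hB : IsWeightedShift s κ' B) :
    IsWeightedShift s (κ + κ') (A * B) := by
  refine ⟨fun i k h => ?_, ?_⟩
  · obtain ⟨l, h1, h2⟩ := entry_mul_ne_zero h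
    exact (hA.shift i l h1).trans (hB.shift l k h2)
  obtain ⟨M, hM0, hM⟩ := hB.colSum_bounded
  obtain ⟨u, v, hu, hv, C, r, hC, h0, h1, H⟩ := hA.weight
  obtain ⟨u', v', hu', hv', H'⟩ := hB.weight
  obtain ⟨Mu, hMu0, hMu⟩ := hu.bounded
  obtain ⟨Mv, hMv0, hMv⟩ := hv.bounded
  refine ⟨fun x => u ((x : ℤ) + κ'.2.1).toNat * u' x, fun y => v ((y : ℤ) + κ'.2.2).toNat * v' y,
    (hu.comp (fun x => ((x : ℤ) + κ'.2.1).toNat) κ'.2.1.natAbs fun x => by omega).mul hu',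
    (hv.comp (fun y => ((y : ℤ) + κ'.2.2).toNat) κ'.2.2.natAbs fun x => by omega).mul hv', ?_⟩
  set K := κ'.1.natAbs
  have hg : ExpSmall lvl fun k => M * (C * (r ^ K)⁻¹) * r ^ lvl k :=
    ⟨_, r, by positivity, h0, h1, fun _ => le_rfl⟩
  refine (hg.add (H'.const_mul (mul_nonneg hMu0 hMv0))).mono fun k => ?_
  have hbound : ∀ x y, ‖u x * v y‖ ≤ Mu * Mv := fun x y => by
    rw [norm_mul]
    exact mul_le_mul (hMu x) (hMv y) (norm_nonneg _) hMu0
  by_cases hk : ∃ l, IsShift s κ' l k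
  · obtain ⟨l, hl⟩ := hk
    have e1 : colSum (A * B) k = colSum B k * colSum A l := by
      rw [colSum_eq hB.shift hl]
      unfold colSum
      rw [Module.End.mul_apply, apply_single hB.shift hl, map_smul, map_smul, smul_eq_mul]
    have e2 : ((cx k : ℤ) + κ'.2.1).toNat = cx l := by have := hl.2.2.2.1; omega
    have e3 : ((cy k : ℤ) + κ'.2.2).toNat = cy l := by have := hl.2.2.2.2; omega
    have hup := hl.1
    have hlup := hl.2.1
    have Hl := H l
    rw [e1, if_pos hup, if_pos hup]
    dsimp only
    rw [e2, e3]
    dsimp only at Hl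
    rw [if_pos hlup] at Hl
    have hr : C * r ^ lvl l ≤ C * (r ^ K)⁻¹ * r ^ lvl k := by
      rw [mul_assoc]
      gcongr
      rw [inv_mul_eq_div, le_div_iff₀ (by positivity), ← pow_add]
      refine pow_le_pow_of_le_one h0.le h1.le ?_
      have := hl.2.2.1
      omega
    have e4 : colSum B k * colSum A l - u (cx l) * u' (cx k) * (v (cy l) * v' (cy k)) =
        colSum B k * (colSum A l - u (cx l) * v (cy l)) +
          u (cx l) * v (cy l) * (colSum B k - u' (cx k) * v' (cy k)) := by ring
    rw [e4]
    refine (norm_add_le _ _).trans (add_le_add ?_ ?_)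
    · rw [norm_mul, mul_assoc]
      exact mul_le_mul (hM k) (Hl.trans hr) (norm_nonneg _) hM0
    · rw [norm_mul]
      exact mul_le_mul_of_nonneg_right (hbound _ _) (norm_nonneg _)
  · have hk' := not_exists.1 hk
    have e1 : colSum (A * B) k = 0 := by
      rw [colSum, Module.End.mul_apply, apply_single_eq_zero hB.shift hk', map_zero, map_zero]
    rw [e1, colSum_eq_zero hB.shift hk', zero_sub, zero_sub, norm_neg, norm_neg]
    refine le_add_of_nonneg_of_le (by positivity) ?_
    split_ifs with hup
    · rw [show ∀ a b c d : ℂ, a * b * (c * d) = a * c * (b * d) from fun a b c d => by ring,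
        norm_mul]
      exact mul_le_mul_of_nonneg_right (hbound _ _) (norm_nonneg _)
    · simp

end IsWeightedShift

/-! ### The tame algebra -/

/-- The generators of the tame algebra: weighted shifts and smoothing operators. -/
def IsTameGen (T : Op) : Prop := (∃ s κ, IsWeightedShift s κ T) ∨ IsSmoothing T

theorem IsTameGen.isBanded {T : Op} (h : IsTameGen T) : IsBanded T := by
  obtain ⟨s, κ, h⟩ | h := h
  · exact h.isBanded
  · exact h.isBanded

theorem IsTameGen.mul {S T : Op} (hS : IsTameGen S) (hT : IsTameGen T) : IsTameGen (S * T) := by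
  rcases hS with ⟨s, κ, hS⟩ | hS
  · rcases hT with ⟨s', κ', hT⟩ | hT
    · rcases eq_or_ne s s' with rfl | hne
      · exact Or.inl ⟨s, _, hS.mul hT⟩
      · have : S * T = 0 := by
          refine op_ext fun i k => ?_
          by_contra h
          obtain ⟨l, h1, h2⟩ := entry_mul_ne_zero h
          exact hne ((hS.shift i l h1).1.symm.trans (hT.shift l k h2).2.1)
        rw [this]
        exact Or.inr IsSmoothing.zero
    · exact Or.inr (hS.isBanded.mul_smoothing hT)
  · exact Or.inr (hS.mul_banded hT.isBanded)

/-- The projection to the vectors of spin `s`. -/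
def spinProj (s : Bool) : Op := diag fun i => if isUp i = s then 1 else 0

theorem isWeightedShift_spinProj (s : Bool) : IsWeightedShift s 0 (spinProj s) := by
  have hs : ∀ i k, entry (spinProj s) i k ≠ 0 → IsShift s 0 i k := by
    intro i k h
    rw [spinProj, entry_diag] at h
    split_ifs at h with h1 h2
    · subst h1
      simp [IsShift, h2]
    · exact absurd rfl h
    · exact absurd rfl h
  refine ⟨hs, fun _ => 1, fun _ => 1, ExpConst.const 1, ExpConst.const 1,
    ExpSmall.of_nonpos fun k => ?_⟩
  by_cases hk : isUp k = s
  · rw [IsWeightedShift.colSum_eq hs (i := k) (by simp [IsShift, hk]), spinProj, entry_diag]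
    simp [hk]
  · rw [IsWeightedShift.colSum_eq_zero hs fun i hi => hk hi.1]
    simp [hk]

theorem spinProj_add : spinProj true + spinProj false = 1 := by
  rw [← diag_one]
  refine op_ext fun i k => ?_
  rw [entry_add, spinProj, spinProj, entry_diag, entry_diag, entry_diag]
  split_ifs with h1 h2 h3 h3 <;> simp_all

theorem spinProj_sub : spinProj true - spinProj false = F := by
  rw [F_eq]
  refine op_ext fun i k => ?_
  rw [entry_sub, spinProj, spinProj, entry_diag, entry_diag, entry_diag]
  split_ifs with h1 h2 h3 h3 <;> simp_all

/-- The algebra spanned by weighted shifts and smoothing operators, which plays the role of the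
algebra of classical pseudodifferential operators of order zero. It is unital because the identity
is the sum of the two spin projections. -/
def Tame : Subalgebra ℂ Op :=
  (Submodule.span ℂ {T | IsTameGen T}).toSubalgebra
    (by
      rw [← spinProj_add]
      exact add_mem (Submodule.subset_span (Or.inl ⟨_, _, isWeightedShift_spinProj _⟩))
        (Submodule.subset_span (Or.inl ⟨_, _, isWeightedShift_spinProj _⟩)))
    (fun S T hS hT => by
      have h := Submodule.mul_mem_mul hS hT
      rw [Submodule.span_mul_span] at h
      refine Submodule.span_mono ?_ h
      rintro _ ⟨A, hA, B, hB, rfl⟩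
      exact IsTameGen.mul hA hB)

theorem IsTameGen.mem {T : Op} (h : IsTameGen T) : T ∈ Tame := Submodule.subset_span h

theorem IsWeightedShift.mem {s : Bool} {κ : ℤ × ℤ × ℤ} {T : Op} (h : IsWeightedShift s κ T) :
    T ∈ Tame := IsTameGen.mem (Or.inl ⟨s, κ, h⟩)

theorem IsSmoothing.mem {T : Op} (h : IsSmoothing T) : T ∈ Tame := IsTameGen.mem (Or.inr h)

/-- `Tame` is the linear span of its generators, so that products need no induction step. -/
@[elab_as_elim]
theorem tame_induction {p : ∀ T : Op, T ∈ Tame → Prop} (gen : ∀ T (h : IsTameGen T), p T h.mem)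
    (add : ∀ S T hS hT, p S hS → p T hT → p (S + T) (add_mem hS hT))
    (smul : ∀ (c : ℂ) T hT, p T hT → p (c • T) (Subalgebra.smul_mem _ hT c))
    {T : Op} (hT : T ∈ Tame) : p T hT := by
  refine Submodule.span_induction (p := p) gen ?_ add smul hT
  exact gen 0 (Or.inr IsSmoothing.zero)

theorem isBanded_of_tame {T : Op} (hT : T ∈ Tame) : IsBanded T := by
  induction hT using tame_induction with
  | gen T h => exact h.isBanded
  | add S T _ _ h h' => exact h.add h'
  | smul c T _ h => exact h.smul c

theorem F_mem : F ∈ Tame := by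
  rw [← spinProj_sub]
  exact sub_mem (isWeightedShift_spinProj _).mem (isWeightedShift_spinProj _).mem

theorem P_mem : P ∈ Tame := Subalgebra.smul_mem _ (add_mem (one_mem _) F_mem) _

theorem entry_δ (T : Op) (i k : Idx) :
    entry (δ T) i k = ((lvl i : ℂ) - lvl k) * entry T i k := by
  rw [δ, comm, entry_sub, absD_eq, entry_diag_mul, entry_mul_diag]
  ring

theorem δ_add (S T : Op) : δ (S + T) = δ S + δ T := by
  simp only [δ, comm, mul_add, add_mul]; abel

theorem δ_smul (c : ℂ) (T : Op) : δ (c • T) = c • δ T := by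
  simp only [δ, comm, mul_smul_comm, smul_mul_assoc, smul_sub]

theorem δ_mul (S T : Op) : δ (S * T) = δ S * T + S * δ T := by
  simp only [δ, comm]; noncomm_ring

/-- `T` is homogeneous of degree `a` for the grading of operators by level shifts. -/
def IsHomog (a : ℤ) (T : Op) : Prop := ∀ i k, entry T i k ≠ 0 → (lvl i : ℤ) = lvl k + a

/-- On operators of degree `a` the derivation `δ` is multiplication by `a`, since `|D|` has the
eigenvalue `m + 1/2` on the level `m`. -/
theorem IsHomog.δ_eq {a : ℤ} {T : Op} (h : IsHomog a T) : δ T = (a : ℂ) • T := by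
  refine op_ext fun i k => ?_
  rw [entry_δ, entry_smul]
  by_cases h0 : entry T i k = 0
  · rw [h0, mul_zero, mul_zero]
  · have := h i k h0
    have e : (lvl i : ℂ) = lvl k + a := by exact_mod_cast this
    rw [e]
    ring

theorem IsWeightedShift.isHomog {s : Bool} {κ : ℤ × ℤ × ℤ} {T : Op}
    (h : IsWeightedShift s κ T) : IsHomog κ.1 T := fun i k hik => (h.shift i k hik).2.2.1

theorem IsSmoothing.δ {T : Op} (h : IsSmoothing T) : IsSmoothing (δ T) := by
  obtain ⟨K, hK⟩ := h.banded
  refine ⟨⟨K, fun i k hik => hK i k ?_⟩, (h.small.const_mul (c := K) (by positivity)).mono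
    fun k => ?_⟩
  · rw [entry_δ] at hik
    exact right_ne_zero_of_mul hik
  · rw [colNorm_eq_sum (QSU2.δ T) k (s := (T (Finsupp.single k 1)).support), colNorm,
      Finset.mul_sum]
    · refine Finset.sum_le_sum fun l hl => ?_
      rw [entry_δ, norm_mul]
      refine mul_le_mul_of_nonneg_right ?_ (norm_nonneg _)
      have h1 := hK l k (Finsupp.mem_support_iff.1 hl)
      have e : ((lvl l : ℂ) - lvl k) = (((lvl l : ℝ) - lvl k : ℝ) : ℂ) := by push_cast; rfl
      rw [e, Complex.norm_real, Real.norm_eq_abs, abs_le]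
      have h2 : (lvl l : ℝ) ≤ lvl k + K := by exact_mod_cast h1.1
      have h3 : (lvl k : ℝ) ≤ lvl l + K := by exact_mod_cast h1.2
      constructor <;> linarith
    · intro l hl
      rw [entry_δ] at hl
      exact Finsupp.mem_support_iff.2 (right_ne_zero_of_mul hl)

theorem δ_mem {T : Op} (hT : T ∈ Tame) : δ T ∈ Tame := by
  induction hT using tame_induction with
  | gen T h =>
    obtain ⟨s, κ, h⟩ | h := h
    · rw [h.isHomog.δ_eq]
      exact Subalgebra.smul_mem _ h.mem _
    · exact h.δ.mem
  | add S T _ _ h h' => rw [δ_add]; exact add_mem h h'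
  | smul c T _ h => rw [δ_smul]; exact Subalgebra.smul_mem _ h c

/-- Weighted shifts preserve the spin and so commute with `F`; hence `F` commutes with tame
operators up to smoothing operators. -/
theorem comm_F_smoothing {T : Op} (hT : T ∈ Tame) : IsSmoothing (comm F T) := by
  induction hT using tame_induction with
  | gen T h =>
    obtain ⟨s, κ, h⟩ | h := h
    · have : comm F T = 0 := by
        refine op_ext fun i k => ?_
        rw [comm, entry_sub, F_eq, entry_diag_mul, entry_mul_diag, entry_zero]
        by_cases h0 : entry T i k = 0
        · simp [h0]
        · have h1 := h.shift i k h0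
          rw [h1.1, h1.2.1]
          ring
      rw [this]
      exact IsSmoothing.zero
    · exact ((isBanded_of_tame F_mem).mul_smoothing h).sub
        (h.mul_banded (isBanded_of_tame F_mem))
  | add S T _ _ h h' =>
    have : comm F (S + T) = comm F S + comm F T := by simp only [comm, mul_add, add_mul]; abel
    rw [this]
    exact h.add h'
  | smul c T _ h =>
    have : comm F (c • T) = c • comm F T := by
      simp only [comm, mul_smul_comm, smul_mul_assoc, smul_sub]
    rw [this]
    exact h.smul c

/-! ### Expansions of level traces -/

/-- `T` has bounded columns, and its level traces are `p₀ + p₁ (m + 1/2) + p₂ (m + 1/2)²` up to an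
exponentially small error. -/
structure HasQuadExpansion (T : Op) (p₀ p₁ p₂ : ℂ) : Prop where
  bdd : ∃ C : ℝ, ∀ k, colNorm T k ≤ C
  asymp : ExpSmall id fun m : ℕ =>
    ‖levelTrace T m - (p₀ + p₁ * (m + 1 / 2) + p₂ * (m + 1 / 2) ^ 2)‖

theorem HasQuadExpansion.add {S T : Op} {p₀ p₁ p₂ r₀ r₁ r₂ : ℂ} (hS : HasQuadExpansion S p₀ p₁ p₂)
    (hT : HasQuadExpansion T r₀ r₁ r₂) :
    HasQuadExpansion (S + T) (p₀ + r₀) (p₁ + r₁) (p₂ + r₂) := by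
  obtain ⟨C, hC⟩ := hS.bdd
  obtain ⟨C', hC'⟩ := hT.bdd
  refine ⟨⟨C + C', fun k => (colNorm_add_le S T k).trans (add_le_add (hC k) (hC' k))⟩,
    (hS.asymp.add hT.asymp).mono fun m => ?_⟩
  refine le_trans (le_of_eq ?_) (norm_add_le _ _)
  rw [levelTrace_add]
  congr 1
  ring

theorem HasQuadExpansion.smul {T : Op} {p₀ p₁ p₂ : ℂ} (hT : HasQuadExpansion T p₀ p₁ p₂) (c : ℂ) :
    HasQuadExpansion (c • T) (c * p₀) (c * p₁) (c * p₂) := by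
  obtain ⟨C, hC⟩ := hT.bdd
  refine ⟨⟨‖c‖ * C, fun k => by
    rw [colNorm_smul]; exact mul_le_mul_of_nonneg_left (hC k) (norm_nonneg c)⟩,
    (hT.asymp.const_mul (norm_nonneg c)).mono fun m => ?_⟩
  rw [← norm_mul, levelTrace_smul]
  refine le_of_eq (congrArg norm ?_)
  ring

theorem IsSmoothing.hasQuadExpansion {S : Op} (hS : IsSmoothing S) : HasQuadExpansion S 0 0 0 :=
  ⟨hS.isBanded.bdd, by simpa using hS.levelTrace_small⟩

theorem affine_bound (a b : ℂ) (m : ℕ) :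
    ‖a * (m + 1 / 2) + b‖ ≤ (‖a‖ + ‖b‖) * (m + 1 : ℝ) ^ 1 := by
  have hm : (0 : ℝ) ≤ m := Nat.cast_nonneg m
  refine (norm_add_le _ _).trans ?_
  rw [norm_mul, natCast_add_half_eq_ofReal, Complex.norm_real, Real.norm_of_nonneg (by positivity)]
  nlinarith [norm_nonneg a, norm_nonneg b]

/-- The level traces of a diagonal weighted shift are sums of products `u x * v y` over a
rectangle, that is products of two partial sums, each of them affine in the level. -/
theorem IsWeightedShift.hasQuadExpansion {s : Bool} {κ : ℤ × ℤ × ℤ} {T : Op}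
    (hT : IsWeightedShift s κ T) : ∃ p₀ p₁ p₂ : ℂ, HasQuadExpansion T p₀ p₁ p₂ := by
  rcases eq_or_ne κ 0 with rfl | hκ
  swap
  · refine ⟨0, 0, 0, hT.isBanded.bdd, ExpSmall.of_nonpos fun m => ?_⟩
    have : levelTrace T m = 0 := by
      refine Finset.sum_eq_zero fun i _ => ?_
      by_contra h
      obtain ⟨_, _, h1, h2, h3⟩ := hT.shift i i h
      exact hκ (Prod.ext (by simpa using h1.symm)
        (Prod.ext (by simpa using h2.symm) (by simpa using h3.symm)))
    simp [this]
  obtain ⟨u, v, hu, hv, C, r, hC, h0, h1, H⟩ := hT.weight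
  obtain ⟨a, b, hU⟩ := hu.sum_range (!s).toNat
  obtain ⟨a', b', hV⟩ := hv.sum_range s.toNat
  refine ⟨b * b', a * b' + a' * b, a * a', hT.isBanded.bdd, ?_⟩
  set U : ℕ → ℂ := fun m => ∑ x ∈ Finset.range (m + (!s).toNat), u x
  set V : ℕ → ℂ := fun m => ∑ x ∈ Finset.range (m + s.toNat), v x
  have e1 : ∀ m, ‖levelTrace T m - U m * V m‖ ≤ 2 * ((m + 1 : ℝ) ^ 2 * (C * r ^ m)) := by
    intro m
    have hUV : U m * V m =
        ∑ i ∈ levelSet m, if isUp i = s then u (cx i) * v (cy i) else 0 := by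
      rw [← Finset.sum_filter, sum_levelSet_spin s m fun x y => u x * v y]
      simp only [U, V]
      rw [Finset.sum_mul_sum]
    rw [hUV, levelTrace, ← Finset.sum_sub_distrib]
    calc _ ≤ ∑ i ∈ levelSet m, C * r ^ m := by
          refine (norm_sum_le _ _).trans (Finset.sum_le_sum fun i hi => ?_)
          have hH : ‖colSum T i - if isUp i = s then u (cx i) * v (cy i) else 0‖ ≤ C * r ^ m := by
            rw [← mem_levelSet.1 hi]
            exact H i
          refine le_trans (le_of_eq ?_) hH
          by_cases hs : isUp i = s
          · rw [IsWeightedShift.colSum_eq hT.shift (i := i) (by simp [IsShift, hs])]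
          · rw [IsWeightedShift.colSum_eq_zero hT.shift fun l hl => hs hl.1]
            have : entry T i i = 0 := by
              by_contra h
              exact hs (hT.shift i i h).1
            rw [this]
      _ = (levelSet m).card * (C * r ^ m) := by rw [Finset.sum_const, nsmul_eq_mul]
      _ ≤ (2 * (m + 1) ^ 2 : ℕ) * (C * r ^ m) :=
          mul_le_mul_of_nonneg_right (Nat.cast_le.2 (card_levelSet_le m)) (by positivity)
      _ = _ := by push_cast; ring
  have hg : ExpSmall id fun m : ℕ => C * r ^ m := ⟨C, r, hC, h0, h1, fun _ => le_rfl⟩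
  have E1 := (hg.pow_mul 2).const_mul (c := 2) (by norm_num)
  obtain ⟨M, hM⟩ : ∃ M : ℝ, ∀ m : ℕ, ‖U m - (a * (m + 1 / 2) + b)‖ ≤ M := by
    obtain ⟨C, r, hC, h0, h1, H⟩ := hU
    exact ⟨C, fun m => (H m).trans (mul_le_of_le_one_right hC (pow_le_one₀ h0.le h1.le))⟩
  have hM0 : 0 ≤ M := (norm_nonneg _).trans (hM 0)
  have E2 := (hU.pow_mul 1).const_mul (c := ‖a'‖ + ‖b'‖) (by positivity)
  have E3 := (hV.pow_mul 1).const_mul (c := ‖a‖ + ‖b‖) (by positivity)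
  have E4 := hV.const_mul hM0
  refine (((E1.add E2).add E3).add E4).mono fun m => ?_
  have e2 : levelTrace T m - (b * b' + (a * b' + a' * b) * (m + 1 / 2) +
        a * a' * (m + 1 / 2) ^ 2) = (levelTrace T m - U m * V m) +
      (U m - (a * (m + 1 / 2) + b)) * (a' * (m + 1 / 2) + b') +
      (a * (m + 1 / 2) + b) * (V m - (a' * (m + 1 / 2) + b')) +
      (U m - (a * (m + 1 / 2) + b)) * (V m - (a' * (m + 1 / 2) + b')) := by ring
  rw [e2]
  refine (norm_add_le _ _).trans (add_le_add ((norm_add_le _ _).trans (add_le_add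
    ((norm_add_le _ _).trans (add_le_add (e1 m) ?_)) ?_)) ?_)
  · rw [norm_mul, mul_comm, ← mul_assoc]
    exact mul_le_mul_of_nonneg_right (affine_bound a' b' m) (norm_nonneg _)
  · rw [norm_mul, ← mul_assoc]
    exact mul_le_mul_of_nonneg_right (affine_bound a b m) (norm_nonneg _)
  · rw [norm_mul]
    exact mul_le_mul_of_nonneg_right (hM m) (norm_nonneg _)

/-- Tame operators have dimension at most three: their level traces grow at most quadratically. -/
theorem exists_hasQuadExpansion {T : Op} (hT : T ∈ Tame) :
    ∃ p₀ p₁ p₂ : ℂ, HasQuadExpansion T p₀ p₁ p₂ := by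
  induction hT using tame_induction with
  | gen T h =>
    obtain ⟨s, κ, h⟩ | h := h
    · exact h.hasQuadExpansion
    · exact ⟨0, 0, 0, h.hasQuadExpansion⟩
  | add S T _ _ h h' =>
    obtain ⟨_, _, _, h⟩ := h
    obtain ⟨_, _, _, h'⟩ := h'
    exact ⟨_, _, _, h.add h'⟩
  | smul c T _ h =>
    obtain ⟨_, _, _, h⟩ := h
    exact ⟨_, _, _, h.smul c⟩

theorem laurentEval_add (p r : ℤ →₀ ℂ) (t : ℂ) :
    laurentEval (p + r) t = laurentEval p t + laurentEval r t :=
  Finsupp.sum_add_index' (by simp) fun _ _ _ => by ring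

theorem laurentEval_single (j : ℤ) (c t : ℂ) : laurentEval (Finsupp.single j c) t = c * t ^ j :=
  Finsupp.sum_single_index (by simp)

theorem laurentEval_smul (c : ℂ) (p : ℤ →₀ ℂ) (t : ℂ) :
    laurentEval (c • p) t = c * laurentEval p t := by
  rw [laurentEval, laurentEval, Finsupp.sum_smul_index (by simp), Finsupp.sum, Finsupp.sum,
    Finset.mul_sum]
  exact Finset.sum_congr rfl fun _ _ => by ring

theorem HasExpansion.add {S T : Op} {p r : ℤ →₀ ℂ} (hS : HasExpansion S p)
    (hT : HasExpansion T r) : HasExpansion (S + T) (p + r) := by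
  obtain ⟨C, d, hC⟩ := hS.bdd
  obtain ⟨C', d', hC'⟩ := hT.bdd
  refine ⟨⟨|C| + |C'|, d + d', fun k => (colNorm_add_le S T k).trans ?_⟩,
    (hS.asymp.add hT.asymp).mono fun m => ?_⟩
  · have h1 : (1 : ℝ) ≤ lvl k + 1 := by simp
    have e1 : C * (lvl k + 1 : ℝ) ^ d ≤ |C| * (lvl k + 1 : ℝ) ^ (d + d') :=
      mul_le_mul (le_abs_self C) (pow_le_pow_right₀ h1 (by omega)) (by positivity) (abs_nonneg C)
    have e2 : C' * (lvl k + 1 : ℝ) ^ d' ≤ |C'| * (lvl k + 1 : ℝ) ^ (d + d') :=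
      mul_le_mul (le_abs_self C') (pow_le_pow_right₀ h1 (by omega)) (by positivity)
        (abs_nonneg C')
    linarith [hC k, hC' k]
  · refine le_trans (le_of_eq ?_) (norm_add_le _ _)
    rw [levelTrace_add, laurentEval_add]
    congr 1
    ring

theorem HasExpansion.smul {T : Op} {p : ℤ →₀ ℂ} (hT : HasExpansion T p) (c : ℂ) :
    HasExpansion (c • T) (c • p) := by
  obtain ⟨C, d, hC⟩ := hT.bdd
  refine ⟨⟨‖c‖ * C, d, fun k => by
    rw [colNorm_smul, mul_assoc]; exact mul_le_mul_of_nonneg_left (hC k) (norm_nonneg c)⟩,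
    (hT.asymp.const_mul (norm_nonneg c)).mono fun m => ?_⟩
  rw [← norm_mul, levelTrace_smul, laurentEval_smul]
  refine le_of_eq (congrArg norm ?_)
  ring

/-- Multiplication by `|D|^{-k}` shifts the exponents of the expansion by `k`. -/
theorem HasQuadExpansion.hasExpansion {T : Op} {p₀ p₁ p₂ : ℂ} (h : HasQuadExpansion T p₀ p₁ p₂)
    (k : ℕ) : HasExpansion (T * absDPow (-k))
      (Finsupp.single (-k : ℤ) p₀ + Finsupp.single (1 - k : ℤ) p₁ +
        Finsupp.single (2 - k : ℤ) p₂) := by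
  obtain ⟨C, hC⟩ := h.bdd
  have hhalf : ∀ m : ℕ, (m + 1 / 2 : ℝ) ^ (-(k : ℂ)).re ≤ 2 ^ k := by
    intro m
    rw [Complex.neg_re, Complex.natCast_re]
    calc (m + 1 / 2 : ℝ) ^ (-(k : ℝ)) ≤ (1 / 2 : ℝ) ^ (-(k : ℝ)) :=
          Real.rpow_le_rpow_of_nonpos (by norm_num) (by simp) (by simp)
      _ = 2 ^ k := by rw [Real.rpow_neg (by norm_num), Real.rpow_natCast, one_div, inv_pow, inv_inv]
  refine ⟨⟨|C| * 2 ^ k, 0, fun i => ?_⟩, (h.asymp.const_mul (c := 2 ^ k) (by positivity)).mono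
    fun m => ?_⟩
  · rw [colNorm_mul_absDPow, pow_zero, mul_one]
    exact mul_le_mul ((hC i).trans (le_abs_self C)) (hhalf _) (by positivity) (abs_nonneg C)
  · have hm := half_ne_zero m
    have e : levelTrace (T * absDPow (-k)) m - laurentEval
        (Finsupp.single (-k : ℤ) p₀ + Finsupp.single (1 - k : ℤ) p₁ +
          Finsupp.single (2 - k : ℤ) p₂) (m + 1 / 2) = (m + 1 / 2 : ℂ) ^ (-(k : ℂ)) *
        (levelTrace T m - (p₀ + p₁ * (m + 1 / 2) + p₂ * (m + 1 / 2) ^ 2)) := by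
      rw [levelTrace_mul_absDPow, laurentEval_add, laurentEval_add, laurentEval_single,
        laurentEval_single, laurentEval_single]
      have hk : (m + 1 / 2 : ℂ) ^ (-(k : ℂ)) = (m + 1 / 2 : ℂ) ^ (-k : ℤ) := by
        rw [← Complex.cpow_intCast]
        push_cast
        rfl
      rw [hk, sub_eq_add_neg (1 : ℤ), sub_eq_add_neg (2 : ℤ), zpow_add₀ hm, zpow_add₀ hm]
      norm_cast
      ring
    rw [e, norm_mul, norm_half_cpow]
    exact mul_le_mul_of_nonneg_right (hhalf m) (norm_nonneg _)

theorem absDPow_zero : absDPow 0 = 1 := by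
  rw [absDPow_eq, ← diag_one]
  congr 1
  ext i
  simp

/-- The regularised trace of a tame operator in terms of its expansion; the summand `p₁ / 24` is
`p₁ ζ(-1, 1/2)`, while `ζ(0, 1/2)` and `ζ(-2, 1/2)` vanish. -/
theorem HasQuadExpansion.isZetaZero {T : Op} {p₀ p₁ p₂ : ℂ} (h : HasQuadExpansion T p₀ p₁ p₂) :
    IsZetaZero T (p₁ / 24 + ∑' m : ℕ,
      (levelTrace T m - (p₀ + p₁ * (m + 1 / 2) + p₂ * (m + 1 / 2) ^ 2))) := by
  have h0 := h.hasExpansion 0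
  rw [Nat.cast_zero, neg_zero, absDPow_zero, mul_one] at h0
  have h1 := h0.isZetaZero fun j hj => by
    intro hj'
    subst hj'
    rw [Finsupp.mem_support_iff] at hj
    simp at hj
  convert h1 using 2
  · rw [Finsupp.sum_add_index' (by simp) (by intros; ring),
      Finsupp.sum_add_index' (by simp) (by intros; ring), Finsupp.sum_single_index (by simp),
      Finsupp.sum_single_index (by simp), Finsupp.sum_single_index (by simp)]
    simp [halfZeta_zero, halfZeta_neg_one, halfZeta_neg_two, div_eq_mul_inv]
  · refine tsum_congr fun m => ?_
    rw [laurentEval_add, laurentEval_add, laurentEval_single, laurentEval_single,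
      laurentEval_single]
    simp

/-! ### Residues and regularised traces as linear functionals -/

/-- The operators whose level traces have a Laurent expansion. -/
def Expandable : Submodule ℂ Op where
  carrier := {T | ∃ p, HasExpansion T p}
  add_mem' := fun ⟨_, h⟩ ⟨_, h'⟩ => ⟨_, h.add h'⟩
  zero_mem' := ⟨0, ⟨0, 0, fun k => by simp [colNorm_zero]⟩, ExpSmall.of_nonpos fun m => by
    simp [laurentEval, levelTrace, entry_zero]⟩
  smul_mem' := fun c _ ⟨_, h⟩ => ⟨_, h.smul c⟩

/-- The residue functional `ncInt`, which is linear on `Expandable`, extends to a linear functional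
on all operators. -/
theorem exists_linear_ncInt : ∃ ρ : Op →ₗ[ℂ] ℂ, ∀ T ∈ Expandable, IsNCInt T (ρ T) := by
  let f : Expandable →ₗ[ℂ] ℂ :=
    { toFun := fun T => ncInt (T : Op)
      map_add' := by
        rintro ⟨S, p, hS⟩ ⟨T, r, hT⟩
        change ncInt (S + T) = ncInt S + ncInt T
        rw [(hS.add hT).isNCInt.ncInt_eq, hS.isNCInt.ncInt_eq, hT.isNCInt.ncInt_eq]
        rfl
      map_smul' := by
        rintro c ⟨T, p, hT⟩
        change ncInt (c • T) = c * ncInt T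
        rw [(hT.smul c).isNCInt.ncInt_eq, hT.isNCInt.ncInt_eq]
        rfl }
  obtain ⟨ρ, hρ⟩ := LinearMap.exists_extend f
  refine ⟨ρ, fun T hT => ?_⟩
  have e : ρ T = ncInt T := LinearMap.congr_fun hρ ⟨T, hT⟩
  obtain ⟨p, hp⟩ := hT
  rw [e, hp.isNCInt.ncInt_eq]
  exact hp.isNCInt

/-- The functional `zetaZero`, which is linear on `Tame`, extends to a linear functional on all
operators. -/
theorem exists_linear_zetaZero : ∃ ρ : Op →ₗ[ℂ] ℂ, ∀ T ∈ Tame, IsZetaZero T (ρ T) := by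
  have hsum : ∀ {T : Op} {p₀ p₁ p₂ : ℂ}, HasQuadExpansion T p₀ p₁ p₂ → Summable fun m : ℕ =>
      levelTrace T m - (p₀ + p₁ * (m + 1 / 2) + p₂ * (m + 1 / 2) ^ 2) := fun h =>
    Summable.of_norm (h.asymp.summable fun _ => norm_nonneg _)
  let f : Subalgebra.toSubmodule Tame →ₗ[ℂ] ℂ :=
    { toFun := fun T => zetaZero (T : Op)
      map_add' := by
        rintro ⟨S, hS⟩ ⟨T, hT⟩
        change zetaZero (S + T) = zetaZero S + zetaZero T
        obtain ⟨p₀, p₁, p₂, hp⟩ := exists_hasQuadExpansion hS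
        obtain ⟨r₀, r₁, r₂, hr⟩ := exists_hasQuadExpansion hT
        rw [(hp.add hr).isZetaZero.zetaZero_eq, hp.isZetaZero.zetaZero_eq,
          hr.isZetaZero.zetaZero_eq]
        have h1 := (hsum hp).tsum_add (hsum hr)
        have h2 : ∀ m : ℕ, levelTrace (S + T) m - (p₀ + r₀ + (p₁ + r₁) * (m + 1 / 2) +
            (p₂ + r₂) * (m + 1 / 2) ^ 2) =
            (levelTrace S m - (p₀ + p₁ * (m + 1 / 2) + p₂ * (m + 1 / 2) ^ 2)) +
            (levelTrace T m - (r₀ + r₁ * (m + 1 / 2) + r₂ * (m + 1 / 2) ^ 2)) := fun m => by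
          rw [levelTrace_add]; ring
        rw [tsum_congr h2, h1]
        ring
      map_smul' := by
        rintro c ⟨T, hT⟩
        change zetaZero (c • T) = c * zetaZero T
        obtain ⟨p₀, p₁, p₂, hp⟩ := exists_hasQuadExpansion hT
        rw [(hp.smul c).isZetaZero.zetaZero_eq, hp.isZetaZero.zetaZero_eq, mul_add,
          ← tsum_mul_left]
        have h2 : ∀ m : ℕ, levelTrace (c • T) m - (c * p₀ + c * p₁ * (m + 1 / 2) +
            c * p₂ * (m + 1 / 2) ^ 2) =
            c * (levelTrace T m - (p₀ + p₁ * (m + 1 / 2) + p₂ * (m + 1 / 2) ^ 2)) := fun m => by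
          rw [levelTrace_smul]; ring
        rw [tsum_congr h2]
        ring }
  obtain ⟨ρ, hρ⟩ := LinearMap.exists_extend f
  refine ⟨ρ, fun T hT => ?_⟩
  have e : ρ T = zetaZero T := LinearMap.congr_fun hρ ⟨T, hT⟩
  obtain ⟨p₀, p₁, p₂, hp⟩ := exists_hasQuadExpansion hT
  rw [e, hp.isZetaZero.zetaZero_eq]
  exact hp.isZetaZero

/-- A linear functional on all operators which agrees with `ncInt` on `Expandable`. -/
def resLin : Op →ₗ[ℂ] ℂ := exists_linear_ncInt.choose

/-- A linear functional on all operators which agrees with `zetaZero` on `Tame`. -/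
def zetaLin : Op →ₗ[ℂ] ℂ := exists_linear_zetaZero.choose

theorem isNCInt_resLin {T : Op} (hT : T ∈ Expandable) : IsNCInt T (resLin T) :=
  exists_linear_ncInt.choose_spec T hT

theorem isZetaZero_zetaLin {T : Op} (hT : T ∈ Tame) : IsZetaZero T (zetaLin T) :=
  exists_linear_zetaZero.choose_spec T hT

/-- The functional `T ↦ ⨍ T |D|^{-k}`. -/
def resPow (k : ℕ) : Op →ₗ[ℂ] ℂ := resLin ∘ₗ LinearMap.mulRight ℂ (absDPow (-k))

theorem resPow_apply (k : ℕ) (T : Op) : resPow k T = resLin (T * absDPow (-k)) := rfl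

theorem mul_absDPow_mem {T : Op} (hT : T ∈ Tame) (k : ℕ) : T * absDPow (-k) ∈ Expandable := by
  obtain ⟨_, _, _, h⟩ := exists_hasQuadExpansion hT
  exact ⟨_, h.hasExpansion k⟩

/-- The residues of `T |D|^{-1}`, `T |D|^{-2}` and `T |D|^{-3}` are the coefficients of the
expansion of `T`, and the later ones vanish. -/
theorem HasQuadExpansion.resPow_eq {T : Op} {p₀ p₁ p₂ : ℂ} (h : HasQuadExpansion T p₀ p₁ p₂)
    (k : ℕ) : resPow k T = if k = 1 then p₀ else if k = 2 then p₁ else if k = 3 then p₂ else 0 := by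
  have h1 := (h.hasExpansion k).isNCInt
  rw [resPow_apply, (isNCInt_resLin ⟨_, h.hasExpansion k⟩).unique h1]
  simp only [Finsupp.add_apply, Finsupp.single_apply]
  split_ifs <;> first | omega | simp

theorem HasQuadExpansion.resPow_one {T : Op} {p₀ p₁ p₂ : ℂ} (h : HasQuadExpansion T p₀ p₁ p₂) :
    resPow 1 T = p₀ := h.resPow_eq 1

theorem HasQuadExpansion.resPow_two {T : Op} {p₀ p₁ p₂ : ℂ} (h : HasQuadExpansion T p₀ p₁ p₂) :
    resPow 2 T = p₁ := h.resPow_eq 2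

theorem HasQuadExpansion.resPow_three {T : Op} {p₀ p₁ p₂ : ℂ}
    (h : HasQuadExpansion T p₀ p₁ p₂) : resPow 3 T = p₂ := h.resPow_eq 3

theorem HasQuadExpansion.zetaLin_eq {T : Op} {p₀ p₁ p₂ : ℂ} (h : HasQuadExpansion T p₀ p₁ p₂)
    (hT : T ∈ Tame) : zetaLin T = p₁ / 24 + ∑' m : ℕ,
      (levelTrace T m - (p₀ + p₁ * (m + 1 / 2) + p₂ * (m + 1 / 2) ^ 2)) :=
  (isZetaZero_zetaLin hT).unique h.isZetaZero

theorem resPow_smoothing {S : Op} (hS : IsSmoothing S) (k : ℕ) : resPow k S = 0 := by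
  rw [hS.hasQuadExpansion.resPow_eq]
  simp

theorem resPow_of_four_le {T : Op} (hT : T ∈ Tame) {k : ℕ} (hk : 4 ≤ k) : resPow k T = 0 := by
  obtain ⟨_, _, _, h⟩ := exists_hasQuadExpansion hT
  rw [h.resPow_eq, if_neg (by omega), if_neg (by omega), if_neg (by omega)]

/-- On smoothing operators no regularisation is needed. -/
theorem zetaLin_smoothing {S : Op} (hS : IsSmoothing S) : zetaLin S = opTrace S := by
  rw [hS.hasQuadExpansion.zetaLin_eq hS.mem, opTrace_eq_tsum_levelTrace hS.summable]
  simp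

/-! ### Traces of commutators -/

theorem sum_range_quad (x y z : ℂ) (n : ℕ) :
    ∑ m ∈ Finset.range n, (x + y * (m + 1 / 2) + z * (m + 1 / 2) ^ 2) =
      x * n + y * n ^ 2 / 2 + z * (n ^ 3 / 3 - n / 12) := by
  induction n with
  | zero => simp
  | succ n ih =>
    rw [Finset.sum_range_succ, ih]
    push_cast
    ring

/-- If `c'` is the sequence `c` delayed by `n` steps, then the expansion of `c'` is that of `c`
with the shifted variable, and the regularised sums differ by a polynomial in `n`. -/
theorem regularised_sum_delay {c c' : ℕ → ℂ} {n : ℕ} (h : ∀ m, c' (m + n) = c m)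
    (h0 : ∀ m < n, c' m = 0) {p₀ p₁ p₂ : ℂ}
    (hc : ExpSmall id fun m : ℕ => ‖c m - (p₀ + p₁ * (m + 1 / 2) + p₂ * (m + 1 / 2) ^ 2)‖) :
    ExpSmall id (fun m : ℕ => ‖c' m - ((p₀ - n * p₁ + n ^ 2 * p₂) +
      (p₁ - 2 * n * p₂) * (m + 1 / 2) + p₂ * (m + 1 / 2) ^ 2)‖) ∧
    ((p₁ - 2 * n * p₂) / 24 + ∑' m : ℕ, (c' m - ((p₀ - n * p₁ + n ^ 2 * p₂) +
      (p₁ - 2 * n * p₂) * (m + 1 / 2) + p₂ * (m + 1 / 2) ^ 2))) -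
    (p₁ / 24 + ∑' m : ℕ, (c m - (p₀ + p₁ * (m + 1 / 2) + p₂ * (m + 1 / 2) ^ 2))) =
      -(n * p₀) + n ^ 2 / 2 * p₁ - n ^ 3 / 3 * p₂ := by
  set e : ℕ → ℂ := fun m => c m - (p₀ + p₁ * (m + 1 / 2) + p₂ * (m + 1 / 2) ^ 2) with he
  set e' : ℕ → ℂ := fun m => c' m - ((p₀ - n * p₁ + n ^ 2 * p₂) +
      (p₁ - 2 * n * p₂) * (m + 1 / 2) + p₂ * (m + 1 / 2) ^ 2) with he'
  have hshift : ∀ m, e' (m + n) = e m := by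
    intro m
    simp only [he, he', h]
    push_cast
    ring
  have hexp : ExpSmall id fun m => ‖e' m‖ := by
    have h1 : ExpSmall id fun m : ℕ => ‖e (m - n)‖ :=
      hc.comp (fun m => m - n) n fun m => by simp only [id]; omega
    have h2 : ExpSmall id fun m : ℕ => if m < n then ‖e' m‖ else 0 := by
      refine ExpSmall.of_le_pow (q := 1 / 2) (by norm_num) (by norm_num)
        ((∑ m ∈ Finset.range n, ‖e' m‖) * 2 ^ n) fun m => ?_
      split_ifs with hm
      · have h3 : ‖e' m‖ ≤ ∑ m ∈ Finset.range n, ‖e' m‖ :=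
          Finset.single_le_sum (f := fun m => ‖e' m‖) (fun _ _ => norm_nonneg _)
            (Finset.mem_range.2 hm)
        have h4 : (1 : ℝ) ≤ 2 ^ n * (1 / 2) ^ m := by
          rw [one_div, inv_pow, ← div_eq_mul_inv, one_le_div (by positivity)]
          exact pow_le_pow_right₀ (by norm_num) hm.le
        calc ‖e' m‖ ≤ (∑ m ∈ Finset.range n, ‖e' m‖) * 1 := by rwa [mul_one]
          _ ≤ (∑ m ∈ Finset.range n, ‖e' m‖) * (2 ^ n * (1 / 2) ^ m) :=
            mul_le_mul_of_nonneg_left h4 ((norm_nonneg _).trans h3)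
          _ = _ := by rw [mul_assoc]; rfl
      · positivity
    refine (h1.add h2).mono fun m => ?_
    split_ifs with hm
    · exact le_add_of_nonneg_left (norm_nonneg _)
    · have := hshift (m - n)
      rw [Nat.sub_add_cancel (by omega)] at this
      rw [this, add_zero]
  refine ⟨hexp, ?_⟩
  have hs' : Summable e' := Summable.of_norm (hexp.summable fun _ => norm_nonneg _)
  have h1 := hs'.sum_add_tsum_nat_add n
  rw [tsum_congr hshift] at h1
  have h2 : ∑ m ∈ Finset.range n, e' m = -∑ m ∈ Finset.range n, ((p₀ - n * p₁ + n ^ 2 * p₂) +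
      (p₁ - 2 * n * p₂) * (m + 1 / 2) + p₂ * (m + 1 / 2) ^ 2) := by
    rw [← Finset.sum_neg_distrib]
    refine Finset.sum_congr rfl fun m hm => ?_
    simp only [he', h0 m (Finset.mem_range.1 hm), zero_sub]
  rw [h2, sum_range_quad] at h1
  rw [← h1]
  ring

theorem IsHomog.mul {a b : ℤ} {A B : Op} (hA : IsHomog a A) (hB : IsHomog b B) :
    IsHomog (a + b) (A * B) := by
  intro i k h
  obtain ⟨l, h1, h2⟩ := entry_mul_ne_zero h
  have := hA i l h1
  have := hB l k h2
  omega

theorem IsHomog.levelTrace_eq_zero {a : ℤ} {T : Op} (h : IsHomog a T) (ha : a ≠ 0) (m : ℕ) :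
    levelTrace T m = 0 := by
  refine Finset.sum_eq_zero fun i _ => ?_
  by_contra h0
  have := h i i h0
  omega

/-- For `A` of degree `n` and `B` of degree `-n`, the trace of `AB` over the level `m + n` is
the trace of `BA` over the level `m`. -/
theorem levelTrace_mul_comm {n : ℕ} {A B : Op} (hA : IsHomog n A) (hB : IsHomog (-n) B) :
    (∀ m, levelTrace (A * B) (m + n) = levelTrace (B * A) m) ∧
      ∀ m < n, levelTrace (A * B) m = 0 := by
  constructor
  · intro m
    have e1 : ∀ i ∈ levelSet (m + n), entry (A * B) i i =
        ∑ l ∈ levelSet m, entry A i l * entry B l i := fun i hi =>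
      entry_mul A B i i fun l hl => by
        rw [mem_levelSet] at hi ⊢
        have := hB l i hl
        omega
    have e2 : ∀ l ∈ levelSet m, entry (B * A) l l =
        ∑ i ∈ levelSet (m + n), entry B l i * entry A i l := fun l hl =>
      entry_mul B A l l fun i hi => by
        rw [mem_levelSet] at hl ⊢
        have := hA i l hi
        omega
    rw [levelTrace, levelTrace, Finset.sum_congr rfl e1, Finset.sum_congr rfl e2, Finset.sum_comm]
    exact Finset.sum_congr rfl fun _ _ => Finset.sum_congr rfl fun _ _ => mul_comm _ _
  · intro m hm
    refine Finset.sum_eq_zero fun i hi => ?_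
    by_contra h
    obtain ⟨l, _, h2⟩ := entry_mul_ne_zero h
    have := hB l i h2
    rw [mem_levelSet] at hi
    omega

/-- The regularised trace of a commutator in terms of residues, and the trace property of the
highest residue. -/
def CommutatorFormula (A B : Op) : Prop :=
  zetaLin (A * B) - zetaLin (B * A) = -resPow 1 (B * δ A) + 1 / 2 * resPow 2 (B * δ (δ A))
    - 1 / 3 * resPow 3 (B * δ (δ (δ A))) ∧
  resPow 3 (A * B) = resPow 3 (B * A)

/-- For homogeneous operators the level traces of `AB` are those of `BA` delayed by the degree `a`
of `A` (or the other way round), while `δ^k(A) = a^k A`. Unless the degrees are opposite, all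
traces vanish. -/
theorem commutatorFormula_homog {a b : ℤ} {A B : Op} (hA : IsHomog a A) (hB : IsHomog b B)
    (hAm : A ∈ Tame) (hBm : B ∈ Tame) : CommutatorFormula A B := by
  have hAB : A * B ∈ Tame := mul_mem hAm hBm
  have hBA : B * A ∈ Tame := mul_mem hBm hAm
  unfold CommutatorFormula
  simp only [hA.δ_eq, δ_smul, mul_smul_comm, map_smul, smul_eq_mul]
  by_cases hab : a + b = 0
  swap
  · have h0 : ∀ {c : ℤ} {T : Op}, IsHomog c T → c ≠ 0 → T ∈ Tame →
        HasQuadExpansion T 0 0 0 ∧ zetaLin T = 0 := by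
      intro c T hT hc hTm
      have hz := hT.levelTrace_eq_zero hc
      have hq : HasQuadExpansion T 0 0 0 :=
        ⟨(isBanded_of_tame hTm).bdd, ExpSmall.of_nonpos fun m => by simp [hz]⟩
      refine ⟨hq, ?_⟩
      rw [hq.zetaLin_eq hTm]
      simp [hz]
    obtain ⟨h1, h2⟩ := h0 (hA.mul hB) hab hAB
    obtain ⟨h3, h4⟩ := h0 (hB.mul hA) (by omega) hBA
    rw [h2, h4, h3.resPow_one, h3.resPow_two, h3.resPow_three, h1.resPow_three]
    simp
  obtain ⟨n, rfl | rfl⟩ := a.eq_nat_or_neg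
  · obtain rfl : b = -n := by omega
    obtain ⟨p₀, p₁, p₂, hp⟩ := exists_hasQuadExpansion hBA
    obtain ⟨h1, h2⟩ := levelTrace_mul_comm hA hB
    obtain ⟨h3, h4⟩ := regularised_sum_delay h1 h2 hp.asymp
    have hq : HasQuadExpansion (A * B) _ _ _ := ⟨(isBanded_of_tame hAB).bdd, h3⟩
    rw [hq.zetaLin_eq hAB, hp.zetaLin_eq hBA, h4, hp.resPow_one, hp.resPow_two, hp.resPow_three,
      hq.resPow_three]
    refine ⟨?_, rfl⟩
    push_cast
    ring
  · obtain rfl : b = n := by omega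
    obtain ⟨p₀, p₁, p₂, hp⟩ := exists_hasQuadExpansion hAB
    obtain ⟨h1, h2⟩ := levelTrace_mul_comm hB hA
    obtain ⟨h3, h4⟩ := regularised_sum_delay h1 h2 hp.asymp
    have hq : HasQuadExpansion (B * A) _ _ _ := ⟨(isBanded_of_tame hBA).bdd, h3⟩
    rw [← neg_sub, hq.zetaLin_eq hBA, hp.zetaLin_eq hAB, h4, hq.resPow_one, hq.resPow_two,
      hq.resPow_three, hp.resPow_three]
    refine ⟨?_, rfl⟩
    push_cast
    ring

/-- If one of the operators is smoothing, all residues vanish and the trace is an honest trace. -/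
theorem commutatorFormula_smoothing {A B : Op} (hA : A ∈ Tame) (hB : B ∈ Tame)
    (h : IsSmoothing A ∨ IsSmoothing B) : CommutatorFormula A B := by
  have hA' := isBanded_of_tame hA
  have hB' := isBanded_of_tame hB
  have hδ : ∀ {T : Op}, T ∈ Tame → (IsSmoothing T ∨ IsSmoothing B) → IsSmoothing (B * T) := by
    rintro T hT (h | h)
    · exact hB'.mul_smoothing h
    · exact h.mul_banded (isBanded_of_tame hT)
  have hd : ∀ {T : Op}, (IsSmoothing T ∨ IsSmoothing B) → (IsSmoothing (δ T) ∨ IsSmoothing B) :=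
    fun h => h.imp_left fun h => h.δ
  have hAB : IsSmoothing (A * B) := by
    rcases h with h | h
    · exact h.mul_banded hB'
    · exact hA'.mul_smoothing h
  have htr : opTrace (A * B) = opTrace (B * A) := by
    rcases h with h | h
    · exact opTrace_mul_comm h hB'
    · exact (opTrace_mul_comm h hA').symm
  have hBA := hδ hA h
  constructor
  · rw [zetaLin_smoothing hAB, zetaLin_smoothing hBA, htr,
      resPow_smoothing (hδ (δ_mem hA) (hd h)),
      resPow_smoothing (hδ (δ_mem (δ_mem hA)) (hd (hd h))),
      resPow_smoothing (hδ (δ_mem (δ_mem (δ_mem hA))) (hd (hd (hd h))))]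
    ring
  · rw [resPow_smoothing hAB, resPow_smoothing hBA]

/-- Both sides of the commutator formula are bilinear, so that it suffices to check it on
generators. -/
theorem commutatorFormula {A B : Op} (hA : A ∈ Tame) (hB : B ∈ Tame) : CommutatorFormula A B := by
  induction hA using tame_induction with
  | gen A hA =>
    induction hB using tame_induction with
    | gen B hB =>
      rcases hA with ⟨s, κ, hA⟩ | hA
      · rcases hB with ⟨s', κ', hB⟩ | hB
        · exact commutatorFormula_homog hA.isHomog hB.isHomog hA.mem hB.mem
        · exact commutatorFormula_smoothing hA.mem hB.mem (Or.inr hB)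
      · exact commutatorFormula_smoothing hA.mem hB.mem (Or.inl hA)
    | add B B' _ _ h h' =>
      obtain ⟨h1, h2⟩ := h
      obtain ⟨h1', h2'⟩ := h'
      constructor
      · simp only [mul_add, add_mul, map_add]
        linear_combination h1 + h1'
      · simp only [mul_add, add_mul, map_add]
        linear_combination h2 + h2'
    | smul c B _ h =>
      obtain ⟨h1, h2⟩ := h
      constructor
      · simp only [mul_smul_comm, smul_mul_assoc, map_smul, smul_eq_mul]
        linear_combination c * h1
      · simp only [mul_smul_comm, smul_mul_assoc, map_smul, smul_eq_mul]
        linear_combination c * h2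
  | add A A' _ _ h h' =>
    obtain ⟨h1, h2⟩ := h
    obtain ⟨h1', h2'⟩ := h'
    constructor
    · simp only [δ_add, mul_add, add_mul, map_add]
      linear_combination h1 + h1'
    · simp only [mul_add, add_mul, map_add]
      linear_combination h2 + h2'
  | smul c A _ h =>
    obtain ⟨h1, h2⟩ := h
    constructor
    · simp only [δ_smul, mul_smul_comm, smul_mul_assoc, map_smul, smul_eq_mul]
      linear_combination c * h1
    · simp only [mul_smul_comm, smul_mul_assoc, map_smul, smul_eq_mul]
      linear_combination c * h2

/-! ### Adjoints -/

theorem entry_adj_eq (T : Op) (i k : Idx) :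
    entry (adj T) k i = if k.1 < i.1 + 2 then conj (entry T i k) else 0 := by
  have : entry (adj T) k i = ∑ l ∈ (Finset.range (i.1 + 2)).sigma fun _ => Finset.univ,
      (Finsupp.single l (conj (entry T i l)) : Core) k := by
    simp [entry, adj, Finsupp.finsetSum_apply]
  rw [this]
  simp only [Finsupp.single_apply, Finset.sum_ite_eq', Finset.mem_sigma, Finset.mem_range,
    Finset.mem_univ, and_true]

theorem adj_add (S T : Op) : adj (S + T) = adj S + adj T := by
  refine op_ext fun k i => ?_
  rw [entry_add, entry_adj_eq, entry_adj_eq, entry_adj_eq, entry_add, map_add]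
  split_ifs <;> simp

theorem IsShift.symm {s : Bool} {κ : ℤ × ℤ × ℤ} {i k : Idx} (h : IsShift s κ i k) :
    IsShift s (-κ) k i := by
  obtain ⟨h1, h2, h3, h4, h5⟩ := h
  refine ⟨h2, h1, ?_, ?_, ?_⟩ <;> simp only [Prod.fst_neg, Prod.snd_neg] <;> omega

theorem exists_isShift {s : Bool} {κ : ℤ × ℤ × ℤ} {k : Idx} (hk : isUp k = s)
    (h1 : 0 ≤ (lvl k : ℤ) + κ.1) (h2 : 0 ≤ (cx k : ℤ) + κ.2.1)
    (h2' : (cx k : ℤ) + κ.2.1 < lvl k + κ.1 + (!s).toNat) (h3 : 0 ≤ (cy k : ℤ) + κ.2.2)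
    (h3' : (cy k : ℤ) + κ.2.2 < lvl k + κ.1 + s.toNat) : ∃ i, IsShift s κ i k := by
  obtain ⟨i, e1, e2, e3, e4⟩ := exists_idx (s := s) (m := ((lvl k : ℤ) + κ.1).toNat)
    (x := ((cx k : ℤ) + κ.2.1).toNat) (y := ((cy k : ℤ) + κ.2.2).toNat) (by omega) (by omega)
  exact ⟨i, hk, e1, by omega, by omega, by omega⟩

theorem fst_eq_of_isUp {i k : Idx} (h : isUp i = isUp k) : (i.1 : ℤ) - k.1 = lvl i - lvl k := by
  unfold lvl
  rw [h]
  push_cast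
  ring

/-- The adjoint of a weighted shift is a weighted shift, provided that the weights of the shift
are exponentially small at every label which cannot be shifted back, unless the reason is that one
of its coordinates becomes negative. The condition on `κ.1` is needed because `adj` disregards the
entries which lower the level by more than one. -/
theorem IsWeightedShift.adj {s : Bool} {κ : ℤ × ℤ × ℤ} {T : Op}
    (hshift : ∀ i k, entry T i k ≠ 0 → IsShift s κ i k) {u v : ℕ → ℂ} (hu : ExpConst u)
    (hv : ExpConst v) {C r : ℝ} (hC : 0 ≤ C) (h0 : 0 < r) (h1 : r < 1)
    (H : ∀ k, ‖colSum T k - if isUp k = s then u (cx k) * v (cy k) else 0‖ ≤ C * r ^ lvl k)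
    (hκ : -1 ≤ κ.1) (hreg : ∀ k, isUp k = s → κ.1 ≤ lvl k → κ.2.1 ≤ cx k → κ.2.2 ≤ cy k →
      (∃ i, IsShift s κ k i) ∨ ‖v ((cy k : ℤ) - κ.2.2).toNat‖ ≤ C * r ^ lvl k) :
    IsWeightedShift s (-κ) (adj T) := by
  have hentry : ∀ i k, entry (QSU2.adj T) k i = conj (entry T i k) := by
    intro i k
    refine entry_adj (fun i k hik => ?_) i k
    by_contra h0
    have h1 := hshift i k h0
    have h2 := fst_eq_of_isUp (h1.2.1.trans h1.1.symm)
    have h3 := h1.2.2.1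
    omega
  have hs : ∀ i k, entry (QSU2.adj T) i k ≠ 0 → IsShift s (-κ) i k := by
    intro i k h0
    rw [hentry] at h0
    exact (hshift k i fun e => h0 (by rw [e, map_zero])).symm
  refine ⟨hs, ?_⟩
  obtain ⟨M, hM0, hM⟩ := hu.bounded
  obtain ⟨M', hM0', hM'⟩ := hv.bounded
  have hcut : ∀ (c : ℤ) {u : ℕ → ℂ}, ExpConst u →
      ExpConst fun x : ℕ => (if c ≤ x then 1 else 0) * conj (u ((x : ℤ) - c).toNat) := by
    intro c u hu
    refine ExpConst.mul ⟨1, ExpSmall.of_le_pow (q := 1 / 2) (by norm_num) (by norm_num)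
      (2 ^ c.toNat) fun x => ?_⟩ (hu.comp (fun x => ((x : ℤ) - c).toNat) c.natAbs
        fun x => by omega).star
    by_cases hc : c ≤ x
    · simp [hc]
    · dsimp only
      rw [if_neg hc, zero_sub, norm_neg, norm_one, one_div, inv_pow, ← div_eq_mul_inv,
        one_le_div (by positivity)]
      exact pow_le_pow_right₀ (by norm_num) (by simp only [id]; omega)
  refine ⟨_, _, hcut κ.2.1 hu, hcut κ.2.2 hv, ?_⟩
  have hb : ∀ x y, ‖u x * v y‖ ≤ M * M' := fun x y => by
    rw [norm_mul]
    exact mul_le_mul (hM x) (hM' y) (norm_nonneg _) hM0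
  set K := κ.1.natAbs
  refine ExpSmall.of_le_pow h0 h1 ((C + M * M' + M * C) * (r ^ K)⁻¹) fun k => ?_
  have hK : ∀ n, lvl k ≤ n + K → r ^ n ≤ (r ^ K)⁻¹ * r ^ lvl k := by
    intro n hn
    rw [inv_mul_eq_div, le_div_iff₀ (by positivity), ← pow_add]
    exact pow_le_pow_of_le_one h0.le h1.le hn
  by_cases hk : ∃ i, IsShift s κ k i
  · obtain ⟨i, hi⟩ := hk
    have e1 : colSum (QSU2.adj T) k = conj (colSum T i) := by
      rw [colSum_eq hs hi.symm, colSum_eq hshift hi, hentry]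
    have e2 : ((cx k : ℤ) - κ.2.1).toNat = cx i := by have := hi.2.2.2.1; omega
    have e3 : ((cy k : ℤ) - κ.2.2).toNat = cy i := by have := hi.2.2.2.2; omega
    have e4 : κ.2.1 ≤ cx k := by have := hi.2.2.2.1; omega
    have e5 : κ.2.2 ≤ cy k := by have := hi.2.2.2.2; omega
    have Hi : ‖colSum T i - if isUp i = s then u (cx i) * v (cy i) else 0‖ ≤ C * r ^ lvl i := H i
    rw [if_pos hi.1] at Hi
    rw [if_pos hi.2.1, if_pos e4, if_pos e5, e1, e2, e3, one_mul, one_mul, ← map_mul, ← map_sub,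
      RCLike.norm_conj]
    refine Hi.trans ?_
    rw [mul_assoc]
    rw [add_assoc]
    refine mul_le_mul (le_add_of_nonneg_right (by positivity)) (hK _ ?_) (by positivity)
      (by positivity)
    have := hi.2.2.1
    omega
  · have e1 : colSum (QSU2.adj T) k = 0 := colSum_eq_zero hs fun i hi => hk ⟨i, by
      simpa using hi.symm⟩
    rw [e1, zero_sub, norm_neg]
    split_ifs with h2 h3 h4 h4
    · rw [one_mul, one_mul, ← map_mul, RCLike.norm_conj, mul_assoc]
      have h7 : 0 ≤ M * M' := mul_nonneg hM0 hM0'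
      have h8 : 0 ≤ M * C := mul_nonneg hM0 hC
      by_cases h5 : lvl k ≤ 0 + K
      · have h6 := hK 0 h5
        rw [pow_zero] at h6
        refine (hb _ _).trans ?_
        nlinarith
      · have h6 := (hreg k h2 (by omega) h3 h4).resolve_left hk
        have h9 := hK (lvl k) (by omega)
        rw [norm_mul]
        calc _ ≤ M * (C * r ^ lvl k) :=
              mul_le_mul (hM _) h6 (norm_nonneg _) hM0
          _ = M * C * r ^ lvl k := (mul_assoc _ _ _).symm
          _ ≤ (C + M * M' + M * C) * ((r ^ K)⁻¹ * r ^ lvl k) :=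
              mul_le_mul (by linarith) h9 (by positivity) (by linarith)
    all_goals
      simp only [zero_mul, mul_zero, norm_zero]
      positivity

/-- The columns have at most `O(m²)` entries, because the level is preserved. -/
theorem isSmoothing_of_entry_le {T : Op} {q : ℝ} (h0 : 0 < q) (h1 : q < 1) {C : ℝ}
    (hT : ∀ i k, entry T i k ≠ 0 → lvl i = lvl k) (h : ∀ i k, ‖entry T i k‖ ≤ C * q ^ lvl k) :
    IsSmoothing T := by
  refine ⟨⟨0, fun i k hik => by have := hT i k hik; omega⟩, ?_⟩
  have hC : 0 ≤ C := by
    let k : Idx := ⟨0, ⟨0, by omega⟩, Sum.inl ⟨0, by omega⟩⟩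
    exact nonneg_of_mul_nonneg_left ((norm_nonneg _).trans (h k k)) (by positivity)
  have hg : ExpSmall lvl fun k : Idx => C * q ^ lvl k := ⟨C, q, hC, h0, h1, fun _ => le_rfl⟩
  refine ((hg.pow_mul 2).const_mul (c := 2) (by norm_num)).mono fun k => ?_
  rw [colNorm_eq_sum T k (s := levelSet (lvl k)) fun l hl => mem_levelSet.2 (hT l k hl)]
  calc _ ≤ ∑ i ∈ levelSet (lvl k), C * q ^ lvl k := Finset.sum_le_sum fun i _ => h i k
    _ = (levelSet (lvl k)).card * (C * q ^ lvl k) := by rw [Finset.sum_const, nsmul_eq_mul]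
    _ ≤ (2 * (lvl k + 1) ^ 2 : ℕ) * (C * q ^ lvl k) :=
        mul_le_mul_of_nonneg_right (Nat.cast_le.2 (card_levelSet_le _)) (by positivity)
    _ = _ := by push_cast; ring

theorem isSmoothing_adj_of_entry_le {T : Op} {q : ℝ} (h0 : 0 < q) (h1 : q < 1) {C : ℝ}
    (hT : ∀ i k, entry T i k ≠ 0 → lvl i = lvl k) (h : ∀ i k, ‖entry T i k‖ ≤ C * q ^ lvl k) :
    IsSmoothing (adj T) := by
  have hadj : ∀ i k, entry (adj T) i k ≠ 0 → entry T k i ≠ 0 := by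
    intro i k hik e
    rw [entry_adj_eq, e, map_zero, ite_self] at hik
    exact hik rfl
  refine isSmoothing_of_entry_le h0 h1 (C := C) (fun i k hik => (hT k i (hadj i k hik)).symm)
    fun i k => ?_
  by_cases hik : entry (adj T) i k = 0
  · rw [hik, norm_zero]
    exact (norm_nonneg _).trans (h k k)
  · refine le_trans ?_ ((h k i).trans_eq (by rw [hT k i (hadj i k hik)]))
    rw [entry_adj_eq]
    split_ifs
    · rw [RCLike.norm_conj]
    · rw [norm_zero]
      exact norm_nonneg _

/-! ### Shift operators given by weights on basis vectors -/

/-- The basis vector with spin `s` and labels `n, x, y` (zero if out of range). -/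
def spinVec (s : Bool) (n x y : ℕ) : Core := if s then vUp n x y else vDn n x y

theorem spinVec_apply (s : Bool) (n x y : ℕ) (i : Idx) : spinVec s n x y i =
    if isUp i = s ∧ i.1 = n ∧ cx i = x ∧ cy i = y then 1 else 0 := by
  have hlvl : ∀ i : Idx, i.1 + (isUp i).toNat = lvl i := fun _ => rfl
  have hx := cx_lt i
  have hy := cy_lt i
  cases s
  · simp only [spinVec, vDn, Bool.false_eq_true, if_false]
    split_ifs with h1 h2 h2
    · rw [Finsupp.single_apply, if_pos]
      refine idx_ext h2.1.symm ?_ h2.2.2.1.symm h2.2.2.2.symm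
      rw [← hlvl i, h2.1, h2.2.1]
      rfl
    · rw [Finsupp.single_apply, if_neg]
      rintro rfl
      exact h2 ⟨rfl, rfl, rfl, rfl⟩
    · rw [← hlvl i, h2.1, h2.2.1] at hx hy
      simp at hx hy
      omega
    · rfl
  · simp only [spinVec, vUp, if_true]
    split_ifs with h1 h2 h2
    · rw [Finsupp.single_apply, if_pos]
      refine idx_ext h2.1.symm ?_ h2.2.2.1.symm h2.2.2.2.symm
      rw [← hlvl i, h2.1, h2.2.1]
      rfl
    · rw [Finsupp.single_apply, if_neg]
      rintro rfl
      exact h2 ⟨rfl, rfl, rfl, rfl⟩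
    · rw [← hlvl i, h2.1, h2.2.1] at hx hy
      simp at hx hy
      omega
    · rfl

/-- The operator which maps `v_{x,y}^{n/2}` of spin `s` to `w n x y` times the basis vector of
spin `s'` with labels `t n x y`, and vanishes on the other spin. -/
def shiftOp (s s' : Bool) (w : ℕ → ℕ → ℕ → ℝ) (t : ℕ → ℕ → ℕ → ℕ × ℕ × ℕ) : Op :=
  let f : ℕ → ℕ → ℕ → Core := fun n x y =>
    ((w n x y : ℝ) : ℂ) • spinVec s' (t n x y).1 (t n x y).2.1 (t n x y).2.2
  opOfBasis (if s then f else 0) (if s then 0 else f)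

theorem entry_opOfBasis (f g : ℕ → ℕ → ℕ → Core) (i k : Idx) : entry (opOfBasis f g) i k =
    if isUp k then f k.1 (cx k) (cy k) i else g k.1 (cx k) (cy k) i := by
  obtain ⟨n, x, y | y⟩ := k <;> simp [entry, opOfBasis, isUp, cx, cy]

theorem entry_shiftOp (s s' : Bool) (w : ℕ → ℕ → ℕ → ℝ) (t : ℕ → ℕ → ℕ → ℕ × ℕ × ℕ)
    (i k : Idx) : entry (shiftOp s s' w t) i k =
      if isUp k = s ∧ isUp i = s' ∧ (i.1, cx i, cy i) = t k.1 (cx k) (cy k)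
      then (w k.1 (cx k) (cy k) : ℂ) else 0 := by
  rw [shiftOp, entry_opOfBasis]
  have key : (((w k.1 (cx k) (cy k) : ℝ) : ℂ) • spinVec s' (t k.1 (cx k) (cy k)).1
      (t k.1 (cx k) (cy k)).2.1 (t k.1 (cx k) (cy k)).2.2) i =
      if isUp i = s' ∧ (i.1, cx i, cy i) = t k.1 (cx k) (cy k)
      then (w k.1 (cx k) (cy k) : ℂ) else 0 := by
    rw [Finsupp.smul_apply, spinVec_apply, smul_eq_mul]
    simp only [Prod.ext_iff, mul_ite, mul_one, mul_zero]
  cases s <;> cases hk : isUp k <;> simp [key, -Complex.coe_smul, -Finsupp.coe_smul]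

/-- A shift operator whose weights are, up to a sign, products `A B d` with `A`, `B` and `d`
exponentially close to `a x`, `b y` and `1` is tame, and so is its adjoint. -/
theorem shiftOp_mem {q : ℝ} (h0 : 0 < q) (h1 : q < 1) {s : Bool} {w : ℕ → ℕ → ℕ → ℝ}
    {t : ℕ → ℕ → ℕ → ℕ × ℕ × ℕ} {κ : ℤ × ℤ × ℤ} (hκ : -1 ≤ κ.1) {σ : ℝ} (hσ : |σ| ≤ 1)
    {A B d : Idx → ℝ} {a b : ℕ → ℝ} {C : ℝ}
    (hw : ∀ k, isUp k = s → w k.1 (cx k) (cy k) = σ * (A k * B k * d k))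
    (hA1 : ∀ k, isUp k = s → |A k| ≤ 1) (hA : ∀ k, isUp k = s → |A k - a (cx k)| ≤ C * q ^ lvl k)
    (hB1 : ∀ k, isUp k = s → |B k| ≤ 1) (hB : ∀ k, isUp k = s → |B k - b (cy k)| ≤ C * q ^ lvl k)
    (hd : ∀ k, isUp k = s → |d k - 1| ≤ C * q ^ lvl k)
    (ha : ExpConst fun x => (a x : ℂ)) (ha1 : ∀ x, |a x| ≤ 1) (hb : ExpConst fun y => (b y : ℂ))
    (ht : ∀ k, isUp k = s → w k.1 (cx k) (cy k) ≠ 0 →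
      ((t k.1 (cx k) (cy k)).1 : ℤ) = k.1 + κ.1 ∧
      ((t k.1 (cx k) (cy k)).2.1 : ℤ) = cx k + κ.2.1 ∧
      ((t k.1 (cx k) (cy k)).2.2 : ℤ) = cy k + κ.2.2 ∧ ∃ i, IsShift s κ i k)
    (hreg : ∀ k, isUp k = s → κ.1 ≤ lvl k → κ.2.1 ≤ cx k → κ.2.2 ≤ cy k →
      (∃ i, IsShift s κ k i) ∨ |b ((cy k : ℤ) - κ.2.2).toNat| ≤ C * q ^ lvl k) :
    shiftOp s s w t ∈ Tame ∧ adj (shiftOp s s w t) ∈ Tame := by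
  set T := shiftOp s s w t with hT
  have hs : ∀ i k, entry T i k ≠ 0 → IsShift s κ i k := by
    intro i k h
    rw [hT, entry_shiftOp] at h
    split_ifs at h with h2
    · obtain ⟨hk, hi, he⟩ := h2
      obtain ⟨e1, e2, e3, _⟩ := ht k hk (by exact_mod_cast h)
      rw [← he] at e1 e2 e3
      have := fst_eq_of_isUp (hi.trans hk.symm)
      refine ⟨hk, hi, ?_, e2, e3⟩
      dsimp only at e1
      omega
    · exact absurd rfl h
  have hcol : ∀ k, isUp k = s → colSum T k = (w k.1 (cx k) (cy k) : ℂ) := by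
    intro k hk
    by_cases h : w k.1 (cx k) (cy k) = 0
    · rw [h, Complex.ofReal_zero]
      by_cases h' : ∃ i, IsShift s κ i k
      · obtain ⟨i, hi⟩ := h'
        rw [IsWeightedShift.colSum_eq hs hi, hT, entry_shiftOp, h]
        simp
      · exact IsWeightedShift.colSum_eq_zero hs (not_exists.1 h')
    · obtain ⟨e1, e2, e3, i, hi⟩ := ht k hk h
      rw [IsWeightedShift.colSum_eq hs hi, hT, entry_shiftOp, if_pos]
      have h2 := fst_eq_of_isUp (hi.2.1.trans hi.1.symm)
      obtain ⟨_, h3, h4, h5, h6⟩ := hi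
      refine ⟨hk, h3, Prod.ext ?_ (Prod.ext ?_ ?_)⟩ <;> dsimp only <;> omega
  have hC : 0 ≤ C := by
    obtain ⟨i, hi, _⟩ := exists_idx (s := s) (m := 1) (x := 0) (y := 0) (by omega) (by omega)
    exact nonneg_of_mul_nonneg_left ((abs_nonneg _).trans (hd i hi)) (by positivity)
  have hσa : ExpConst fun x => (σ : ℂ) * a x := (ExpConst.const _).mul ha
  have H : ∀ k, ‖colSum T k - if isUp k = s then (σ : ℂ) * a (cx k) * b (cy k) else 0‖ ≤
      (3 * C + C ^ 2) * q ^ lvl k := by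
    intro k
    by_cases hk : isUp k = s
    swap
    · rw [IsWeightedShift.colSum_eq_zero hs fun i hi => hk hi.1, if_neg hk, sub_zero, norm_zero]
      positivity
    rw [hcol k hk, if_pos hk, hw k hk]
    have e : ((σ * (A k * B k * d k) : ℝ) : ℂ) - σ * a (cx k) * b (cy k) =
        ((σ * (A k * B k * (d k - 1) + (A k - a (cx k)) * B k + a (cx k) * (B k - b (cy k))) : ℝ)
          : ℂ) := by
      push_cast
      ring
    rw [e, Complex.norm_real, Real.norm_eq_abs, abs_mul]
    have f1 : |A k * B k * (d k - 1)| ≤ C * q ^ lvl k := by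
      rw [abs_mul, abs_mul]
      have := mul_le_mul (hA1 k hk) (hB1 k hk) (abs_nonneg _) zero_le_one
      calc |A k| * |B k| * |d k - 1| ≤ 1 * (C * q ^ lvl k) :=
            mul_le_mul (by linarith) (hd k hk) (abs_nonneg _) zero_le_one
        _ = _ := one_mul _
    have f2 : |(A k - a (cx k)) * B k| ≤ C * q ^ lvl k := by
      rw [abs_mul]
      exact (mul_le_of_le_one_right (abs_nonneg _) (hB1 k hk)).trans (hA k hk)
    have f3 : |a (cx k) * (B k - b (cy k))| ≤ C * q ^ lvl k := by
      rw [abs_mul]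
      exact (mul_le_of_le_one_left (abs_nonneg _) (ha1 _)).trans (hB k hk)
    have f4 := abs_add_three (A k * B k * (d k - 1)) ((A k - a (cx k)) * B k)
      (a (cx k) * (B k - b (cy k)))
    have f5 : 0 ≤ C ^ 2 * q ^ lvl k := by positivity
    refine (mul_le_of_le_one_left (abs_nonneg _) hσ).trans ?_
    linarith
  refine ⟨IsWeightedShift.mem ⟨hs, _, _, hσa, hb, _, _, by positivity, h0, h1, H⟩,
    (IsWeightedShift.adj hs hσa hb (by positivity) h0 h1 H hκ fun k e1 e2 e3 e4 =>
      (hreg k e1 e2 e3 e4).imp_right fun h => ?_).mem⟩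
  rw [Complex.norm_real, Real.norm_eq_abs]
  exact h.trans (mul_le_mul_of_nonneg_right (by nlinarith) (by positivity))

/-- A shift operator which preserves the level, changes the spin and has exponentially small
weights is smoothing, and so is its adjoint. -/
theorem shiftOp_smoothing {q : ℝ} (h0 : 0 < q) (h1 : q < 1) {s : Bool} {w : ℕ → ℕ → ℕ → ℝ}
    {t : ℕ → ℕ → ℕ → ℕ × ℕ × ℕ} {C : ℝ}
    (hw : ∀ k, isUp k = s → |w k.1 (cx k) (cy k)| ≤ C * q ^ lvl k)
    (ht : ∀ k, isUp k = s → (t k.1 (cx k) (cy k)).1 + (!s).toNat = lvl k) :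
    shiftOp s (!s) w t ∈ Tame ∧ adj (shiftOp s (!s) w t) ∈ Tame := by
  have hC : 0 ≤ C := by
    obtain ⟨i, hi, _⟩ := exists_idx (s := s) (m := 1) (x := 0) (y := 0) (by omega) (by omega)
    exact nonneg_of_mul_nonneg_left ((abs_nonneg _).trans (hw i hi)) (by positivity)
  have hl : ∀ i k, entry (shiftOp s (!s) w t) i k ≠ 0 → lvl i = lvl k := by
    intro i k h
    rw [entry_shiftOp] at h
    split_ifs at h with h2
    · obtain ⟨hk, hi, he⟩ := h2
      rw [← ht k hk, ← he, lvl, hi]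
    · exact absurd rfl h
  have hn : ∀ i k, ‖entry (shiftOp s (!s) w t) i k‖ ≤ C * q ^ lvl k := by
    intro i k
    rw [entry_shiftOp]
    split_ifs with h2
    · rw [Complex.norm_real]
      exact hw k h2.1
    · rw [norm_zero]
      positivity
  exact ⟨(isSmoothing_of_entry_le h0 h1 hl hn).mem,
    (isSmoothing_adj_of_entry_le h0 h1 hl hn).mem⟩

/-! ### The coefficients of the generators -/

/-- `√(1 - q^{2N})`. -/
def qroot (q : ℝ) (N : ℕ) : ℝ := √(1 - q ^ (2 * N))

/-- `(1 - q^{2N})⁻¹`. -/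
def qinv (q : ℝ) (N : ℕ) : ℝ := (1 - q ^ (2 * N))⁻¹

/-- The `q`-number `[N]` is `q^{-N} (1 - q^{2N})` up to a constant. -/
theorem qnum_nat {q : ℝ} (hq0 : 0 < q) (N : ℕ) :
    qnum q N = (q⁻¹ - q)⁻¹ * (q ^ (-(N : ℝ)) * (1 - q ^ (2 * N))) := by
  rw [qnum, zpow_neg, zpow_natCast, Real.rpow_neg hq0.le, Real.rpow_natCast, pow_mul']
  have : q ^ N ≠ 0 := by positivity
  field_simp

theorem inv_qnum {q : ℝ} (hq0 : 0 < q) {M : ℤ} {N : ℕ} (h : M = N) :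
    (qnum q M)⁻¹ = (q⁻¹ - q) * (q ^ (N : ℝ) * qinv q N) := by
  rw [h, qnum_nat hq0, mul_inv, mul_inv, inv_inv, Real.rpow_neg hq0.le, inv_inv, qinv]

theorem abs_qroot_le {q : ℝ} (hq0 : 0 < q) (N : ℕ) : |qroot q N| ≤ 1 := by
  rw [qroot, abs_of_nonneg (Real.sqrt_nonneg _)]
  have : 0 < q ^ (2 * N) := by positivity
  exact Real.sqrt_le_one.2 (by linarith)

section Coefficients

variable {q : ℝ} (hq0 : 0 < q) (hq1 : q < 1)
include hq0 hq1

theorem qinv_sub_q_pos : 0 < q⁻¹ - q := by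
  have := (one_lt_inv₀ hq0).2 hq1
  linarith

theorem sq_nat {M : ℤ} {N : ℕ} (h : M = N) :
    sq q M = √((q⁻¹ - q)⁻¹) * (q ^ (-(N : ℝ) / 2) * qroot q N) := by
  have h2 := qinv_sub_q_pos hq0 hq1
  rw [sq, h, qnum_nat hq0, Real.sqrt_mul (by positivity), Real.sqrt_mul (by positivity), qroot,
    Real.sqrt_eq_rpow (q ^ (-(N : ℝ))), ← Real.rpow_mul hq0.le]
  congr 3
  ring

theorem sqrt_mul_sqrt_mul : √((q⁻¹ - q)⁻¹) * √((q⁻¹ - q)⁻¹) * (q⁻¹ - q) = 1 := by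
  have h2 := qinv_sub_q_pos hq0 hq1
  rw [Real.mul_self_sqrt (by positivity), inv_mul_cancel₀ h2.ne']

/-- The weights of the terms of the generators which preserve the spin: the powers of `q` combine to
`q^E`, the constants cancel, and the remaining factors tend to `1` exponentially fast. -/
theorem weight_eq {α β E : ℝ} {M₁ M₂ M₃ : ℤ} {N₁ N₂ N₃ : ℕ} (h₁ : M₁ = N₁) (h₂ : M₂ = N₂)
    (h₃ : M₃ = N₃) (hE : α + -(N₁ : ℝ) / 2 + β + -(N₂ : ℝ) / 2 + N₃ = E) :
    q ^ α * sq q M₁ * (q ^ β * sq q M₂ / qnum q M₃) =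
      q ^ E * (qroot q N₁ * qroot q N₂ * qinv q N₃) := by
  rw [div_eq_mul_inv, sq_nat hq0 hq1 h₁, sq_nat hq0 hq1 h₂, inv_qnum hq0 h₃, ← hE,
    Real.rpow_add hq0, Real.rpow_add hq0, Real.rpow_add hq0, Real.rpow_add hq0]
  linear_combination (q ^ α * q ^ (-(N₁ : ℝ) / 2) * q ^ β * q ^ (-(N₂ : ℝ) / 2) * q ^ (N₃ : ℝ) *
    (qroot q N₁ * qroot q N₂ * qinv q N₃)) * sqrt_mul_sqrt_mul hq0 hq1

/-- The weights of the terms of the generators which change the spin: the second denominator `[N₄]`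
leads to an additional factor `q^{N₄}`. -/
theorem cross_weight_eq {α β E : ℝ} {M₁ M₂ M₃ M₄ : ℤ} {N₁ N₂ N₃ N₄ : ℕ} (h₁ : M₁ = N₁)
    (h₂ : M₂ = N₂) (h₃ : M₃ = N₃) (h₄ : M₄ = N₄)
    (hE : α + -(N₁ : ℝ) / 2 + β + -(N₂ : ℝ) / 2 + N₃ + N₄ = E) :
    q ^ α * sq q M₁ * (q ^ β * sq q M₂ / (qnum q M₃ * qnum q M₄)) =
      q ^ E * ((q⁻¹ - q) * (qroot q N₁ * qroot q N₂ * (qinv q N₃ * qinv q N₄))) := by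
  rw [div_eq_mul_inv, mul_inv, sq_nat hq0 hq1 h₁, sq_nat hq0 hq1 h₂, inv_qnum hq0 h₃,
    inv_qnum hq0 h₄, ← hE, Real.rpow_add hq0, Real.rpow_add hq0, Real.rpow_add hq0,
    Real.rpow_add hq0, Real.rpow_add hq0]
  linear_combination ((q⁻¹ - q) * (q ^ α * q ^ (-(N₁ : ℝ) / 2) * q ^ β * q ^ (-(N₂ : ℝ) / 2) *
    q ^ (N₃ : ℝ) * q ^ (N₄ : ℝ) *
    (qroot q N₁ * qroot q N₂ * (qinv q N₃ * qinv q N₄)))) * sqrt_mul_sqrt_mul hq0 hq1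

theorem pow_two_mul_le_one (N : ℕ) : q ^ (2 * N) ≤ 1 := pow_le_one₀ hq0.le hq1.le

theorem abs_qroot_sub_one_le (N : ℕ) : |qroot q N - 1| ≤ q ^ (2 * N) := by
  have h1 := pow_two_mul_le_one hq0 hq1 N
  have h2 := (le_abs_self _).trans (abs_qroot_le hq0 N)
  rw [abs_of_nonpos (by linarith)]
  have h3 : 0 ≤ qroot q N := Real.sqrt_nonneg _
  have h4 : qroot q N * qroot q N = 1 - q ^ (2 * N) := Real.mul_self_sqrt (by linarith)
  nlinarith

theorem qinv_le {N : ℕ} (hN : 1 ≤ N) : 0 ≤ qinv q N ∧ qinv q N ≤ (1 - q ^ 2)⁻¹ := by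
  have h1 : q ^ 2 < 1 := pow_lt_one₀ hq0.le hq1 (by norm_num)
  have h2 : q ^ (2 * N) ≤ q ^ 2 := pow_le_pow_of_le_one hq0.le hq1.le (by omega)
  exact ⟨inv_nonneg.2 (by linarith), inv_anti₀ (by linarith) (by linarith)⟩

theorem one_le_inv_one_sub : 1 ≤ (1 - q ^ 2)⁻¹ := by
  have h1 : q ^ 2 < 1 := pow_lt_one₀ hq0.le hq1 (by norm_num)
  have : 0 < q ^ 2 := by positivity
  exact (one_le_inv₀ (by linarith)).2 (by linarith)

/-- The constant `q⁻¹ (1 - q²)⁻¹` absorbs an exponent which falls short of the level by one, and at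
the same time the denominators `1 - q^{2N}`; it serves for all weights below. -/
theorem pow_le_of_le {e m : ℕ} (h : m ≤ e + 1) : q ^ e ≤ q⁻¹ * (1 - q ^ 2)⁻¹ * q ^ m := by
  have h1 := one_le_inv_one_sub hq0 hq1
  have h2 : q ^ e ≤ q⁻¹ * q ^ m := by
    rw [inv_mul_eq_div, le_div_iff₀ hq0, ← pow_succ]
    exact pow_le_pow_of_le_one hq0.le hq1.le h
  calc q ^ e ≤ q⁻¹ * q ^ m := h2
    _ ≤ (q⁻¹ * q ^ m) * (1 - q ^ 2)⁻¹ := le_mul_of_one_le_right (by positivity) h1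
    _ = _ := by ring

theorem abs_qinv_sub_one_le {N m : ℕ} (hN : 1 ≤ N) (h : m ≤ 2 * N + 1) :
    |qinv q N - 1| ≤ q⁻¹ * (1 - q ^ 2)⁻¹ * q ^ m := by
  obtain ⟨h2, h3⟩ := qinv_le hq0 hq1 hN
  have h1 : q ^ (2 * N) < 1 := pow_lt_one₀ hq0.le hq1 (by omega)
  have e : qinv q N - 1 = q ^ (2 * N) * qinv q N := by
    rw [qinv]
    have : 1 - q ^ (2 * N) ≠ 0 := by linarith
    field_simp
    ring
  rw [e, abs_of_nonneg (by positivity)]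
  have h4 : q ^ (2 * N) ≤ q⁻¹ * q ^ m := by
    rw [inv_mul_eq_div, le_div_iff₀ hq0, ← pow_succ]
    exact pow_le_pow_of_le_one hq0.le hq1.le h
  calc _ ≤ (q⁻¹ * q ^ m) * (1 - q ^ 2)⁻¹ := mul_le_mul h4 h3 h2 (by positivity)
    _ = _ := by ring

theorem abs_pow_le (e : ℕ) : |q ^ e| ≤ 1 := by
  rw [abs_of_nonneg (by positivity)]
  exact pow_le_one₀ hq0.le hq1.le

theorem abs_pow_mul_qroot_le (e N : ℕ) : |q ^ e * qroot q N| ≤ 1 := by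
  rw [abs_mul]
  exact mul_le_one₀ (abs_pow_le hq0 hq1 e) (abs_nonneg _) (abs_qroot_le hq0 N)

theorem abs_pow_mul_qroot_sub_le {e N m : ℕ} (h : m ≤ e + 2 * N + 1) :
    |q ^ e * qroot q N - q ^ e| ≤ q⁻¹ * (1 - q ^ 2)⁻¹ * q ^ m := by
  rw [show q ^ e * qroot q N - q ^ e = q ^ e * (qroot q N - 1) by ring, abs_mul,
    abs_of_nonneg (by positivity : 0 ≤ q ^ e)]
  calc q ^ e * |qroot q N - 1| ≤ q ^ e * q ^ (2 * N) :=
        mul_le_mul_of_nonneg_left (abs_qroot_sub_one_le hq0 hq1 N) (by positivity)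
    _ = q ^ (e + 2 * N) := (pow_add _ _ _).symm
    _ ≤ _ := pow_le_of_le hq0 hq1 h

theorem expConst_qroot (c : ℕ) : ExpConst fun x => (qroot q (x + c) : ℂ) := by
  refine ⟨1, ExpSmall.of_le_pow hq0 hq1 1 fun x => ?_⟩
  rw [← Complex.ofReal_one, ← Complex.ofReal_sub, Complex.norm_real, one_mul]
  exact (abs_qroot_sub_one_le hq0 hq1 _).trans
    (pow_le_pow_of_le_one hq0.le hq1.le (by simp only [id]; omega))

theorem expConst_pow (c : ℕ) : ExpConst fun x => ((q ^ (x + c) : ℝ) : ℂ) := by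
  refine ⟨0, ExpSmall.of_le_pow hq0 hq1 1 fun x => ?_⟩
  rw [sub_zero, Complex.norm_real, Real.norm_of_nonneg (by positivity), one_mul]
  exact pow_le_pow_of_le_one hq0.le hq1.le (by simp only [id]; omega)

theorem cross_weight_le {E : ℝ} {N₁ N₂ N₃ N₄ e m : ℕ} (hE : E = e) (h : m ≤ e + 1)
    (h₃ : 1 ≤ N₃) (h₄ : 1 ≤ N₄) :
    |q ^ E * ((q⁻¹ - q) * (qroot q N₁ * qroot q N₂ * (qinv q N₃ * qinv q N₄)))| ≤
      q⁻¹ * (1 - q ^ 2)⁻¹ * ((q⁻¹ - q) * ((1 - q ^ 2)⁻¹ * (1 - q ^ 2)⁻¹)) * q ^ m := by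
  have hp := qinv_sub_q_pos hq0 hq1
  obtain ⟨h5, h6⟩ := qinv_le hq0 hq1 h₃
  obtain ⟨h7, h8⟩ := qinv_le hq0 hq1 h₄
  rw [hE, Real.rpow_natCast, abs_mul, abs_mul, abs_mul, abs_mul, abs_mul,
    abs_of_nonneg (by positivity : 0 ≤ q ^ e), abs_of_pos hp, abs_of_nonneg h5, abs_of_nonneg h7]
  have h9 : |qroot q N₁| * |qroot q N₂| ≤ 1 :=
    mul_le_one₀ (abs_qroot_le hq0 _) (abs_nonneg _) (abs_qroot_le hq0 _)
  have h10 : qinv q N₃ * qinv q N₄ ≤ (1 - q ^ 2)⁻¹ * (1 - q ^ 2)⁻¹ :=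
    mul_le_mul h6 h8 h7 (h5.trans h6)
  calc _ ≤ (q⁻¹ * (1 - q ^ 2)⁻¹ * q ^ m) *
        ((q⁻¹ - q) * (1 * ((1 - q ^ 2)⁻¹ * (1 - q ^ 2)⁻¹))) := by
        refine mul_le_mul (pow_le_of_le hq0 hq1 h) ?_ (by positivity)
          ((by positivity : (0 : ℝ) ≤ q ^ e).trans (pow_le_of_le hq0 hq1 h))
        refine mul_le_mul_of_nonneg_left ?_ hp.le
        exact mul_le_mul h9 h10 (by positivity) zero_le_one
    _ = _ := by ring

end Coefficients

/-! ### The generators are tame -/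

/-- The operator and its adjoint are tame. -/
def TameStar (T : Op) : Prop := T ∈ Tame ∧ adj T ∈ Tame

theorem TameStar.add {S T : Op} (hS : TameStar S) (hT : TameStar T) : TameStar (S + T) :=
  ⟨add_mem hS.1 hT.1, by rw [adj_add]; exact add_mem hS.2 hT.2⟩

/-- The range of the labels of spin `↑`. -/
theorem up_range {k : Idx} (hk : isUp k = true) :
    lvl k = k.1 + 1 ∧ cx k < k.1 + 1 ∧ cy k < k.1 + 2 := by
  have hl : lvl k = k.1 + 1 := by rw [lvl, hk]; rfl
  have h1 := cx_lt k
  have h2 := cy_lt k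
  rw [hk, hl] at h1 h2
  exact ⟨hl, h1, h2⟩

/-- The range of the labels of spin `↓`. -/
theorem dn_range {k : Idx} (hk : isUp k = false) :
    lvl k = k.1 ∧ cx k < k.1 + 1 ∧ cy k < k.1 := by
  have hl : lvl k = k.1 := by rw [lvl, hk]; rfl
  have h1 := cx_lt k
  have h2 := cy_lt k
  rw [hk, hl] at h1 h2
  exact ⟨hl, h1, h2⟩

theorem sq_zero (q : ℝ) : sq q 0 = 0 := by simp [sq, qnum]

section Generators

variable {q : ℝ} (hq0 : 0 < q) (hq1 : q < 1)
include hq0 hq1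

/-- The error bound for a factor of a weight which is equal to its limit. -/
theorem abs_sub_self_le (x : ℝ) (m : ℕ) : |x - x| ≤ q⁻¹ * (1 - q ^ 2)⁻¹ * q ^ m := by
  rw [sub_self, abs_zero]
  exact (by positivity : (0 : ℝ) ≤ q ^ m).trans (pow_le_of_le hq0 hq1 (by omega))

/-- The part of `a₊` which maps spin `↑` to spin `↑`. In terms of `weight_eq` its weight is
`√(1 - q^{2x+2}) √(1 - q^{2y+2})` up to a factor exponentially close to `1`. The other parts of the
generators which preserve the spin are treated in the same way: a factor `√(1 - q^{2N})` depends on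
`x` or `y` alone or occurs together with `q^x` or `q^y`, so that it may be replaced by `1`. -/
theorem aPlus_up : TameStar (shiftOp true true
    (fun n x y => preUp q n x y * sq q (x + 1) *
      (q ^ (-(n + 1 : ℝ) / 2) * sq q (y + 1) / qnum q (n + 2)))
    (fun n x y => (n + 1, x + 1, y + 1))) := by
  refine shiftOp_mem hq0 hq1 (κ := (1, 1, 1)) (by norm_num) (σ := 1) (by simp)
    (A := fun k => qroot q (cx k + 1)) (B := fun k => qroot q (cy k + 1))
    (d := fun k => qinv q (k.1 + 2)) (a := fun x => qroot q (x + 1))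
    (b := fun y => qroot q (y + 1)) (C := q⁻¹ * (1 - q ^ 2)⁻¹) ?_
    (fun k _ => abs_qroot_le hq0 _) (fun k _ => abs_sub_self_le hq0 hq1 _ _)
    (fun k _ => abs_qroot_le hq0 _) (fun k _ => abs_sub_self_le hq0 hq1 _ _) ?_
    (expConst_qroot hq0 hq1 1) (fun x => abs_qroot_le hq0 _) (expConst_qroot hq0 hq1 1) ?_ ?_
  · intro k hk
    obtain ⟨h1, h2, h3⟩ := up_range hk
    rw [one_mul, preUp, weight_eq hq0 hq1 (N₁ := cx k + 1) (N₂ := cy k + 1) (N₃ := k.1 + 2)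
      (E := 0) (by omega) (by omega) (by omega)
      (by push_cast [Nat.cast_sub (show cx k ≤ k.1 by omega)]; ring)]
    rw [Real.rpow_zero, one_mul]
  · intro k hk
    obtain ⟨h1, h2, h3⟩ := up_range hk
    exact abs_qinv_sub_one_le hq0 hq1 (by omega) (by omega)
  · intro k hk _
    obtain ⟨h1, h2, h3⟩ := up_range hk
    refine ⟨by dsimp only; omega, by dsimp only; omega, by dsimp only; omega,
      exists_isShift hk ?_ ?_ ?_ ?_ ?_⟩ <;> simp <;> omega
  · intro k hk e1 e2 e3
    obtain ⟨h1, h2, h3⟩ := up_range hk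
    dsimp only at e1 e2 e3
    obtain ⟨i, hi⟩ := exists_isShift (κ := -(1, 1, 1)) hk (by simp; omega) (by simp; omega)
        (by simp; omega) (by simp; omega) (by simp; omega)
    exact .inl ⟨i, by simpa using hi.symm⟩

theorem aPlus_dn : TameStar (shiftOp false false
    (fun n x y => preDn q n x y * sq q (x + 1) *
      (q ^ (-(n : ℝ) / 2) * sq q (y + 1) / qnum q (n + 1)))
    (fun n x y => (n + 1, x + 1, y + 1))) := by
  refine shiftOp_mem hq0 hq1 (κ := (1, 1, 1)) (by norm_num) (σ := 1) (by simp)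
    (A := fun k => qroot q (cx k + 1)) (B := fun k => qroot q (cy k + 1))
    (d := fun k => qinv q (k.1 + 1)) (a := fun x => qroot q (x + 1))
    (b := fun y => qroot q (y + 1)) (C := q⁻¹ * (1 - q ^ 2)⁻¹) ?_
    (fun k _ => abs_qroot_le hq0 _) (fun k _ => abs_sub_self_le hq0 hq1 _ _)
    (fun k _ => abs_qroot_le hq0 _) (fun k _ => abs_sub_self_le hq0 hq1 _ _) ?_
    (expConst_qroot hq0 hq1 1) (fun x => abs_qroot_le hq0 _) (expConst_qroot hq0 hq1 1) ?_ ?_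
  · intro k hk
    obtain ⟨h1, h2, h3⟩ := dn_range hk
    rw [one_mul, preDn, weight_eq hq0 hq1 (N₁ := cx k + 1) (N₂ := cy k + 1) (N₃ := k.1 + 1)
      (E := 0) (by omega) (by omega) (by omega)
      (by push_cast [Nat.cast_sub (show cx k ≤ k.1 by omega)]; ring)]
    rw [Real.rpow_zero, one_mul]
  · intro k hk
    obtain ⟨h1, h2, h3⟩ := dn_range hk
    exact abs_qinv_sub_one_le hq0 hq1 (by omega) (by omega)
  · intro k hk _
    obtain ⟨h1, h2, h3⟩ := dn_range hk
    refine ⟨by dsimp only; omega, by dsimp only; omega, by dsimp only; omega,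
      exists_isShift hk ?_ ?_ ?_ ?_ ?_⟩ <;> simp <;> omega
  · intro k hk e1 e2 e3
    obtain ⟨h1, h2, h3⟩ := dn_range hk
    dsimp only at e1 e2 e3
    obtain ⟨i, hi⟩ := exists_isShift (κ := -(1, 1, 1)) hk (by simp; omega) (by simp; omega)
        (by simp; omega) (by simp; omega) (by simp; omega)
    exact .inl ⟨i, by simpa using hi.symm⟩

theorem aMinus_up : TameStar (shiftOp true true
    (fun n x y => preUp q n x y * sq q (n - x) *
      (q ^ ((n : ℝ) / 2 + 1) * sq q (n - y + 1) / qnum q (n + 1)))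
    (fun n x y => (n - 1, x, y))) := by
  refine shiftOp_mem hq0 hq1 (κ := (-1, 0, 0)) (by norm_num) (σ := 1) (by simp)
    (A := fun k => q ^ cx k * qroot q (k.1 - cx k))
    (B := fun k => q ^ (cy k + 1) * qroot q (k.1 + 1 - cy k))
    (d := fun k => qinv q (k.1 + 1)) (a := fun x => q ^ x)
    (b := fun y => q ^ (y + 1)) (C := q⁻¹ * (1 - q ^ 2)⁻¹) ?_
    (fun k _ => abs_pow_mul_qroot_le hq0 hq1 _ _) (?_)
    (fun k _ => abs_pow_mul_qroot_le hq0 hq1 _ _) (?_) ?_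
    (by simpa using expConst_pow hq0 hq1 0) (fun x => abs_pow_le hq0 hq1 _)
    (expConst_pow hq0 hq1 1) ?_ ?_
  · intro k hk
    obtain ⟨h1, h2, h3⟩ := up_range hk
    rw [one_mul, preUp, weight_eq hq0 hq1 (N₁ := k.1 - cx k) (N₂ := k.1 + 1 - cy k) (N₃ := k.1 + 1)
      (E := ((cx k + (cy k + 1) : ℕ) : ℝ)) (by omega) (by omega) (by omega)
      (by
        push_cast [Nat.cast_sub (show cx k ≤ k.1 by omega),
          Nat.cast_sub (show cy k ≤ k.1 + 1 by omega)]
        ring)]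
    rw [Real.rpow_natCast]
    ring
  · intro k hk
    obtain ⟨h1, h2, h3⟩ := up_range hk
    exact abs_pow_mul_qroot_sub_le hq0 hq1 (by omega)
  · intro k hk
    obtain ⟨h1, h2, h3⟩ := up_range hk
    exact abs_pow_mul_qroot_sub_le hq0 hq1 (by omega)
  · intro k hk
    obtain ⟨h1, h2, h3⟩ := up_range hk
    exact abs_qinv_sub_one_le hq0 hq1 (by omega) (by omega)
  · intro k hk h0
    obtain ⟨h1, h2, h3⟩ := up_range hk
    have : ((k.1 : ℤ) - cx k) ≠ 0 := by
      intro e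
      apply h0
      rw [e, sq_zero]
      simp
    have : ((k.1 : ℤ) - cy k + 1) ≠ 0 := by
      intro e
      apply h0
      rw [e, sq_zero]
      simp
    refine ⟨by dsimp only; omega, by dsimp only; omega, by dsimp only; omega,
      exists_isShift hk ?_ ?_ ?_ ?_ ?_⟩ <;> simp <;> omega
  · intro k hk e1 e2 e3
    obtain ⟨h1, h2, h3⟩ := up_range hk
    dsimp only at e1 e2 e3
    obtain ⟨i, hi⟩ := exists_isShift (κ := -(-1, 0, 0)) hk (by simp; omega) (by simp)
        (by simp; omega) (by simp) (by simp; omega)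
    exact .inl ⟨i, by simpa using hi.symm⟩

theorem aMinus_dn : TameStar (shiftOp false false
    (fun n x y => preDn q n x y * sq q (n - x) *
      (q ^ (((n : ℝ) + 1) / 2) * sq q (n - y - 1) / qnum q n))
    (fun n x y => (n - 1, x, y))) := by
  refine shiftOp_mem hq0 hq1 (κ := (-1, 0, 0)) (by norm_num) (σ := 1) (by simp)
    (A := fun k => q ^ cx k * qroot q (k.1 - cx k))
    (B := fun k => q ^ (cy k + 1) * qroot q (k.1 - (cy k + 1)))
    (d := fun k => qinv q (k.1)) (a := fun x => q ^ x)
    (b := fun y => q ^ (y + 1)) (C := q⁻¹ * (1 - q ^ 2)⁻¹) ?_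
    (fun k _ => abs_pow_mul_qroot_le hq0 hq1 _ _) (?_)
    (fun k _ => abs_pow_mul_qroot_le hq0 hq1 _ _) (?_) ?_
    (by simpa using expConst_pow hq0 hq1 0) (fun x => abs_pow_le hq0 hq1 _)
    (expConst_pow hq0 hq1 1) ?_ ?_
  · intro k hk
    obtain ⟨h1, h2, h3⟩ := dn_range hk
    rw [one_mul, preDn, weight_eq hq0 hq1 (N₁ := k.1 - cx k) (N₂ := k.1 - (cy k + 1)) (N₃ := k.1)
      (E := ((cx k + (cy k + 1) : ℕ) : ℝ)) (by omega) (by omega) (by omega)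
      (by
        push_cast [Nat.cast_sub (show cx k ≤ k.1 by omega),
          Nat.cast_sub (show cy k + 1 ≤ k.1 by omega)]
        ring)]
    rw [Real.rpow_natCast]
    ring
  · intro k hk
    obtain ⟨h1, h2, h3⟩ := dn_range hk
    exact abs_pow_mul_qroot_sub_le hq0 hq1 (by omega)
  · intro k hk
    obtain ⟨h1, h2, h3⟩ := dn_range hk
    exact abs_pow_mul_qroot_sub_le hq0 hq1 (by omega)
  · intro k hk
    obtain ⟨h1, h2, h3⟩ := dn_range hk
    exact abs_qinv_sub_one_le hq0 hq1 (by omega) (by omega)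
  · intro k hk h0
    obtain ⟨h1, h2, h3⟩ := dn_range hk
    have : ((k.1 : ℤ) - cx k) ≠ 0 := by
      intro e
      apply h0
      rw [e, sq_zero]
      simp
    have : ((k.1 : ℤ) - cy k - 1) ≠ 0 := by
      intro e
      apply h0
      rw [e, sq_zero]
      simp
    refine ⟨by dsimp only; omega, by dsimp only; omega, by dsimp only; omega,
      exists_isShift hk ?_ ?_ ?_ ?_ ?_⟩ <;> simp <;> omega
  · intro k hk e1 e2 e3
    obtain ⟨h1, h2, h3⟩ := dn_range hk
    dsimp only at e1 e2 e3
    obtain ⟨i, hi⟩ := exists_isShift (κ := -(-1, 0, 0)) hk (by simp; omega) (by simp)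
        (by simp; omega) (by simp) (by simp; omega)
    exact .inl ⟨i, by simpa using hi.symm⟩

theorem bPlus_up : TameStar (shiftOp true true
    (fun n x y => preUp q n x y * sq q (x + 1) *
      (q ^ (0 : ℝ) * sq q (n - y + 2) / qnum q (n + 2)))
    (fun n x y => (n + 1, x + 1, y))) := by
  refine shiftOp_mem hq0 hq1 (κ := (1, 1, 0)) (by norm_num) (σ := 1) (by simp)
    (A := fun k => qroot q (cx k + 1)) (B := fun k => q ^ (cy k) * qroot q (k.1 + 2 - cy k))
    (d := fun k => qinv q (k.1 + 2)) (a := fun x => qroot q (x + 1))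
    (b := fun y => q ^ (y)) (C := q⁻¹ * (1 - q ^ 2)⁻¹) ?_
    (fun k _ => abs_qroot_le hq0 _) (fun k _ => abs_sub_self_le hq0 hq1 _ _)
    (fun k _ => abs_pow_mul_qroot_le hq0 hq1 _ _) (?_) ?_
    (expConst_qroot hq0 hq1 1) (fun x => abs_qroot_le hq0 _)
    (by simpa using expConst_pow hq0 hq1 0) ?_ ?_
  · intro k hk
    obtain ⟨h1, h2, h3⟩ := up_range hk
    rw [one_mul, preUp, weight_eq hq0 hq1 (N₁ := cx k + 1) (N₂ := k.1 + 2 - cy k) (N₃ := k.1 + 2)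
      (E := (cy k : ℝ)) (by omega) (by omega) (by omega)
      (by
        push_cast [Nat.cast_sub (show cx k ≤ k.1 by omega),
          Nat.cast_sub (show cy k ≤ k.1 + 2 by omega)]
        ring)]
    rw [Real.rpow_natCast]
    ring
  · intro k hk
    obtain ⟨h1, h2, h3⟩ := up_range hk
    exact abs_pow_mul_qroot_sub_le hq0 hq1 (by omega)
  · intro k hk
    obtain ⟨h1, h2, h3⟩ := up_range hk
    exact abs_qinv_sub_one_le hq0 hq1 (by omega) (by omega)
  · intro k hk _
    obtain ⟨h1, h2, h3⟩ := up_range hk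
    refine ⟨by dsimp only; omega, by dsimp only; omega, by dsimp only; omega,
      exists_isShift hk ?_ ?_ ?_ ?_ ?_⟩ <;> simp <;> omega
  · intro k hk e1 e2 e3
    obtain ⟨h1, h2, h3⟩ := up_range hk
    dsimp only at e1 e2 e3
    -- at the largest possible value of `y` the label cannot be shifted back
    by_cases h4 : cy k + 1 = lvl k + true.toNat
    · refine .inr ?_
      rw [sub_zero, Int.toNat_natCast, abs_of_pos (by positivity)]
      exact pow_le_of_le hq0 hq1 (by simp at h4; omega)
    · refine .inl ?_
      simp only [Bool.toNat_true] at h4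
      obtain ⟨i, hi⟩ := exists_isShift (κ := -(1, 1, 0)) hk (by simp; omega) (by simp; omega)
        (by simp; omega) (by simp) (by simp; omega)
      exact ⟨i, by simpa using hi.symm⟩

theorem bPlus_dn : TameStar (shiftOp false false
    (fun n x y => preDn q n x y * sq q (x + 1) *
      (q ^ (-1 / 2 : ℝ) * sq q (n - y) / qnum q (n + 1)))
    (fun n x y => (n + 1, x + 1, y))) := by
  refine shiftOp_mem hq0 hq1 (κ := (1, 1, 0)) (by norm_num) (σ := 1) (by simp)
    (A := fun k => qroot q (cx k + 1)) (B := fun k => q ^ (cy k) * qroot q (k.1 - cy k))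
    (d := fun k => qinv q (k.1 + 1)) (a := fun x => qroot q (x + 1))
    (b := fun y => q ^ (y)) (C := q⁻¹ * (1 - q ^ 2)⁻¹) ?_
    (fun k _ => abs_qroot_le hq0 _) (fun k _ => abs_sub_self_le hq0 hq1 _ _)
    (fun k _ => abs_pow_mul_qroot_le hq0 hq1 _ _) (?_) ?_
    (expConst_qroot hq0 hq1 1) (fun x => abs_qroot_le hq0 _)
    (by simpa using expConst_pow hq0 hq1 0) ?_ ?_
  · intro k hk
    obtain ⟨h1, h2, h3⟩ := dn_range hk
    rw [one_mul, preDn, weight_eq hq0 hq1 (N₁ := cx k + 1) (N₂ := k.1 - cy k) (N₃ := k.1 + 1)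
      (E := (cy k : ℝ)) (by omega) (by omega) (by omega)
      (by
        push_cast [Nat.cast_sub (show cx k ≤ k.1 by omega),
          Nat.cast_sub (show cy k ≤ k.1 by omega)]
        ring)]
    rw [Real.rpow_natCast]
    ring
  · intro k hk
    obtain ⟨h1, h2, h3⟩ := dn_range hk
    exact abs_pow_mul_qroot_sub_le hq0 hq1 (by omega)
  · intro k hk
    obtain ⟨h1, h2, h3⟩ := dn_range hk
    exact abs_qinv_sub_one_le hq0 hq1 (by omega) (by omega)
  · intro k hk _
    obtain ⟨h1, h2, h3⟩ := dn_range hk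
    refine ⟨by dsimp only; omega, by dsimp only; omega, by dsimp only; omega,
      exists_isShift hk ?_ ?_ ?_ ?_ ?_⟩ <;> simp <;> omega
  · intro k hk e1 e2 e3
    obtain ⟨h1, h2, h3⟩ := dn_range hk
    dsimp only at e1 e2 e3
    -- at the largest possible value of `y` the label cannot be shifted back
    by_cases h4 : cy k + 1 = lvl k + false.toNat
    · refine .inr ?_
      rw [sub_zero, Int.toNat_natCast, abs_of_pos (by positivity)]
      exact pow_le_of_le hq0 hq1 (by simp at h4; omega)
    · refine .inl ?_
      simp only [Bool.toNat_false] at h4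
      obtain ⟨i, hi⟩ := exists_isShift (κ := -(1, 1, 0)) hk (by simp; omega) (by simp; omega)
        (by simp; omega) (by simp) (by simp; omega)
      exact ⟨i, by simpa using hi.symm⟩

theorem bMinus_up : TameStar (shiftOp true true
    (fun n x y => -(preUp q n x y * sq q (n - x) *
      (q ^ (-1 / 2 : ℝ) * sq q y / qnum q (n + 1))))
    (fun n x y => (n - 1, x, y - 1))) := by
  refine shiftOp_mem hq0 hq1 (κ := (-1, 0, -1)) (by norm_num) (σ := -1) (by simp)
    (A := fun k => q ^ cx k * qroot q (k.1 - cx k)) (B := fun k => qroot q (cy k))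
    (d := fun k => qinv q (k.1 + 1)) (a := fun x => q ^ x)
    (b := fun y => qroot q (y)) (C := q⁻¹ * (1 - q ^ 2)⁻¹) ?_
    (fun k _ => abs_pow_mul_qroot_le hq0 hq1 _ _) (?_)
    (fun k _ => abs_qroot_le hq0 _) (fun k _ => abs_sub_self_le hq0 hq1 _ _) ?_
    (by simpa using expConst_pow hq0 hq1 0) (fun x => abs_pow_le hq0 hq1 _)
    (by simpa using expConst_qroot hq0 hq1 0) ?_ ?_
  · intro k hk
    obtain ⟨h1, h2, h3⟩ := up_range hk
    rw [neg_one_mul, neg_inj, preUp, weight_eq hq0 hq1 (N₁ := k.1 - cx k) (N₂ := cy k)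
      (N₃ := k.1 + 1)
      (E := (cx k : ℝ)) (by omega) (by omega) (by omega)
      (by push_cast [Nat.cast_sub (show cx k ≤ k.1 by omega)]; ring)]
    rw [Real.rpow_natCast]
    ring
  · intro k hk
    obtain ⟨h1, h2, h3⟩ := up_range hk
    exact abs_pow_mul_qroot_sub_le hq0 hq1 (by omega)
  · intro k hk
    obtain ⟨h1, h2, h3⟩ := up_range hk
    exact abs_qinv_sub_one_le hq0 hq1 (by omega) (by omega)
  · intro k hk h0
    obtain ⟨h1, h2, h3⟩ := up_range hk
    have : ((k.1 : ℤ) - cx k) ≠ 0 := by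
      intro e
      apply h0
      rw [e, sq_zero]
      simp
    have : (cy k : ℤ) ≠ 0 := by
      intro e
      apply h0
      rw [e, sq_zero]
      simp
    refine ⟨by dsimp only; omega, by dsimp only; omega, by dsimp only; omega,
      exists_isShift hk ?_ ?_ ?_ ?_ ?_⟩ <;> simp <;> omega
  · intro k hk e1 e2 e3
    obtain ⟨h1, h2, h3⟩ := up_range hk
    dsimp only at e1 e2 e3
    obtain ⟨i, hi⟩ := exists_isShift (κ := -(-1, 0, -1)) hk (by simp; omega) (by simp)
        (by simp; omega) (by simp; omega) (by simp; omega)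
    exact .inl ⟨i, by simpa using hi.symm⟩

theorem bMinus_dn : TameStar (shiftOp false false
    (fun n x y => -(preDn q n x y * sq q (n - x) *
      (q ^ (0 : ℝ) * sq q y / qnum q n)))
    (fun n x y => (n - 1, x, y - 1))) := by
  refine shiftOp_mem hq0 hq1 (κ := (-1, 0, -1)) (by norm_num) (σ := -1) (by simp)
    (A := fun k => q ^ cx k * qroot q (k.1 - cx k)) (B := fun k => qroot q (cy k))
    (d := fun k => qinv q (k.1)) (a := fun x => q ^ x)
    (b := fun y => qroot q (y)) (C := q⁻¹ * (1 - q ^ 2)⁻¹) ?_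
    (fun k _ => abs_pow_mul_qroot_le hq0 hq1 _ _) (?_)
    (fun k _ => abs_qroot_le hq0 _) (fun k _ => abs_sub_self_le hq0 hq1 _ _) ?_
    (by simpa using expConst_pow hq0 hq1 0) (fun x => abs_pow_le hq0 hq1 _)
    (by simpa using expConst_qroot hq0 hq1 0) ?_ ?_
  · intro k hk
    obtain ⟨h1, h2, h3⟩ := dn_range hk
    rw [neg_one_mul, neg_inj, preDn, weight_eq hq0 hq1 (N₁ := k.1 - cx k) (N₂ := cy k) (N₃ := k.1)
      (E := (cx k : ℝ)) (by omega) (by omega) (by omega)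
      (by push_cast [Nat.cast_sub (show cx k ≤ k.1 by omega)]; ring)]
    rw [Real.rpow_natCast]
    ring
  · intro k hk
    obtain ⟨h1, h2, h3⟩ := dn_range hk
    exact abs_pow_mul_qroot_sub_le hq0 hq1 (by omega)
  · intro k hk
    obtain ⟨h1, h2, h3⟩ := dn_range hk
    exact abs_qinv_sub_one_le hq0 hq1 (by omega) (by omega)
  · intro k hk h0
    obtain ⟨h1, h2, h3⟩ := dn_range hk
    have : ((k.1 : ℤ) - cx k) ≠ 0 := by
      intro e
      apply h0
      rw [e, sq_zero]
      simp
    have : (cy k : ℤ) ≠ 0 := by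
      intro e
      apply h0
      rw [e, sq_zero]
      simp
    refine ⟨by dsimp only; omega, by dsimp only; omega, by dsimp only; omega,
      exists_isShift hk ?_ ?_ ?_ ?_ ?_⟩ <;> simp <;> omega
  · intro k hk e1 e2 e3
    obtain ⟨h1, h2, h3⟩ := dn_range hk
    dsimp only at e1 e2 e3
    obtain ⟨i, hi⟩ := exists_isShift (κ := -(-1, 0, -1)) hk (by simp; omega) (by simp)
        (by simp; omega) (by simp; omega) (by simp; omega)
    exact .inl ⟨i, by simpa using hi.symm⟩

/-- The part of `a₊` which changes the spin. As for the other generators, it preserves the level,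
although it changes `2j`, and its weights are of order `q^{2j}`. -/
theorem aPlus_cross : TameStar (shiftOp true (!true)
    (fun n x y => preUp q n x y * sq q (x + 1) *
      (q ^ (1 / 2 : ℝ) * sq q (n - y + 1) / (qnum q (n + 1) * qnum q (n + 2))))
    (fun n x y => (n + 1, x + 1, y))) := by
  refine shiftOp_smoothing hq0 hq1 (C := q⁻¹ * (1 - q ^ 2)⁻¹ *
    ((q⁻¹ - q) * ((1 - q ^ 2)⁻¹ * (1 - q ^ 2)⁻¹))) (fun k hk => ?_) fun k hk => ?_
  · obtain ⟨h1, h2, h3⟩ := up_range hk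
    rw [preUp, cross_weight_eq hq0 hq1 (N₁ := cx k + 1) (N₂ := k.1 + 1 - cy k) (N₃ := k.1 + 1)
      (N₄ := k.1 + 2) (E := ((cy k + k.1 + 2 : ℕ) : ℝ)) (by omega) (by omega) (by omega) (by omega)
      (by
        push_cast [Nat.cast_sub (show cx k ≤ k.1 by omega),
          Nat.cast_sub (show cy k ≤ k.1 + 1 by omega)]
        ring)]
    exact cross_weight_le hq0 hq1 rfl (by omega) (by omega) (by omega)
  · obtain ⟨h1, h2, h3⟩ := up_range hk
    simp
    omega

theorem aMinus_cross : TameStar (shiftOp false (!false)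
    (fun n x y => -(preDn q n x y * sq q (n - x) *
      (q ^ (1 / 2 : ℝ) * sq q (y + 1) / (qnum q n * qnum q (n + 1)))))
    (fun n x y => (n - 1, x, y + 1))) := by
  refine shiftOp_smoothing hq0 hq1 (C := q⁻¹ * (1 - q ^ 2)⁻¹ *
    ((q⁻¹ - q) * ((1 - q ^ 2)⁻¹ * (1 - q ^ 2)⁻¹))) (fun k hk => ?_) fun k hk => ?_
  · obtain ⟨h1, h2, h3⟩ := dn_range hk
    rw [abs_neg, preDn, cross_weight_eq hq0 hq1 (N₁ := k.1 - cx k) (N₂ := cy k + 1) (N₃ := k.1)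
      (N₄ := k.1 + 1) (E := ((cx k + k.1 + 1 : ℕ) : ℝ)) (by omega) (by omega) (by omega) (by omega)
      (by push_cast [Nat.cast_sub (show cx k ≤ k.1 by omega)]; ring)]
    exact cross_weight_le hq0 hq1 rfl (by omega) (by omega) (by omega)
  · obtain ⟨h1, h2, h3⟩ := dn_range hk
    simp
    omega

theorem bPlus_cross : TameStar (shiftOp true (!true)
    (fun n x y => -(preUp q n x y * sq q (x + 1) *
      (q ^ (-(n : ℝ) / 2 - 1) * sq q y / (qnum q (n + 1) * qnum q (n + 2)))))
    (fun n x y => (n + 1, x + 1, y - 1))) := by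
  refine shiftOp_smoothing hq0 hq1 (C := q⁻¹ * (1 - q ^ 2)⁻¹ *
    ((q⁻¹ - q) * ((1 - q ^ 2)⁻¹ * (1 - q ^ 2)⁻¹))) (fun k hk => ?_) fun k hk => ?_
  · obtain ⟨h1, h2, h3⟩ := up_range hk
    rw [abs_neg, preUp, cross_weight_eq hq0 hq1 (N₁ := cx k + 1) (N₂ := cy k) (N₃ := k.1 + 1)
      (N₄ := k.1 + 2) (E := ((k.1 + 1 : ℕ) : ℝ)) (by omega) (by omega) (by omega) (by omega)
      (by push_cast [Nat.cast_sub (show cx k ≤ k.1 by omega)]; ring)]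
    exact cross_weight_le hq0 hq1 rfl (by omega) (by omega) (by omega)
  · obtain ⟨h1, h2, h3⟩ := up_range hk
    simp
    omega

theorem bMinus_cross : TameStar (shiftOp false (!false)
    (fun n x y => -(preDn q n x y * sq q (n - x) *
      (q ^ ((n : ℝ) / 2) * sq q (n - y) / (qnum q n * qnum q (n + 1)))))
    (fun n x y => (n - 1, x, y))) := by
  refine shiftOp_smoothing hq0 hq1 (C := q⁻¹ * (1 - q ^ 2)⁻¹ *
    ((q⁻¹ - q) * ((1 - q ^ 2)⁻¹ * (1 - q ^ 2)⁻¹))) (fun k hk => ?_) fun k hk => ?_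
  · obtain ⟨h1, h2, h3⟩ := dn_range hk
    rw [abs_neg, preDn, cross_weight_eq hq0 hq1 (N₁ := k.1 - cx k) (N₂ := k.1 - cy k) (N₃ := k.1)
      (N₄ := k.1 + 1) (E := ((cx k + cy k + k.1 + 1 : ℕ) : ℝ)) (by omega) (by omega) (by omega)
      (by omega)
      (by
        push_cast [Nat.cast_sub (show cx k ≤ k.1 by omega),
          Nat.cast_sub (show cy k ≤ k.1 by omega)]
        ring)]
    exact cross_weight_le hq0 hq1 rfl (by omega) (by omega) (by omega)
  · obtain ⟨h1, h2, h3⟩ := dn_range hk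
    simp
    omega

end Generators

/-- The operator `a₊` is the sum of its parts from `↑` to `↑`, from `↓` to `↓`, and between the
spins. -/
theorem tameStar_aPlus {q : ℝ} (hq0 : 0 < q) (hq1 : q < 1) : TameStar (aPlus q) := by
  have h := (((aPlus_up hq0 hq1).add (aPlus_dn hq0 hq1)).add (aPlus_cross hq0 hq1))
  convert! h using 1
  refine op_ext fun i k => ?_
  rw [entry_add, entry_add, aPlus]
  simp only [shiftOp, entry_opOfBasis]
  cases hk : isUp k
  · simp [spinVec]
    ring
  · simp [spinVec]
    ring

theorem tameStar_aMinus {q : ℝ} (hq0 : 0 < q) (hq1 : q < 1) : TameStar (aMinus q) := by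
  have h := (((aMinus_up hq0 hq1).add (aMinus_dn hq0 hq1)).add (aMinus_cross hq0 hq1))
  convert! h using 1
  refine op_ext fun i k => ?_
  rw [entry_add, entry_add, aMinus]
  simp only [shiftOp, entry_opOfBasis]
  cases hk : isUp k
  · simp [spinVec]
    ring
  · simp [spinVec]
    ring

theorem tameStar_bPlus {q : ℝ} (hq0 : 0 < q) (hq1 : q < 1) : TameStar (bPlus q) := by
  have h := (((bPlus_up hq0 hq1).add (bPlus_dn hq0 hq1)).add (bPlus_cross hq0 hq1))
  convert! h using 1
  refine op_ext fun i k => ?_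
  rw [entry_add, entry_add, bPlus]
  simp only [shiftOp, entry_opOfBasis]
  cases hk : isUp k
  · simp [spinVec]
    ring
  · simp [spinVec]
    ring

theorem tameStar_bMinus {q : ℝ} (hq0 : 0 < q) (hq1 : q < 1) : TameStar (bMinus q) := by
  have h := (((bMinus_up hq0 hq1).add (bMinus_dn hq0 hq1)).add (bMinus_cross hq0 hq1))
  convert! h using 1
  refine op_ext fun i k => ?_
  rw [entry_add, entry_add, bMinus]
  simp only [shiftOp, entry_opOfBasis]
  cases hk : isUp k
  · simp [spinVec]
    ring
  · simp [spinVec]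
    ring

/-- The spinor representation consists of tame operators. Adjoints need to be considered for
the generators only. -/
theorem Alg_le_Tame {q : ℝ} (hq0 : 0 < q) (hq1 : q < 1) : Alg q ≤ Tame := by
  have ha : TameStar (piA q) := (tameStar_aPlus hq0 hq1).add (tameStar_aMinus hq0 hq1)
  have hb : TameStar (piB q) := (tameStar_bPlus hq0 hq1).add (tameStar_bMinus hq0 hq1)
  refine Algebra.adjoin_le ?_
  rintro T (rfl | rfl | rfl | rfl)
  exacts [ha.1, hb.1, ha.2, hb.2]

/-! ### Coboundaries in low degrees -/

section LowDegree

variable {R : Type} [Semiring R]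

theorem hochB_zero_apply (φ : Cochain R 0) (a : Fin 2 → R) :
    hochB φ a = φ ![a 0 * a 1] - φ ![a 1 * a 0] := by
  have h1 : Fin.contractNth (Fin.castSucc 0) (· * ·) a = ![a 0 * a 1] := by
    ext i; fin_cases i; rfl
  have h2 : (Fin.cons (a (Fin.last 1) * a 0) fun i : Fin 0 => a i.castSucc.succ) =
      ![a 1 * a 0] := by
    ext i; fin_cases i; rfl
  change (∑ j : Fin 1, (-1 : ℂ) ^ (j : ℕ) * φ (Fin.contractNth j.castSucc (· * ·) a)) +
    (-1 : ℂ) ^ (0 + 1) * φ (Fin.cons (a (Fin.last 1) * a 0) fun i : Fin 0 => a i.castSucc.succ) = _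
  simp only [Fin.sum_univ_one, h1, h2, Fin.val_zero]
  ring

theorem hochB_one_apply (φ : Cochain R 1) (a : Fin 3 → R) :
    hochB φ a = φ ![a 0 * a 1, a 2] - φ ![a 0, a 1 * a 2] + φ ![a 2 * a 0, a 1] := by
  have h0 : Fin.contractNth (Fin.castSucc 0) (· * ·) a = ![a 0 * a 1, a 2] := by
    ext i; fin_cases i <;> rfl
  have h1 : Fin.contractNth (Fin.castSucc 1) (· * ·) a = ![a 0, a 1 * a 2] := by
    ext i; fin_cases i <;> rfl
  have h2 : (Fin.cons (a (Fin.last 2) * a 0) fun i : Fin 1 => a i.castSucc.succ) =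
      ![a 2 * a 0, a 1] := by
    ext i; fin_cases i <;> rfl
  change (∑ j : Fin 2, (-1 : ℂ) ^ (j : ℕ) * φ (Fin.contractNth j.castSucc (· * ·) a)) +
    (-1 : ℂ) ^ (1 + 1) * φ (Fin.cons (a (Fin.last 2) * a 0) fun i : Fin 1 => a i.castSucc.succ) = _
  simp only [Fin.sum_univ_two, h0, h1, h2, Fin.val_zero, Fin.val_one]
  ring

theorem hochB_two_apply (φ : Cochain R 2) (a : Fin 4 → R) :
    hochB φ a = φ ![a 0 * a 1, a 2, a 3] - φ ![a 0, a 1 * a 2, a 3] + φ ![a 0, a 1, a 2 * a 3] -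
      φ ![a 3 * a 0, a 1, a 2] := by
  have h0 : Fin.contractNth (Fin.castSucc 0) (· * ·) a = ![a 0 * a 1, a 2, a 3] := by
    ext i; fin_cases i <;> rfl
  have h1 : Fin.contractNth (Fin.castSucc 1) (· * ·) a = ![a 0, a 1 * a 2, a 3] := by
    ext i; fin_cases i <;> rfl
  have h2 : Fin.contractNth (Fin.castSucc 2) (· * ·) a = ![a 0, a 1, a 2 * a 3] := by
    ext i; fin_cases i <;> rfl
  have h3 : (Fin.cons (a (Fin.last 3) * a 0) fun i : Fin 2 => a i.castSucc.succ) =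
      ![a 3 * a 0, a 1, a 2] := by
    ext i; fin_cases i <;> rfl
  change (∑ j : Fin 3, (-1 : ℂ) ^ (j : ℕ) * φ (Fin.contractNth j.castSucc (· * ·) a)) +
    (-1 : ℂ) ^ (2 + 1) * φ (Fin.cons (a (Fin.last 3) * a 0) fun i : Fin 2 => a i.castSucc.succ) = _
  simp only [Fin.sum_univ_three, h0, h1, h2, h3, Fin.val_zero, Fin.val_one, Fin.val_two]
  ring

theorem connesB_one_apply (φ : Cochain R 1) (a : Fin 1 → R) :
    connesB φ a = φ ![1, a 0] + φ ![a 0, 1] := by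
  have h1 : (Fin.cons 1 fun i : Fin 1 => a (i + 0)) = ![1, a 0] := by
    ext i; fin_cases i <;> rfl
  have h2 : (Fin.snoc (fun i : Fin 1 => a (i + 0)) 1 : Fin 2 → R) = ![a 0, 1] := by
    ext i; fin_cases i <;> rfl
  change (∑ j : Fin 1, (-1 : ℂ) ^ (0 * (j : ℕ)) *
    (φ (Fin.cons 1 fun i => a (i + j)) - (-1 : ℂ) ^ (0 + 1) *
      φ (Fin.snoc (fun i => a (i + j)) 1))) = _
  simp only [Fin.sum_univ_one, h1, h2, Fin.val_zero]
  ring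

theorem connesB_two_apply (φ : Cochain R 2) (a : Fin 2 → R) :
    connesB φ a = φ ![1, a 0, a 1] - φ ![a 0, a 1, 1] - φ ![1, a 1, a 0] + φ ![a 1, a 0, 1] := by
  have h1 : (Fin.cons 1 fun i : Fin 2 => a (i + 0)) = ![1, a 0, a 1] := by
    ext i; fin_cases i <;> rfl
  have h2 : (Fin.snoc (fun i : Fin 2 => a (i + 0)) 1 : Fin 3 → R) = ![a 0, a 1, 1] := by
    ext i; fin_cases i <;> rfl
  have h3 : (Fin.cons 1 fun i : Fin 2 => a (i + 1)) = ![1, a 1, a 0] := by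
    ext i; fin_cases i <;> rfl
  have h4 : (Fin.snoc (fun i : Fin 2 => a (i + 1)) 1 : Fin 3 → R) = ![a 1, a 0, 1] := by
    ext i; fin_cases i <;> rfl
  change (∑ j : Fin 2, (-1 : ℂ) ^ (1 * (j : ℕ)) *
    (φ (Fin.cons 1 fun i => a (i + j)) - (-1 : ℂ) ^ (1 + 1) *
      φ (Fin.snoc (fun i => a (i + j)) 1))) = _
  simp only [Fin.sum_univ_two, h1, h2, h3, h4, Fin.val_zero, Fin.val_one]
  ring

theorem hochB_zero (n : ℕ) : hochB (0 : Cochain R n) = 0 := by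
  ext a
  simp [hochB]

theorem connesB_zero (n : ℕ) : connesB (0 : Cochain R (n + 1)) = 0 := by
  ext a
  simp [connesB, cyclicN, connesB0]

theorem hochB_add {n : ℕ} (φ ψ : Cochain R n) : hochB (φ + ψ) = hochB φ + hochB ψ := by
  ext a
  simp only [hochB, Pi.add_apply, mul_add, Finset.sum_add_distrib]
  ring

theorem hochB_neg {n : ℕ} (φ : Cochain R n) : hochB (-φ) = -hochB φ := by
  ext a
  simp only [hochB, Pi.neg_apply, mul_neg, Finset.sum_neg_distrib]
  ring

theorem connesB_neg {n : ℕ} (φ : Cochain R (n + 1)) : connesB (-φ) = -connesB φ := by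
  ext a
  simp only [connesB, cyclicN, connesB0, Pi.neg_apply, mul_neg, ← Finset.sum_neg_distrib]
  refine Finset.sum_congr rfl fun j _ => ?_
  ring

theorem hochB_hochB_zero (φ : Cochain R 0) : hochB (hochB φ) = 0 := by
  ext a
  rw [hochB_one_apply, hochB_zero_apply, hochB_zero_apply, hochB_zero_apply]
  simp [mul_assoc]

end LowDegree

/-! ### Residues of commutators with the Dirac operator -/

theorem F_mul_F : F * F = 1 := by
  rw [F_eq, diag_mul_diag, ← diag_one]
  congr 1
  ext i
  split_ifs <;> norm_num

theorem F_mul_absD : F * absD = absD * F := by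
  rw [F_eq, absD_eq, diag_mul_diag, diag_mul_diag]
  congr 1
  ext i
  ring

theorem δ_F : δ F = 0 := by
  rw [δ, comm, F_mul_absD, sub_self]

theorem δ_zero : δ 0 = 0 := by
  rw [δ, comm, mul_zero, zero_mul, sub_self]

theorem δ_one : δ 1 = 0 := by
  rw [δ, comm, one_mul, mul_one, sub_self]

theorem δ_mul_F (T : Op) : δ (T * F) = δ T * F := by
  rw [δ_mul, δ_F, mul_zero, add_zero]

theorem δ_mul_absD (T : Op) : δ (T * absD) = δ T * absD := by
  simp only [δ, comm, sub_mul, mul_assoc]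

theorem absD_mul_absDPow (k : ℕ) : absD * absDPow (-((k + 1 : ℕ) : ℂ)) = absDPow (-(k : ℂ)) := by
  rw [absD_eq, absDPow_eq, absDPow_eq, diag_mul_diag]
  congr 1
  ext i
  have h : (lvl i : ℂ) + 1 / 2 ≠ 0 := by
    rw [natCast_add_half_eq_ofReal]
    exact Complex.ofReal_ne_zero.2 (by positivity)
  have e : -(k : ℂ) = 1 + -((k + 1 : ℕ) : ℂ) := by push_cast; ring
  rw [e, Complex.cpow_add _ _ h, Complex.cpow_one]

theorem resPow_congr {S T : Op} (h : IsSmoothing (S - T)) (k : ℕ) : resPow k S = resPow k T := by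
  rw [← sub_eq_zero, ← map_sub, resPow_smoothing h]

/-- The diagonal entries of `[|D|, T]` vanish. -/
theorem resPow_δ {T : Op} (hT : T ∈ Tame) (k : ℕ) : resPow k (δ T) = 0 := by
  have h : HasQuadExpansion (δ T) 0 0 0 := by
    refine ⟨(isBanded_of_tame (δ_mem hT)).bdd, ExpSmall.of_nonpos fun m => ?_⟩
    have : levelTrace (δ T) m = 0 := Finset.sum_eq_zero fun i _ => by
      rw [entry_δ, sub_self, zero_mul]
    simp [this]
  rw [h.resPow_eq]
  simp

theorem isNCInt_mul_absDPow {T : Op} (hT : T ∈ Tame) (k : ℕ) :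
    IsNCInt (T * absDPow (-k)) (resPow k T) :=
  isNCInt_resLin (mul_absDPow_mem hT k)

theorem isNCInt_mul_absDPow_one {T : Op} (hT : T ∈ Tame) :
    IsNCInt (T * absDPow (-1)) (resPow 1 T) := by
  simpa using isNCInt_mul_absDPow hT 1

theorem isNCInt_mul_absDPow_two {T : Op} (hT : T ∈ Tame) :
    IsNCInt (T * absDPow (-2)) (resPow 2 T) := by
  simpa using isNCInt_mul_absDPow hT 2

theorem isNCInt_mul_absDPow_three {T : Op} (hT : T ∈ Tame) :
    IsNCInt (T * absDPow (-3)) (resPow 3 T) := by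
  simpa using isNCInt_mul_absDPow hT 3

theorem comm_D_eq (T : Op) : comm D T = F * δ T + comm F T * absD := by
  rw [D_eq]
  simp only [comm, δ, mul_sub, sub_mul, mul_assoc]
  abel

theorem comm_D_mem {T : Op} (hT : T ∈ Tame) : comm D T ∈ Tame := by
  rw [comm_D_eq]
  exact add_mem (mul_mem F_mem (δ_mem hT)) (comm_F_smoothing hT).mul_absD.mem

/-- Up to smoothing operators `[D, T]` is `δ(T) F`. -/
theorem comm_D_sub_smoothing {T : Op} (hT : T ∈ Tame) : IsSmoothing (comm D T - δ T * F) := by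
  have e : comm D T - δ T * F = comm F (δ T) + comm F T * absD := by
    rw [comm_D_eq, comm, comm]
    abel
  rw [e]
  exact (comm_F_smoothing (δ_mem hT)).add (comm_F_smoothing hT).mul_absD

theorem nabla_eq (T : Op) : nabla T = (2 : ℂ) • (δ T * absD) + δ (δ T) := by
  have e : D * D = absD * absD := by
    rw [D_eq, mul_assoc, ← mul_assoc absD, ← F_mul_absD, mul_assoc, ← mul_assoc, F_mul_F, one_mul]
  rw [nabla, e, two_smul]
  simp only [comm, δ]
  noncomm_ring

/-- Since `∇(X) = 2 δ(X) |D| + δ²(X)`, an operator `∇` costs one power of `|D|`. -/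
theorem isNCInt_nabla {A X : Op} (hA : A ∈ Tame) (hX : X ∈ Tame) :
    IsNCInt (A * nabla X * absDPow (-3)) (2 * resPow 2 (A * δ X) + resPow 3 (A * δ (δ X))) := by
  have h2 := absD_mul_absDPow 2
  have e : A * nabla X * absDPow (-3) = (2 : ℂ) • (A * δ X * absDPow (-(2 : ℕ))) +
      A * δ (δ X) * absDPow (-(3 : ℕ)) := by
    rw [← h2, nabla_eq, mul_add, add_mul, mul_smul_comm, smul_mul_assoc]
    simp only [mul_assoc]
    norm_num
  have h := isNCInt_resLin (add_mem
    (Submodule.smul_mem _ (2 : ℂ) (mul_absDPow_mem (mul_mem hA (δ_mem hX)) 2))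
    (mul_absDPow_mem (mul_mem hA (δ_mem (δ_mem hX))) 3))
  rw [map_add, map_smul, smul_eq_mul] at h
  rw [e]
  exact h

/-- Of the terms of `∇²(X) = 4 δ²(X) |D|² + 4 δ³(X) |D| + δ⁴(X)` only the first one has a
residue. -/
theorem isNCInt_nabla_nabla {A X : Op} (hA : A ∈ Tame) (hX : X ∈ Tame) :
    IsNCInt (A * nabla (nabla X) * absDPow (-5)) (4 * resPow 3 (A * δ (δ X))) := by
  have h3 := absD_mul_absDPow 3
  have h4 := absD_mul_absDPow 4
  have e0 : nabla (nabla X) = (4 : ℂ) • (δ (δ X) * absD * absD) + (4 : ℂ) • (δ (δ (δ X)) * absD) +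
      δ (δ (δ (δ X))) := by
    simp only [nabla_eq, δ_add, δ_smul, δ_mul_absD, add_mul, smul_mul_assoc]
    module
  have e : A * nabla (nabla X) * absDPow (-5) =
      (4 : ℂ) • (A * δ (δ X) * absDPow (-(3 : ℕ))) +
      (4 : ℂ) • (A * δ (δ (δ X)) * absDPow (-(4 : ℕ))) +
      A * δ (δ (δ (δ X))) * absDPow (-(5 : ℕ)) := by
    rw [← h3, ← h4, e0, mul_add, mul_add, add_mul, add_mul, mul_smul_comm, mul_smul_comm,
      smul_mul_assoc, smul_mul_assoc]
    simp only [mul_assoc]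
    norm_num
  have m2 := δ_mem (δ_mem hX)
  have h := isNCInt_resLin (add_mem (add_mem
    (Submodule.smul_mem _ (4 : ℂ) (mul_absDPow_mem (mul_mem hA m2) 3))
    (Submodule.smul_mem _ (4 : ℂ) (mul_absDPow_mem (mul_mem hA (δ_mem m2)) 4)))
    (mul_absDPow_mem (mul_mem hA (δ_mem (δ_mem m2))) 5))
  rw [map_add, map_add, map_smul, map_smul, smul_eq_mul, smul_eq_mul, ← resPow_apply,
    ← resPow_apply, ← resPow_apply, resPow_of_four_le (mul_mem hA (δ_mem m2)) le_rfl,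
    resPow_of_four_le (mul_mem hA (δ_mem (δ_mem m2))) (by norm_num), mul_zero, add_zero,
    add_zero] at h
  rw [e]
  exact h

/-! ### The trace defect of an almost central operator -/

theorem comm_P_eq (T : Op) : comm P T = (1 / 2 : ℂ) • comm F T := by
  simp only [comm, P, smul_mul_assoc, mul_smul_comm, ← smul_sub, add_mul, mul_add, one_mul,
    mul_one, add_sub_add_left_eq_sub]

/-- If `E` commutes with tame operators up to smoothing ones, the commutator formula for
`[b, E a]` expresses the failure of the trace property of `a ↦ Tr(E a |D|^{-z})|_{z=0}` by
residues and by the trace of the smoothing operator `a [E, b]`. -/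
theorem zetaLin_comm {E A B : Op} (hE : E ∈ Tame) (hcomm : ∀ T ∈ Tame, IsSmoothing (comm E T))
    (hA : A ∈ Tame) (hB : B ∈ Tame) :
    zetaLin (E * (A * B)) - zetaLin (E * (B * A)) =
      resPow 1 (A * δ B * E) - 1 / 2 * resPow 2 (A * δ (δ B) * E) +
        1 / 3 * resPow 3 (A * δ (δ (δ B)) * E) - opTrace (A * comm E B) := by
  have hc := (commutatorFormula hB (mul_mem hE hA)).1
  have hr : ∀ (k : ℕ) {X : Op}, X ∈ Tame → resPow k (E * A * X) = resPow k (A * X * E) := by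
    intro k X hX
    refine resPow_congr ?_ k
    rw [mul_assoc]
    exact hcomm _ (mul_mem hA hX)
  rw [hr 1 (δ_mem hB), hr 2 (δ_mem (δ_mem hB)), hr 3 (δ_mem (δ_mem (δ_mem hB)))] at hc
  have hs := (hcomm B hB).mul_banded (isBanded_of_tame hA)
  have e : E * (B * A) = B * (E * A) + comm E B * A := by
    rw [comm]
    noncomm_ring
  rw [e, map_add, zetaLin_smoothing hs, opTrace_mul_comm (hcomm B hB) (isBanded_of_tame hA),
    ← mul_assoc]
  linear_combination -hc

/-! ### The highest residue as a closed graded trace -/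

/-- The functional `T ↦ ⨍ T F |D|^{-3}`. -/
def topRes : Op →ₗ[ℂ] ℂ := resPow 3 ∘ₗ LinearMap.mulRight ℂ F

theorem topRes_apply (T : Op) : topRes T = resPow 3 (T * F) := rfl

/-- The highest residue is a trace, and `F` commutes with tame operators up to smoothing ones. -/
theorem topRes_mul_comm {A B : Op} (hA : A ∈ Tame) (hB : B ∈ Tame) :
    topRes (A * B) = topRes (B * A) := by
  rw [topRes_apply, topRes_apply, mul_assoc, (commutatorFormula hA (mul_mem hB F_mem)).2]
  refine resPow_congr ?_ 3
  have e : B * F * A - B * A * F = B * comm F A := by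
    rw [comm]
    noncomm_ring
  rw [e]
  exact (isBanded_of_tame hB).mul_smoothing (comm_F_smoothing hA)

theorem topRes_δ {T : Op} (hT : T ∈ Tame) : topRes (δ T) = 0 := by
  rw [topRes_apply, ← δ_mul_F, resPow_δ (mul_mem hT F_mem)]

/-- Integration by parts. -/
theorem topRes_δ_mul {A B : Op} (hA : A ∈ Tame) (hB : B ∈ Tame) :
    topRes (δ A * B) = -topRes (A * δ B) := by
  have h := topRes_δ (mul_mem hA hB)
  rw [δ_mul, map_add] at h
  linear_combination h

/-! ### Values of the cochains -/

/-- A telescoping identity which compares `a b' c' d'` with `a b c d u`, for `b'`, `c'`, `d'` close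
to `b u`, `c u`, `d u`, where `u² = 1`. -/
theorem mul_sub_mul_of_sq_eq_one {R : Type*} [Ring R] {u : R} (hu : u * u = 1)
    (a b c d b' c' d' : R) : a * b' * c' * d' - a * b * c * d * u =
      a * ((b' - b * u) * (c' * d')) + a * b * u * ((c' - c * u) * d') +
      a * b * u * c * u * (d' - d * u) + a * b * ((u * c - c * u) * (u * d * u)) := by
  have e : a * b * c * d * u = a * b * c * (u * u) * d * u := by rw [hu, mul_one]
  rw [e]
  noncomm_ring

theorem χ₁_apply {q : ℝ} (a b : Alg q) : χ₁ q ![a, b] = opTrace (a * comm F (b : Op)) := rfl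

section Values

variable {q : ℝ} (hq0 : 0 < q) (hq1 : q < 1)
include hq0 hq1

theorem coe_mem_Tame (a : Alg q) : (a : Op) ∈ Tame := Alg_le_Tame hq0 hq1 a.2

theorem isSmoothing_mul_comm_F (a b : Alg q) : IsSmoothing ((a : Op) * comm F (b : Op)) :=
  (isBanded_of_tame (coe_mem_Tame hq0 hq1 a)).mul_smoothing
    (comm_F_smoothing (coe_mem_Tame hq0 hq1 b))

theorem φ₀_apply (a : Alg q) : φ₀ q ![a] = zetaLin (F * a) :=
  (isZetaZero_zetaLin (mul_mem F_mem (coe_mem_Tame hq0 hq1 a))).zetaZero_eq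

theorem φ₀'_apply (a : Alg q) : φ₀' q ![a] = zetaLin a :=
  (isZetaZero_zetaLin (coe_mem_Tame hq0 hq1 a)).zetaZero_eq

theorem β_apply (a : Alg q) : β q ![a] = 2 * zetaLin (P * a) :=
  congrArg (2 * ·) (isZetaZero_zetaLin (mul_mem P_mem (coe_mem_Tame hq0 hq1 a))).zetaZero_eq

theorem β_eq : β q = φ₀ q + φ₀' q := by
  ext a
  obtain ⟨a, rfl⟩ : ∃ b, a = ![b] := ⟨a 0, by ext i; fin_cases i; rfl⟩
  rw [Pi.add_apply, β_apply hq0 hq1, φ₀_apply hq0 hq1, φ₀'_apply hq0 hq1, P, smul_mul_assoc,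
    map_smul, add_mul, one_mul, map_add, smul_eq_mul]
  ring

theorem isNCInt_φ₂ (a b c : Alg q) :
    IsNCInt (a * δ b * δ (δ c) * F * absDPow (-3)) (topRes (a * δ b * δ (δ (c : Op)))) :=
  have h := coe_mem_Tame hq0 hq1
  isNCInt_mul_absDPow_three (mul_mem (mul_mem (mul_mem (h a) (δ_mem (h b)))
    (δ_mem (δ_mem (h c)))) F_mem)

theorem φ₂_apply (a b c : Alg q) :
    φ₂ q ![a, b, c] = 1 / 24 * topRes (a * δ b * δ (δ (c : Op))) :=
  congrArg (1 / 24 * ·) (isNCInt_φ₂ hq0 hq1 a b c).ncInt_eq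

theorem isNCInt_φ₃ (a b c d : Alg q) :
    IsNCInt (a * comm D b * comm D c * comm D d * absDPow (-3))
      (resPow 3 (a * comm D b * comm D c * comm D (d : Op))) :=
  have h := coe_mem_Tame hq0 hq1
  isNCInt_mul_absDPow_three (mul_mem (mul_mem (mul_mem (h a) (comm_D_mem (h b)))
    (comm_D_mem (h c))) (comm_D_mem (h d)))

/-- As `[D, a]` is `δ(a) F` up to smoothing operators, the third component of the local cocycle
involves `F³ = F`. -/
theorem φ₃_apply (a b c d : Alg q) :
    φ₃ q ![a, b, c, d] = 1 / 12 * topRes (a * δ b * δ c * δ (d : Op)) := by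
  have h := coe_mem_Tame hq0 hq1
  refine congrArg (1 / 12 * ·) ((isNCInt_φ₃ hq0 hq1 a b c d).ncInt_eq.trans ?_)
  rw [topRes_apply]
  refine resPow_congr ?_ 3
  set A : Op := (a : Op)
  set B : Op := δ b
  set C : Op := δ c
  set E : Op := δ d
  have mA : IsBanded A := isBanded_of_tame (h a)
  have mC : C ∈ Tame := δ_mem (h c)
  have mB : B ∈ Tame := δ_mem (h b)
  have mE : E ∈ Tame := δ_mem (h d)
  have m1 := comm_D_mem (h c)
  have m2 := comm_D_mem (h d)
  have e : A * comm D b * comm D c * comm D d - A * B * C * E * F =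
      A * ((comm D b - B * F) * (comm D c * comm D d)) +
      A * B * F * ((comm D c - C * F) * comm D d) +
      A * B * F * C * F * (comm D d - E * F) + A * B * (comm F C * (F * E * F)) :=
    mul_sub_mul_of_sq_eq_one F_mul_F A B C E _ _ _
  rw [e]
  refine IsSmoothing.add (IsSmoothing.add (IsSmoothing.add ?_ ?_) ?_) ?_
  · exact mA.mul_smoothing ((comm_D_sub_smoothing (h b)).mul_banded
      (isBanded_of_tame (mul_mem m1 m2)))
  · exact (isBanded_of_tame (mul_mem (mul_mem (h a) mB) F_mem)).mul_smoothing
      ((comm_D_sub_smoothing (h c)).mul_banded (isBanded_of_tame m2))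
  · exact (isBanded_of_tame (mul_mem (mul_mem (mul_mem (mul_mem (h a) mB) F_mem) mC)
      F_mem)).mul_smoothing (comm_D_sub_smoothing (h d))
  · exact (isBanded_of_tame (mul_mem (h a) mB)).mul_smoothing ((comm_F_smoothing mC).mul_banded
      (isBanded_of_tame (mul_mem (mul_mem F_mem mE) F_mem)))

theorem isNCInt_φ₁_zero (a b : Alg q) : IsNCInt (a * comm D b * absDPow (-1))
    (resPow 1 (a * comm D (b : Op))) :=
  isNCInt_mul_absDPow_one (mul_mem (coe_mem_Tame hq0 hq1 a) (comm_D_mem (coe_mem_Tame hq0 hq1 b)))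

/-- The first component of the local cocycle in terms of `δ`; the coefficient of the last term is
`-1/4 + 4/8 = 1/4`. -/
theorem φ₁_apply (a b : Alg q) : φ₁ q ![a, b] =
    resPow 1 (a * δ b * F) - 1 / 2 * resPow 2 (a * δ (δ b) * F) +
      1 / 4 * topRes (a * δ (δ (δ (b : Op)))) := by
  have ha := coe_mem_Tame hq0 hq1 a
  have hb := coe_mem_Tame hq0 hq1 b
  have hX := comm_D_mem hb
  have s0 := comm_D_sub_smoothing hb
  have s1 : IsSmoothing (δ (comm D b) - δ (δ b) * F) := by
    have e : δ (comm D b) - δ (δ b) * F = δ (comm D b - δ b * F) := by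
      rw [sub_eq_add_neg (comm D b), ← neg_one_smul ℂ (δ b * F), δ_add, δ_smul, δ_mul_F,
        neg_one_smul, ← sub_eq_add_neg]
    rw [e]
    exact s0.δ
  have s2 : IsSmoothing (δ (δ (comm D b)) - δ (δ (δ b)) * F) := by
    have e : δ (δ (comm D b)) - δ (δ (δ b)) * F = δ (δ (comm D b) - δ (δ b) * F) := by
      rw [sub_eq_add_neg (δ (comm D b)), ← neg_one_smul ℂ (δ (δ b) * F), δ_add, δ_smul, δ_mul_F,
        neg_one_smul, ← sub_eq_add_neg]
    rw [e]
    exact s1.δ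
  have hr : ∀ (k : ℕ) {X Y : Op}, IsSmoothing (X - Y * F) →
      resPow k (a * X) = resPow k (a * Y * F) := by
    intro k X Y hXY
    refine resPow_congr ?_ k
    rw [mul_assoc, ← mul_sub]
    exact (isBanded_of_tame ha).mul_smoothing hXY
  have h1 := (isNCInt_φ₁_zero hq0 hq1 a b).ncInt_eq
  have h2 := (isNCInt_nabla ha hX).ncInt_eq
  have h3 := (isNCInt_nabla_nabla ha hX).ncInt_eq
  rw [hr 1 s0] at h1
  rw [hr 2 s1, hr 3 s2] at h2
  rw [hr 3 s2] at h3
  change ncInt (a * comm D b * absDPow (-1)) - 1 / 4 * ncInt (a * nabla (comm D b) * absDPow (-3))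
    + 1 / 8 * ncInt (a * nabla (nabla (comm D b)) * absDPow (-5)) = _
  rw [h1, h2, h3, topRes_apply]
  ring

theorem isNCInt_ψ₁ (a b : Alg q) :
    IsNCInt (a * δ b * P * absDPow (-1)) (resPow 1 (a * δ (b : Op) * P)) ∧
    IsNCInt (a * δ (δ b) * P * absDPow (-2)) (resPow 2 (a * δ (δ (b : Op)) * P)) ∧
    IsNCInt (a * δ (δ (δ b)) * P * absDPow (-3)) (resPow 3 (a * δ (δ (δ (b : Op))) * P)) := by
  have ha := coe_mem_Tame hq0 hq1 a
  have hb := coe_mem_Tame hq0 hq1 b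
  exact ⟨isNCInt_mul_absDPow_one (mul_mem (mul_mem ha (δ_mem hb)) P_mem),
    isNCInt_mul_absDPow_two (mul_mem (mul_mem ha (δ_mem (δ_mem hb))) P_mem),
    isNCInt_mul_absDPow_three (mul_mem (mul_mem ha (δ_mem (δ_mem (δ_mem hb)))) P_mem)⟩

theorem ψ₁_apply (a b : Alg q) : ψ₁ q ![a, b] =
    2 * resPow 1 (a * δ (b : Op) * P) - resPow 2 (a * δ (δ (b : Op)) * P) +
      2 / 3 * resPow 3 (a * δ (δ (δ (b : Op))) * P) := by
  obtain ⟨h1, h2, h3⟩ := isNCInt_ψ₁ hq0 hq1 a b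
  rw [← h1.ncInt_eq, ← h2.ncInt_eq, ← h3.ncInt_eq]
  rfl

/-! ### The cochain identities -/

/-- By the Leibniz rule for `δ` and the trace property, `b φ₂` is `1/24` times
`2 ⨍ a₀ δ(a₁) δ(a₂) δ(a₃) F |D|^{-3}`. -/
theorem φ₃_eq_hochB : φ₃ q = hochB (φ₂ q) := by
  have h := coe_mem_Tame hq0 hq1
  ext x
  obtain ⟨a, b, c, d, rfl⟩ : ∃ a b c d, x = ![a, b, c, d] :=
    ⟨x 0, x 1, x 2, x 3, by ext i; fin_cases i <;> rfl⟩
  rw [hochB_two_apply, φ₃_apply hq0 hq1]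
  change _ = φ₂ q ![a * b, c, d] - φ₂ q ![a, b * c, d] + φ₂ q ![a, b, c * d] - φ₂ q ![d * a, b, c]
  rw [φ₂_apply hq0 hq1, φ₂_apply hq0 hq1, φ₂_apply hq0 hq1, φ₂_apply hq0 hq1]
  simp only [MulMemClass.coe_mul]
  have hc : topRes (d * a * δ b * δ (δ c)) = topRes (a * δ b * δ (δ (c : Op)) * d) := by
    rw [topRes_mul_comm (mul_mem (mul_mem (h a) (δ_mem (h b))) (δ_mem (δ_mem (h c)))) (h d)]
    simp only [mul_assoc]
  rw [hc]
  simp only [δ_mul, δ_add, mul_add, add_mul, map_add, mul_assoc]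
  ring

/-- Two integrations by parts. -/
theorem connesB_φ₂ (a b : Alg q) :
    connesB (φ₂ q) ![a, b] = -(1 / 12) * topRes (a * δ (δ (δ (b : Op)))) := by
  have ha := coe_mem_Tame hq0 hq1 a
  have hb := coe_mem_Tame hq0 hq1 b
  rw [connesB_two_apply]
  change φ₂ q ![1, a, b] - φ₂ q ![a, b, 1] - φ₂ q ![1, b, a] + φ₂ q ![b, a, 1] = _
  rw [φ₂_apply hq0 hq1, φ₂_apply hq0 hq1, φ₂_apply hq0 hq1, φ₂_apply hq0 hq1]
  simp only [OneMemClass.coe_one, δ_one, one_mul]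
  have e1 := topRes_δ_mul ha (δ_mem (δ_mem hb))
  have e2 := topRes_mul_comm (δ_mem hb) (δ_mem (δ_mem ha))
  have e3 := topRes_δ_mul (δ_mem ha) (δ_mem hb)
  have e4 := topRes_δ_mul ha (δ_mem (δ_mem hb))
  rw [δ_zero, mul_zero, mul_zero, map_zero]
  linear_combination 1 / 24 * e1 - 1 / 24 * (e2 + e3) + 1 / 24 * e4

/-- This is `zetaLin_comm` for `E = P`. -/
theorem χ₁_eq_ψ₁_sub : χ₁ q = ψ₁ q - hochB (β q) := by
  ext x
  obtain ⟨a, b, rfl⟩ : ∃ a b, x = ![a, b] := ⟨x 0, x 1, by ext i; fin_cases i <;> rfl⟩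
  rw [Pi.sub_apply, hochB_zero_apply, ψ₁_apply hq0 hq1, χ₁_apply]
  change _ = _ - (β q ![a * b] - β q ![b * a])
  rw [β_apply hq0 hq1, β_apply hq0 hq1]
  have h := zetaLin_comm P_mem (fun T hT => by
    rw [comm_P_eq]
    exact (comm_F_smoothing hT).smul _) (coe_mem_Tame hq0 hq1 a) (coe_mem_Tame hq0 hq1 b)
  have hs := isSmoothing_mul_comm_F hq0 hq1 a b
  rw [comm_P_eq, mul_smul_comm, ← zetaLin_smoothing (hs.smul _), map_smul, zetaLin_smoothing hs,
    smul_eq_mul] at h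
  simp only [MulMemClass.coe_mul]
  linear_combination 2 * h

/-- This is `zetaLin_comm` for `E = F`, whose last coefficient `1/3` differs from the `1/4` of `φ₁`
by the `1/12` of `B φ₂`. -/
theorem φ₁_eq : φ₁ q = χ₁ q + (hochB (φ₀ q) + connesB (φ₂ q)) := by
  ext x
  obtain ⟨a, b, rfl⟩ : ∃ a b, x = ![a, b] := ⟨x 0, x 1, by ext i; fin_cases i <;> rfl⟩
  rw [Pi.add_apply, Pi.add_apply, connesB_φ₂ hq0 hq1, hochB_zero_apply, φ₁_apply hq0 hq1,
    χ₁_apply]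
  change _ = _ + (φ₀ q ![a * b] - φ₀ q ![b * a] + _)
  rw [φ₀_apply hq0 hq1, φ₀_apply hq0 hq1]
  have h := zetaLin_comm F_mem (fun T hT => comm_F_smoothing hT) (coe_mem_Tame hq0 hq1 a)
    (coe_mem_Tame hq0 hq1 b)
  simp only [MulMemClass.coe_mul, topRes_apply] at h ⊢
  linear_combination -h

/-- The operator `[F, a]` is a derivation in `a`, and it is smoothing. -/
theorem hochB_χ₁ : hochB (χ₁ q) = 0 := by
  ext x
  obtain ⟨a, b, c, rfl⟩ : ∃ a b c, x = ![a, b, c] :=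
    ⟨x 0, x 1, x 2, by ext i; fin_cases i <;> rfl⟩
  rw [hochB_one_apply, Pi.zero_apply]
  change χ₁ q ![a * b, c] - χ₁ q ![a, b * c] + χ₁ q ![c * a, b] = 0
  have hs := isSmoothing_mul_comm_F hq0 hq1
  have hc := isBanded_of_tame (coe_mem_Tame hq0 hq1 c)
  have h1 := (hs (a * b) c).add ((hs a b).mul_banded hc)
  have e1 : ((a * b : Alg q) : Op) * comm F c + a * comm F b * c =
      a * comm F ((b * c : Alg q) : Op) := by
    simp only [MulMemClass.coe_mul, comm]
    noncomm_ring
  have e2 : ((c * a : Alg q) : Op) * comm F b = c * (a * comm F b) := mul_assoc _ _ _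
  rw [χ₁_apply, χ₁_apply, χ₁_apply, e2, ← opTrace_mul_comm (hs a b) hc, ← e1,
    ← zetaLin_smoothing h1, map_add, zetaLin_smoothing (hs (a * b) c),
    zetaLin_smoothing ((hs a b).mul_banded hc)]
  ring

theorem hochB_ψ₁ : hochB (ψ₁ q) = 0 := by
  have h : ψ₁ q = χ₁ q + hochB (β q) := by rw [χ₁_eq_ψ₁_sub hq0 hq1, sub_add_cancel]
  rw [h, hochB_add, hochB_χ₁ hq0 hq1, hochB_hochB_zero, add_zero]

theorem connesB_ψ₁ : connesB (ψ₁ q) = 0 := by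
  ext x
  obtain ⟨a, rfl⟩ : ∃ a, x = ![a] := ⟨x 0, by ext i; fin_cases i; rfl⟩
  -- `ψ₁(1, a)` is the trace of `[F, a]`, whose diagonal entries vanish
  have h1 : ψ₁ q ![1, a] = 0 := by
    have h := congrFun (χ₁_eq_ψ₁_sub hq0 hq1) ![1, a]
    rw [Pi.sub_apply, hochB_zero_apply, χ₁_apply] at h
    change _ = _ - (β q ![1 * a] - β q ![a * 1]) at h
    rw [one_mul, mul_one, sub_self, sub_zero] at h
    rw [← h, OneMemClass.coe_one, one_mul]
    refine (tsum_congr fun i => ?_).trans tsum_zero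
    rw [comm, entry_sub, F_eq, entry_diag_mul, entry_mul_diag]
    ring
  rw [connesB_one_apply]
  change ψ₁ q ![1, a] + ψ₁ q ![a, 1] = 0
  rw [h1, ψ₁_apply hq0 hq1]
  simp [δ_one, δ_zero]

end Values

end QSU2

end

theorem mainTheorem5 (q : ℝ) (hq0 : 0 < q) (hq1 : q < 1) :
    -- all traces and residues in the cochains below exist
    ((∀ a₀ a₁ : QSU2.Alg q,
        QSU2.IsTraceClass (a₀ * QSU2.comm QSU2.F a₁) ∧
        (∃ r, QSU2.IsNCInt (a₀ * QSU2.comm QSU2.D a₁ * QSU2.absDPow (-1)) r) ∧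
        (∃ r, QSU2.IsNCInt
          (a₀ * QSU2.nabla (QSU2.comm QSU2.D a₁) * QSU2.absDPow (-3)) r) ∧
        (∃ r, QSU2.IsNCInt
          (a₀ * QSU2.nabla (QSU2.nabla (QSU2.comm QSU2.D a₁)) * QSU2.absDPow (-5)) r) ∧
        (∃ r, QSU2.IsNCInt (a₀ * QSU2.δ a₁ * QSU2.P * QSU2.absDPow (-1)) r) ∧
        (∃ r, QSU2.IsNCInt (a₀ * QSU2.δ (QSU2.δ a₁) * QSU2.P * QSU2.absDPow (-2)) r) ∧
        (∃ r, QSU2.IsNCInt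
          (a₀ * QSU2.δ (QSU2.δ (QSU2.δ a₁)) * QSU2.P * QSU2.absDPow (-3)) r)) ∧
      (∀ a₀ a₁ a₂ : QSU2.Alg q, ∃ r, QSU2.IsNCInt
        (a₀ * QSU2.δ a₁ * QSU2.δ (QSU2.δ a₂) * QSU2.F * QSU2.absDPow (-3)) r) ∧
      (∀ a₀ a₁ a₂ a₃ : QSU2.Alg q, ∃ r, QSU2.IsNCInt
        (a₀ * QSU2.comm QSU2.D a₁ * QSU2.comm QSU2.D a₂ * QSU2.comm QSU2.D a₃ *
          QSU2.absDPow (-3)) r) ∧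
      (∀ a : QSU2.Alg q,
        (∃ r, QSU2.IsZetaZero a r) ∧ (∃ r, QSU2.IsZetaZero (QSU2.F * a) r) ∧
        (∃ r, QSU2.IsZetaZero (QSU2.P * a) r))) ∧
    -- `φ_odd = ψ₁ - (b + B) φ'_ev`
    QSU2.φOdd q = QSU2.inDegreeOne (QSU2.ψ₁ q) - QSU2.totalBoundary (QSU2.φEv' q) ∧
    -- `φ_odd = χ₁ + (b + B) φ_ev`
    QSU2.φOdd q = QSU2.inDegreeOne (QSU2.χ₁ q) + QSU2.totalBoundary (QSU2.φEv q) ∧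
    -- `χ₁ = ψ₁ - b β`
    QSU2.χ₁ q = QSU2.ψ₁ q - QSU2.hochB (QSU2.β q) ∧
    -- `ψ₁` is a `(b, B)`-cocycle
    QSU2.totalBoundary (QSU2.inDegreeOne (QSU2.ψ₁ q)) = 0 := by
  open QSU2 in
  have hmem := coe_mem_Tame hq0 hq1
  have hχ := χ₁_eq_ψ₁_sub hq0 hq1
  have h1 := φ₁_eq hq0 hq1
  have h3 := φ₃_eq_hochB hq0 hq1
  have h2' : φ₂' q = -φ₂ q := by
    ext a
    simp only [φ₂', φ₂, Pi.neg_apply, neg_mul]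
  refine ⟨⟨fun a b => ⟨isTraceClass_of_summable (isSmoothing_mul_comm_F hq0 hq1 a b).summable,
    ⟨_, isNCInt_φ₁_zero hq0 hq1 a b⟩, ⟨_, isNCInt_nabla (hmem a) (comm_D_mem (hmem b))⟩,
    ⟨_, isNCInt_nabla_nabla (hmem a) (comm_D_mem (hmem b))⟩, ⟨_, (isNCInt_ψ₁ hq0 hq1 a b).1⟩,
    ⟨_, (isNCInt_ψ₁ hq0 hq1 a b).2.1⟩, ⟨_, (isNCInt_ψ₁ hq0 hq1 a b).2.2⟩⟩,
    fun a b c => ⟨_, isNCInt_φ₂ hq0 hq1 a b c⟩, fun a b c d => ⟨_, isNCInt_φ₃ hq0 hq1 a b c d⟩,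
    fun a => ⟨⟨_, isZetaZero_zetaLin (hmem a)⟩, ⟨_, isZetaZero_zetaLin (mul_mem F_mem (hmem a))⟩,
      ⟨_, isZetaZero_zetaLin (mul_mem P_mem (hmem a))⟩⟩⟩, ?_, ?_, hχ, ?_⟩
  · funext n
    match n with
    | 0 =>
      change 0 = 0 - connesB 0
      rw [connesB_zero, sub_zero]
    | 1 =>
      change φ₁ q = ψ₁ q - (hochB (φ₀' q) + connesB (φ₂' q))
      rw [h1, hχ, β_eq hq0 hq1, hochB_add, h2', connesB_neg]
      abel
    | 2 =>
      change 0 = 0 - (hochB 0 + connesB 0)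
      rw [hochB_zero, connesB_zero, add_zero, sub_zero]
    | 3 =>
      change φ₃ q = 0 - (hochB (φ₂' q) + connesB 0)
      rw [h3, h2', hochB_neg, connesB_zero, add_zero, zero_sub, neg_neg]
    | n + 4 =>
      change 0 = 0 - (hochB 0 + connesB 0)
      rw [hochB_zero, connesB_zero, add_zero, sub_zero]
  · funext n
    match n with
    | 0 =>
      change 0 = 0 + connesB 0
      rw [connesB_zero, add_zero]
    | 1 => exact h1
    | 2 =>
      change 0 = 0 + (hochB 0 + connesB 0)
      rw [hochB_zero, connesB_zero, add_zero, add_zero]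
    | 3 =>
      change φ₃ q = 0 + (hochB (φ₂ q) + connesB 0)
      rw [h3, connesB_zero, add_zero, zero_add]
    | n + 4 =>
      change 0 = 0 + (hochB 0 + connesB 0)
      rw [hochB_zero, connesB_zero, add_zero, add_zero]
  · funext n
    match n with
    | 0 => exact connesB_ψ₁ hq0 hq1
    | 1 =>
      change hochB 0 + connesB 0 = 0
      rw [hochB_zero, connesB_zero, add_zero]
    | 2 =>
      change hochB (ψ₁ q) + connesB 0 = 0
      rw [hochB_ψ₁ hq0 hq1, connesB_zero, add_zero]
    | n + 3 =>
      change hochB 0 + connesB 0 = 0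
      rw [hochB_zero, connesB_zero, add_zero]
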